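/- Let $\mathcal M$ be a finite-dimensional von Neumann algebra with a faithful positive trace $\operatorname{tr}$, let $\mathcal N_1,\mathcal N_2\subset\mathcal M$ be (unital $*$-)subalgebras and $\mathcal N=\mathcal N_1\cap\mathcal N_2$. Let $E_{\mathcal N}:\mathcal M\to\mathcal N$ and $E_i:\mathcal M\to\mathcal N_i$ ($i=1,2$) be conditional expectations (completely positive unital maps onto the subalgebra that fix it pointwise and are bimodule maps over it) with $E_{\mathcal N}\circ E_1=E_{\mathcal N}\circ E_2=E_{\mathcal N}$, and let $E_{\mathcal N*},E_{i*}$ be their adjoints for the trace pairing, $\operatorname{tr}(E_*(X)Y)=\operatorname{tr}(XE(Y))$. A state is a $\rho\ge0$ in $\mathcal M$ with $\operatorname{tr}\rho=1$, and $D(\rho\|\omega)=\operatorname{tr}(\rho\ln\rho-\rho\ln\omega)$ if $\operatorname{supp}\rho\subseteq\operatorname{supp}\omega$, $+\infty$ otherwise. Let $\sigma$ be a full-rank state with $E_{\mathcal N*}(\sigma)=\sigma$, and let $$\lambda=\|E_1\circ E_2-E_{\mathcal N}:L_2(\sigma)\to L_2(\sigma)\|,\qquad \|X\|_{L_2(\sigma)}^2=\int_0^1\operatorname{tr}(X^\dagger\sigma^sX\sigma^{1-s})\,ds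 .$$ Let $C_\tau(\mathcal M:\mathcal N)=\inf\{c>0:\ \rho\le c\,E_{\mathcal N*}(\rho)\text{ for all states }\rho\in\mathcal M\}$, and let $C_{\tau,\mathrm{cb}}(\mathcal M:\mathcal N)$ be the supremum over $n\in\mathbb N$ of the same quantity for $E_{\mathcal N}\otimes\operatorname{id}_{\mathbb M_n}$ on $\mathcal M\otimes\mathbb M_n$. Then $\lambda<1$, $C_\tau(\mathcal M:\mathcal N)$ and $C_{\tau,\mathrm{cb}}(\mathcal M:\mathcal N)$ are finite, and: 1. The inequality $$D(\rho\|E_{\mathcal N*}(\rho))\le c\,\big(D(\rho\|E_{1*}(\rho))+D(\rho\|E_{2*}(\rho))\big)\qquad\text{for all states }\rho\in\mathcal M$$ holds with $c=\dfrac{2\,C_\tau(\mathcal M:\mathcal N)}{(1-\lambda)^2}$; conversely, unless $\mathcal N_1=\mathcal N_2=\mathcal N$, every real $c$ for which it holds satisfies $c\ge\dfrac1{1-\lambda^2}$. 2. The inequality $$D(\rho\|(E_{\mathcal N*}\otimes\operatorname{id})(\rho))\le c_{\mathrm{cb}}\big(D(\rho\|(E_{1*}\otimes\operatorname{id})(\rho))+D(\rho\|(E_{2*}\otimes\operatorname{id})(\rho))\big)\qquad\text{for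 all }n\in\mathbb N\text{ and all states }\rho\in\mathcal M\otimes\mathbb M_n$$ holds with $c_{\mathrm{cb}}=\dfrac{2\,C_{\tau,\mathrm{cb}}(\mathcal M:\mathcal N)}{(1-\lambda)^2}$; conversely, unless $\mathcal N_1=\mathcal N_2=\mathcal N$, every real $c_{\mathrm{cb}}$ for which it holds satisfies $c_{\mathrm{cb}}\ge\dfrac1{1-\lambda^2}$. -/

import Mathlib

open scoped ENNReal

noncomputable section

/-- A faithful positive trace on a C⋆-algebra `A` (finite-dimensional C⋆-algebras are exactly the
finite-dimensional von Neumann algebras): a linear functional with `tr (x y) = tr (y x)` and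
`tr (x⋆ x) > 0` for every `x ≠ 0`. -/
structure FaithfulTrace (A : Type*) [CStarAlgebra A] extends A →ₗ[ℂ] ℂ where
  tracial : ∀ x y : A, toFun (x * y) = toFun (y * x)
  im_eq_zero : ∀ x : A, (toFun (star x * x)).im = 0
  re_pos : ∀ x : A, x ≠ 0 → 0 < (toFun (star x * x)).re

namespace FaithfulTrace

section Basic

variable {A : Type*} [CStarAlgebra A]

instance : CoeFun (FaithfulTrace A) (fun _ => A → ℂ) := ⟨fun t => t.toLinearMap⟩

/-- The bilinear form `(x, y) ↦ tr (x y)`. -/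
def form (tr : FaithfulTrace A) : LinearMap.BilinForm ℂ A :=
  (LinearMap.mul ℂ A).compr₂ tr.toLinearMap

@[simp] theorem form_apply (tr : FaithfulTrace A) (x y : A) : tr.form x y = tr (x * y) := rfl

theorem form_nondegenerate (tr : FaithfulTrace A) : tr.form.Nondegenerate := by
  constructor
  · intro x hx
    by_contra hne
    have h := tr.re_pos x hne
    have h2 : tr (x * star x) = 0 := hx (star x)
    have h3 : tr (star x * x) = 0 := (tr.tracial _ _).trans h2
    have h4 : (tr (star x * x)).re = 0 := by rw [h3]; rfl
    exact absurd h4 h.ne'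
  · intro x hx
    by_contra hne
    have h := tr.re_pos x hne
    have h3 : tr (star x * x) = 0 := hx (star x)
    have h4 : (tr (star x * x)).re = 0 := by rw [h3]; rfl
    exact absurd h4 h.ne'

/-- The predual map `E_*` of `E`, that is the adjoint of `E` for the trace pairing:
`tr (E_*(X) Y) = tr (X E(Y))`. The predual of `A` is identified with `A` through `tr`. -/
def predual [FiniteDimensional ℂ A] (tr : FaithfulTrace A) (E : A →ₗ[ℂ] A) : A →ₗ[ℂ] A :=
  tr.form.leftAdjointOfNondegenerate tr.form_nondegenerate E

theorem predual_spec [FiniteDimensional ℂ A] (tr : FaithfulTrace A) (E : A →ₗ[ℂ] A) (X Y : A) :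
    tr (tr.predual E X * Y) = tr (X * E Y) :=
  LinearMap.BilinForm.isAdjointPairLeftAdjointOfNondegenerate tr.form tr.form_nondegenerate E X Y

end Basic

section Amplification

variable {A : Type*} [CStarAlgebra A] [PartialOrder A] [StarOrderedRing A]

/-- The amplified trace `tr ⊗ tr` on `A ⊗ 𝕄ₙ`, realised as the `n × n` matrices over `A`:
`X ↦ ∑ i, tr (X i i)`. -/
def amplify (tr : FaithfulTrace A) (n : ℕ) : FaithfulTrace (CStarMatrix (Fin n) (Fin n) A) where
  toFun X := ∑ i, tr (X i i)
  map_add' X Y := by simp [Finset.sum_add_distrib]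
  map_smul' c X := by simp [Finset.mul_sum]
  tracial X Y := by
    simp only [CStarMatrix.mul_apply, map_sum]
    rw [Finset.sum_comm]
    exact Finset.sum_congr rfl fun i _ => Finset.sum_congr rfl fun j _ => tr.tracial _ _
  im_eq_zero X := by
    simp only [CStarMatrix.mul_apply, map_sum, Complex.im_sum, CStarMatrix.star_apply]
    exact Finset.sum_eq_zero fun i _ => Finset.sum_eq_zero fun j _ => tr.im_eq_zero _
  re_pos X hX := by
    have hnn : ∀ x : A, 0 ≤ (tr (star x * x)).re := fun x => by
      by_cases h : x = 0
      · simp [h]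
      · exact (tr.re_pos x h).le
    obtain ⟨i, j, hij⟩ : ∃ i j, X i j ≠ 0 := by
      by_contra! h
      exact hX (CStarMatrix.ext fun i j => h i j)
    simp only [CStarMatrix.mul_apply, map_sum, Complex.re_sum, CStarMatrix.star_apply]
    refine Finset.sum_pos' (fun _ _ => Finset.sum_nonneg fun _ _ => hnn _)
      ⟨j, Finset.mem_univ _, Finset.sum_pos' (fun _ _ => hnn _) ⟨i, Finset.mem_univ _, ?_⟩⟩
    exact tr.re_pos _ hij

end Amplification

end FaithfulTrace

instance CStarMatrix.finiteDimensional_fin {A : Type*} [CStarAlgebra A] [FiniteDimensional ℂ A]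
    (n : ℕ) : FiniteDimensional ℂ (CStarMatrix (Fin n) (Fin n) A) :=
  inferInstanceAs (FiniteDimensional ℂ (Matrix (Fin n) (Fin n) A))

/-- The amplification `Φ ⊗ id` on `A ⊗ 𝕄ₙ`: apply `Φ` to every entry. -/
abbrev ampl {A : Type*} [CStarAlgebra A] (n : ℕ) (Φ : A →ₗ[ℂ] A) :
    CStarMatrix (Fin n) (Fin n) A →ₗ[ℂ] CStarMatrix (Fin n) (Fin n) A :=
  CStarMatrix.mapₗ Φ

/-- `(E ⊗ id)_* = E_* ⊗ id`. -/
theorem FaithfulTrace.predual_ampl {A : Type*} [CStarAlgebra A] [PartialOrder A]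
    [StarOrderedRing A] [FiniteDimensional ℂ A]
    (tr : FaithfulTrace A) (n : ℕ) (E : A →ₗ[ℂ] A) :
    (tr.amplify n).predual (ampl n E) = ampl n (tr.predual E) := by
  symm
  refine (LinearMap.BilinForm.isAdjointPair_iff_eq_of_nondegenerate _
    (tr.amplify n).form_nondegenerate _ _).1 fun X Y => ?_
  change ∑ i, tr ((ampl n (tr.predual E) X * Y) i i) = ∑ i, tr ((X * ampl n E Y) i i)
  simp [CStarMatrix.mul_apply, FaithfulTrace.predual_spec]

section Ordered

variable {A : Type*} [CStarAlgebra A] [PartialOrder A] [StarOrderedRing A]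

/-- `E` is a conditional expectation of `A` onto the subalgebra `N`: a completely positive unital
map with values in `N` that fixes `N` pointwise and satisfies `E (a X b) = a E(X) b` for
`a, b ∈ N`. -/
structure IsConditionalExpectation (N : StarSubalgebra ℂ A) (E : A →ₗ[ℂ] A) : Prop where
  completelyPositive : ∀ (n : ℕ) (X : CStarMatrix (Fin n) (Fin n) A), 0 ≤ X → 0 ≤ ampl n E X
  unital : E 1 = 1
  mem : ∀ X, E X ∈ N
  fixes : ∀ a ∈ N, E a = a
  bimodule : ∀ a ∈ N, ∀ b ∈ N, ∀ X, E (a * X * b) = a * E X * b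

/-- The support projection of a self-adjoint element (of a finite-dimensional algebra). -/
def supportProj (a : A) : A := cfc (fun x : ℝ => if x = 0 then 0 else 1) a

namespace FaithfulTrace

/-- States, as density operators: `ρ ≥ 0` and `tr ρ = 1`. -/
def IsState (tr : FaithfulTrace A) (ρ : A) : Prop := 0 ≤ ρ ∧ tr ρ = 1

open Classical in
/-- The relative entropy `D(ρ‖σ) = tr (ρ ln ρ - ρ ln σ)` if `supp ρ ≤ supp σ`, and `+∞` otherwise.
Since `Real.log 0 = 0`, the usual convention `0 ln 0 = 0` holds. -/
def relEntropy (tr : FaithfulTrace A) (ρ σ : A) : EReal :=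
  if supportProj ρ ≤ supportProj σ then
    (((tr (ρ * CFC.log ρ - ρ * CFC.log σ)).re : ℝ) : EReal)
  else ⊤

/-- The norm of `L₂(σ)`: `‖X‖_σ² = ∫₀¹ tr (X⋆ σˢ X σ¹⁻ˢ) ds`. -/
def l2Norm (tr : FaithfulTrace A) (σ X : A) : ℝ :=
  √(∫ s in (0 : ℝ)..1, (tr (star X * σ ^ s * X * σ ^ (1 - s))).re)

/-- The operator norm of `T : L₂(σ) → L₂(σ)`. -/
def l2OpNorm (tr : FaithfulTrace A) (σ : A) (T : A →ₗ[ℂ] A) : ℝ :=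
  sInf {K : ℝ | 0 ≤ K ∧ ∀ X, tr.l2Norm σ (T X) ≤ K * tr.l2Norm σ X}

/-- The index `C(E) = inf {c > 0 | ρ ≤ c E_*(ρ) for all states ρ}`, in `[0, ∞]`. -/
def index [FiniteDimensional ℂ A] (tr : FaithfulTrace A) (E : A →ₗ[ℂ] A) : ℝ≥0∞ :=
  ⨅ (c : ℝ) (_ : 0 < c ∧ ∀ ρ, tr.IsState ρ → ρ ≤ c • tr.predual E ρ), ENNReal.ofReal c

/-- The completely bounded index `C_cb(E) = sup_n C(E ⊗ id_{𝕄ₙ})`. -/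
def cbIndex [FiniteDimensional ℂ A] (tr : FaithfulTrace A) (E : A →ₗ[ℂ] A) : ℝ≥0∞ :=
  ⨆ n : ℕ, (tr.amplify n).index (ampl n E)

/-- `D(ρ‖Φ(ρ)) ≤ c (D(ρ‖Φ₁(ρ)) + D(ρ‖Φ₂(ρ)))` for all states `ρ`. -/
def ApproxTensorization (tr : FaithfulTrace A) (Φ Φ₁ Φ₂ : A →ₗ[ℂ] A) (c : ℝ) : Prop :=
  ∀ ρ, tr.IsState ρ →
    tr.relEntropy ρ (Φ ρ) ≤ (c : EReal) * (tr.relEntropy ρ (Φ₁ ρ) + tr.relEntropy ρ (Φ₂ ρ))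

/-- The same inequality for `Φ ⊗ id`, `Φ₁ ⊗ id`, `Φ₂ ⊗ id` and all states on `A ⊗ 𝕄ₙ`, for every
`n`, with one constant `c`. -/
def CompleteApproxTensorization (tr : FaithfulTrace A) (Φ Φ₁ Φ₂ : A →ₗ[ℂ] A) (c : ℝ) : Prop :=
  ∀ n : ℕ, (tr.amplify n).ApproxTensorization (ampl n Φ) (ampl n Φ₁) (ampl n Φ₂) c

end FaithfulTrace

end Ordered

end

/-! Upper bound. Put `ω = E_*(ρ)` for a faithful state `ρ`, let `Γ` be the weight `X ↦ ∫ ωˢ X ω¹⁻ˢ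
ds` of `L₂(ω)`, and let `Y = Γ⁻¹(ρ - ω)`. The tangent inequality for resolvents, integrated, gives
`D(ρ‖ω) ≤ ‖Y‖²` (`relEnt_le`). All three conditional expectations are orthogonal projections on
`L₂(ω)` (`l2Form_condExp_comm`), `E Y = 0`, and `Γ⁻¹(ρ - E_{i*}ρ) = Y - E_i Y`. Two-projection
geometry (`l2Form_gap`) gives `(1 - λ)‖Y‖² ≤ ‖Y - E₁Y‖² + ‖Y - E₂Y‖²`. Finally `ρ` and `E_{i*}ρ`
both lie below `c ω`, and an exact integral formula for relative entropy (`relEnt_eq`) with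
antitonicity of inversion yields `‖Y - E_iY‖² ≤ 2c D(ρ‖E_{i*}ρ)` (`l2Form_le_relEnt`).

The number `λ` is computed at `σ`, whereas the gap is needed at `ω`, and on `M ⊗ 𝕄ₙ`. The operator
`S = E₂E₁E₂ - E` is self-adjoint on `L₂` of every faithful invariant state, and for a self-adjoint
operator the growth rate of the matrix coefficients of `Sᵐ` controls the quadratic form. That rate
does not involve the state and survives amplification (`abs_inner_sandwich_pow_le`, `growth_ampl`,
`l2Form_sandwich_self_le`), so `λ` serves everywhere. Compactness gives `λ < 1`; a finite
quasi-basis of `E` bounds the index uniformly in `n` (`exists_isFrame`, `IsFrame.ampl`). Arbitrary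
states are reached by mixing with `σ` and passing to the limit.

Lower bound. For self-adjoint `Y` with `E Y = 0` and `E₂ Y = Y`, the states `σ + ε Γ_σ(Y)` have
`D(ρ‖E_{2*}ρ) = 0`. The `ε²` terms of the remaining two entropies give `‖Y‖² ≤ c (‖Y‖² - ‖E₁Y‖²)` in
`L₂(σ)`, that is `λ² ≤ 1 - 1/c`. -/

noncomputable section

/-! ### Spectral projections and double operator sums -/

section Spectral

variable {A : Type*} [CStarAlgebra A] [FiniteDimensional ℂ A]

theorem finite_real_spectrum (a : A) : (spectrum ℝ a).Finite := by
  have : FiniteDimensional ℝ A := FiniteDimensional.complexToReal A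
  have hi : IsIntegral ℝ a := Algebra.IsIntegral.isIntegral a
  have h0 := minpoly.ne_zero hi
  refine ((minpoly ℝ a).roots.toFinset.finite_toSet).subset fun x hx => ?_
  have h1 := spectrum.subset_polynomial_aeval a (minpoly ℝ a) ⟨x, hx, rfl⟩
  rw [minpoly.aeval] at h1
  have : Nontrivial A := by
    by_contra hA
    rw [not_nontrivial_iff_subsingleton] at hA
    simp [spectrum.of_subsingleton] at hx
  rw [spectrum.zero_eq] at h1
  simpa [h0] using h1

theorem continuousOn_real_spectrum (a : A) (f : ℝ → ℝ) : ContinuousOn f (spectrum ℝ a) :=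
  (finite_real_spectrum a).continuousOn f

/-- The real spectrum as a finite set. -/
def realSpec (a : A) : Finset ℝ := (finite_real_spectrum a).toFinset

@[simp] theorem mem_realSpec {a : A} {x : ℝ} : x ∈ realSpec a ↔ x ∈ spectrum ℝ a := by
  simp [realSpec]

/-- The spectral projection of `a` for the eigenvalue `x`. -/
def specProj (a : A) (x : ℝ) : A := cfc (fun y : ℝ => if y = x then 1 else 0) a

omit [FiniteDimensional ℂ A] in
theorem isSelfAdjoint_specProj (a : A) (x : ℝ) : IsSelfAdjoint (specProj a x) := cfc_predicate _ _

omit [FiniteDimensional ℂ A] in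
@[simp] theorem star_specProj (a : A) (x : ℝ) : star (specProj a x) = specProj a x :=
  isSelfAdjoint_specProj a x

theorem specProj_mul (a : A) (x y : ℝ) :
    specProj a x * specProj a y = if x = y then specProj a x else 0 := by
  rw [specProj, specProj, ← cfc_mul _ _ _ (continuousOn_real_spectrum _ _)
    (continuousOn_real_spectrum _ _)]
  split_ifs with h
  · subst h; congr 1; ext z; simp
  · rw [← cfc_zero ℝ a]
    congr 1; ext z
    by_cases h1 : z = x <;> by_cases h2 : z = y <;> simp_all

theorem cfc_eq_sum_specProj (f : ℝ → ℝ) {a : A} (ha : IsSelfAdjoint a) :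
    cfc f a = ∑ x ∈ realSpec a, f x • specProj a x := by
  simp_rw [specProj, ← cfc_const_mul _ _ _ (continuousOn_real_spectrum _ _)]
  rw [← cfc_sum _ _ _ (fun _ _ => continuousOn_real_spectrum _ _)]
  refine cfc_congr fun z hz => ?_
  simp [Finset.sum_apply, hz]

theorem sum_specProj {a : A} (ha : IsSelfAdjoint a) : ∑ x ∈ realSpec a, specProj a x = 1 := by
  have := cfc_eq_sum_specProj (fun _ => 1) ha
  rw [cfc_const_one ℝ a] at this
  simpa using this.symm

/-- The double operator sum `X ↦ ∑ k(x, y) P_x X Q_y` over the spectral projections of `a` and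
`b`. -/
def doubleOp (k : ℝ → ℝ → ℝ) (a b : A) : A →ₗ[ℂ] A :=
  ∑ x ∈ realSpec a, ∑ y ∈ realSpec b,
    (k x y : ℂ) • (LinearMap.mulLeft ℂ (specProj a x) ∘ₗ LinearMap.mulRight ℂ (specProj b y))

theorem doubleOp_apply (k : ℝ → ℝ → ℝ) (a b X : A) :
    doubleOp k a b X = ∑ x ∈ realSpec a, ∑ y ∈ realSpec b,
      k x y • (specProj a x * X * specProj b y) := by
  simp [doubleOp, LinearMap.sum_apply, mul_assoc]

theorem doubleOp_congr {k k' : ℝ → ℝ → ℝ} {a b : A}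
    (h : ∀ x ∈ spectrum ℝ a, ∀ y ∈ spectrum ℝ b, k x y = k' x y) :
    doubleOp k a b = doubleOp k' a b := by
  refine Finset.sum_congr rfl fun x hx => Finset.sum_congr rfl fun y hy => ?_
  rw [h x (mem_realSpec.1 hx) y (mem_realSpec.1 hy)]

theorem doubleOp_add (k k' : ℝ → ℝ → ℝ) (a b X : A) :
    doubleOp (fun x y => k x y + k' x y) a b X = doubleOp k a b X + doubleOp k' a b X := by
  simp [doubleOp_apply, add_smul, Finset.sum_add_distrib]

theorem doubleOp_const_mul (c : ℝ) (k : ℝ → ℝ → ℝ) (a b X : A) :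
    doubleOp (fun x y => c * k x y) a b X = c • doubleOp k a b X := by
  simp [doubleOp_apply, mul_smul, Finset.smul_sum]

theorem doubleOp_sub (k k' : ℝ → ℝ → ℝ) (a b X : A) :
    doubleOp (fun x y => k x y - k' x y) a b X = doubleOp k a b X - doubleOp k' a b X := by
  simp [doubleOp_apply, sub_smul, Finset.sum_sub_distrib]

theorem specProj_mul_doubleOp_mul (k : ℝ → ℝ → ℝ) (a b X : A) {x y : ℝ}
    (hx : x ∈ spectrum ℝ a) (hy : y ∈ spectrum ℝ b) :
    specProj a x * doubleOp k a b X * specProj b y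
      = k x y • (specProj a x * X * specProj b y) := by
  have h : ∀ x' y', specProj a x * (k x' y' • (specProj a x' * X * specProj b y')) * specProj b y
      = if x = x' then (if y' = y then k x' y' • (specProj a x * X * specProj b y') else 0)
        else 0 := by
    intro x' y'
    have : specProj a x * (k x' y' • (specProj a x' * X * specProj b y')) * specProj b y
      = k x' y' • ((specProj a x * specProj a x') * X * (specProj b y' * specProj b y)) := by
      simp only [mul_smul_comm, smul_mul_assoc, mul_assoc]
    rw [this, specProj_mul, specProj_mul]
    split_ifs <;> simp
  rw [doubleOp_apply]
  simp only [Finset.mul_sum, Finset.sum_mul, h]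
  rw [Finset.sum_eq_single x, Finset.sum_eq_single y]
  · simp
  · intro y' _ hne; simp [hne]
  · intro h'; exact absurd (mem_realSpec.2 hy) h'
  · intro x' _ hne
    refine Finset.sum_eq_zero fun y' _ => ?_
    rw [if_neg (Ne.symm hne)]
  · intro h'; exact absurd (mem_realSpec.2 hx) h'

/-- Orthogonality of the spectral projections leaves one term per block. Identities between left and
right multiplications thereby become scalar identities on pairs of eigenvalues. -/
theorem doubleOp_doubleOp (k k' : ℝ → ℝ → ℝ) (a b X : A) :
    doubleOp k a b (doubleOp k' a b X) = doubleOp (fun x y => k x y * k' x y) a b X := by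
  rw [doubleOp_apply, doubleOp_apply (fun x y => k x y * k' x y)]
  refine Finset.sum_congr rfl fun x hx => Finset.sum_congr rfl fun y hy => ?_
  rw [specProj_mul_doubleOp_mul _ _ _ _ (mem_realSpec.1 hx) (mem_realSpec.1 hy), smul_smul]

theorem doubleOp_mul {a b : A} (f g : ℝ → ℝ) (ha : IsSelfAdjoint a) (hb : IsSelfAdjoint b) (X : A) :
    doubleOp (fun x y => f x * g y) a b X = cfc f a * X * cfc g b := by
  rw [cfc_eq_sum_specProj f ha, cfc_eq_sum_specProj g hb, doubleOp_apply]
  simp only [Finset.sum_mul, Finset.mul_sum]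
  rw [Finset.sum_comm]
  refine Finset.sum_congr rfl fun y _ => Finset.sum_congr rfl fun x _ => ?_
  simp [smul_smul, mul_comm (g y)]

theorem doubleOp_left {a b : A} (f : ℝ → ℝ) (ha : IsSelfAdjoint a) (hb : IsSelfAdjoint b) (X : A) :
    doubleOp (fun x _ => f x) a b X = cfc f a * X := by
  have := doubleOp_mul f (fun _ => 1) ha hb X
  rw [cfc_const_one ℝ b] at this
  simpa using this

theorem doubleOp_right {a b : A} (f : ℝ → ℝ) (ha : IsSelfAdjoint a) (hb : IsSelfAdjoint b) (X : A) :
    doubleOp (fun _ y => f y) a b X = X * cfc f b := by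
  have := doubleOp_mul (fun _ => 1) f ha hb X
  rw [cfc_const_one ℝ a] at this
  simpa using this

theorem doubleOp_one {a b : A} (ha : IsSelfAdjoint a) (hb : IsSelfAdjoint b) (X : A) :
    doubleOp (fun _ _ => 1) a b X = X := by
  have := doubleOp_left (fun _ => 1) ha hb X
  rwa [cfc_const_one ℝ a, one_mul] at this

theorem star_doubleOp (k : ℝ → ℝ → ℝ) (a b X : A) :
    star (doubleOp k a b X) = doubleOp (fun x y => k y x) b a (star X) := by
  rw [doubleOp_apply, doubleOp_apply, Finset.sum_comm]
  simp [star_sum, mul_assoc]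

end Spectral

/-! ### The trace inner product and its double operator forms -/

namespace FaithfulTrace

section Inner

variable {A : Type*} [CStarAlgebra A]

theorem map_real_smul (tr : FaithfulTrace A) (r : ℝ) (x : A) : tr (r • x) = r * tr x := by
  rw [← Complex.coe_smul, map_smul, smul_eq_mul]

/-- Polarization: reality of the trace on `star z * z` for `z = 1 + x` fixes the imaginary part, and
for `z = 1 + I • x` the real part. -/
theorem map_star (tr : FaithfulTrace A) (x : A) : tr (star x) = star (tr x) := by
  have h1 := tr.im_eq_zero (1 + x)
  have h2 := tr.im_eq_zero (1 + Complex.I • x)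
  have h3 := tr.im_eq_zero x
  have h4 := tr.im_eq_zero 1
  have h5 := tr.im_eq_zero (Complex.I • x)
  change (tr _).im = 0 at h1 h2 h3 h4 h5
  simp [mul_add, add_mul] at h1 h2 h3 h4
  simp [h3, h4] at h1 h2
  apply Complex.ext
  · simp; linarith
  · simp; linarith

/-- The real part of the Hilbert–Schmidt inner product of the trace. -/
def inner (tr : FaithfulTrace A) : LinearMap.BilinForm ℝ A :=
  LinearMap.mk₂ ℝ (fun X Y => (tr (star X * Y)).re)
    (by simp [add_mul]) (by simp)
    (by simp [mul_add]) (by simp)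

theorem inner_apply (tr : FaithfulTrace A) (X Y : A) : tr.inner X Y = (tr (star X * Y)).re := rfl

theorem re_map_mul_comm (tr : FaithfulTrace A) (X Y : A) : (tr (X * Y)).re = (tr (Y * X)).re :=
  congrArg Complex.re (tr.tracial X Y)

theorem mul_comm' (tr : FaithfulTrace A) (X Y : A) : tr (X * Y) = tr (Y * X) := tr.tracial X Y

theorem inner_comm (tr : FaithfulTrace A) (X Y : A) : tr.inner X Y = tr.inner Y X := by
  have h := tr.map_star (star Y * X)
  rw [star_mul, star_star] at h
  rw [inner_apply, h, inner_apply]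
  exact Complex.conj_re _

theorem inner_self_nonneg (tr : FaithfulTrace A) (X : A) : 0 ≤ tr.inner X X := by
  by_cases h : X = 0
  · simp [h]
  · exact (tr.re_pos X h).le

theorem inner_self_pos (tr : FaithfulTrace A) {X : A} (h : X ≠ 0) : 0 < tr.inner X X :=
  tr.re_pos X h

theorem inner_mul_left (tr : FaithfulTrace A) (a X Y : A) :
    tr.inner X (a * Y) = tr.inner (star a * X) Y := by
  simp [inner_apply, mul_assoc]

theorem inner_mul_right (tr : FaithfulTrace A) (a X Y : A) :
    tr.inner X (Y * a) = tr.inner (X * star a) Y := by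
  simp only [inner_apply, star_mul, star_star]
  rw [← mul_assoc, mul_comm', mul_assoc]

theorem inner_star_star (tr : FaithfulTrace A) (X Y : A) :
    tr.inner (star X) (star Y) = tr.inner X Y := by
  rw [inner_comm, inner_apply, inner_apply, star_star, mul_comm']

theorem ext_inner (tr : FaithfulTrace A) {X Y : A} (h : ∀ Z, tr.inner Z X = tr.inner Z Y) :
    X = Y := by
  by_contra hne
  have := tr.inner_self_pos (sub_ne_zero.2 hne)
  rw [map_sub (tr.inner (X - Y)), h, sub_self] at this
  exact lt_irrefl _ this

end Inner

section DoubleOp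

variable {A : Type*} [CStarAlgebra A] [FiniteDimensional ℂ A] (tr : FaithfulTrace A)

/-- The projections are self-adjoint idempotents, so the form is diagonal over the blocks `P_x ·
Q_y`. Signs, limits and integrals of kernels can then be handled entry by entry. -/
theorem inner_doubleOp_apply (k : ℝ → ℝ → ℝ) (a b X Y : A) :
    tr.inner X (doubleOp k a b Y) = ∑ x ∈ realSpec a, ∑ y ∈ realSpec b,
      k x y * tr.inner (specProj a x * X * specProj b y) (specProj a x * Y * specProj b y) := by
  rw [doubleOp_apply, map_sum]
  refine Finset.sum_congr rfl fun x _ => ?_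
  rw [map_sum]
  refine Finset.sum_congr rfl fun y _ => ?_
  have h : specProj a x * Y * specProj b y
      = specProj a x * (specProj a x * Y * specProj b y) * specProj b y := by
    have h1 := specProj_mul a x x
    have h2 := specProj_mul b y y
    rw [if_pos rfl] at h1 h2
    simp only [mul_assoc, h2]
    rw [← mul_assoc (specProj a x) (specProj a x), h1]
  rw [map_smul, smul_eq_mul, h, inner_mul_right, inner_mul_left, ← h]
  simp [mul_assoc]

theorem inner_doubleOp_comm (k : ℝ → ℝ → ℝ) (a b X Y : A) :
    tr.inner X (doubleOp k a b Y) = tr.inner (doubleOp k a b X) Y := by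
  rw [tr.inner_comm (doubleOp k a b X), inner_doubleOp_apply, inner_doubleOp_apply]
  simp_rw [tr.inner_comm (_ * X * _)]

theorem inner_doubleOp_nonneg {k : ℝ → ℝ → ℝ} {a b : A}
    (h : ∀ x ∈ spectrum ℝ a, ∀ y ∈ spectrum ℝ b, 0 ≤ k x y) (X : A) :
    0 ≤ tr.inner X (doubleOp k a b X) := by
  rw [inner_doubleOp_apply]
  exact Finset.sum_nonneg fun x hx => Finset.sum_nonneg fun y hy =>
    mul_nonneg (h x (mem_realSpec.1 hx) y (mem_realSpec.1 hy)) (tr.inner_self_nonneg _)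

/-- Inversion of positive double operator sums is antitone for the Loewner order. -/
theorem inner_doubleOp_inv_anti {k k' : ℝ → ℝ → ℝ} {a b c d : A}
    (ha : IsSelfAdjoint a) (hb : IsSelfAdjoint b) (hc : IsSelfAdjoint c) (hd : IsSelfAdjoint d)
    (hk : ∀ x ∈ spectrum ℝ a, ∀ y ∈ spectrum ℝ b, 0 < k x y)
    (hk' : ∀ x ∈ spectrum ℝ c, ∀ y ∈ spectrum ℝ d, 0 < k' x y)
    (h : ∀ Z, tr.inner Z (doubleOp k a b Z) ≤ tr.inner Z (doubleOp k' c d Z)) (X : A) :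
    tr.inner X (doubleOp (fun x y => (k' x y)⁻¹) c d X)
      ≤ tr.inner X (doubleOp (fun x y => (k x y)⁻¹) a b X) := by
  set Z := doubleOp (fun x y => (k' x y)⁻¹) c d X with hZ
  set V := doubleOp (fun x y => (k x y)⁻¹) a b X with hV
  have h1 : doubleOp k' c d Z = X := by
    rw [hZ, doubleOp_doubleOp, doubleOp_congr (k' := fun _ _ => 1), doubleOp_one hc hd]
    exact fun x hx y hy => mul_inv_cancel₀ (hk' x hx y hy).ne'
  have h2 : doubleOp k a b V = X := by
    rw [hV, doubleOp_doubleOp, doubleOp_congr (k' := fun _ _ => 1), doubleOp_one ha hb]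
    exact fun x hx y hy => mul_inv_cancel₀ (hk x hx y hy).ne'
  -- With `K V = X = K' Z`, positivity of `K` at `V - Z` reads `⟨X,V⟩ - 2⟨X,Z⟩ + ⟨Z,KZ⟩ ≥ 0`, and
  -- `⟨Z,KZ⟩ ≤ ⟨Z,K'Z⟩ = ⟨X,Z⟩`.
  have h3 := tr.inner_doubleOp_nonneg (fun x hx y hy => (hk x hx y hy).le) (V - Z)
  have h4 := h Z
  have h5 : tr.inner V (doubleOp k a b Z) = tr.inner X Z := by rw [inner_doubleOp_comm, h2]
  rw [h1] at h4
  simp only [map_sub, LinearMap.sub_apply, h2, h5] at h3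
  rw [tr.inner_comm Z X] at h4 h3
  rw [tr.inner_comm V X] at h3
  linarith

end DoubleOp

end FaithfulTrace

/-! ### Logarithmic means and integral formulas for the logarithm -/

section Scalar

open MeasureTheory intervalIntegral Filter Topology

/-- The logarithmic mean. -/
def logMean (q r : ℝ) : ℝ := ∫ s in (0 : ℝ)..1, q ^ s * r ^ (1 - s)

/-- The reciprocal of the logarithmic mean. -/
def invLogMean (q r : ℝ) : ℝ := ∫ t in (0 : ℝ)..1, (t * q + (1 - t) * r)⁻¹

/-- The kernel `∫₀¹ (1 - t) / (t q + (1 - t) r) dt`, half of `invLogMean` after symmetrisation. -/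
def halfLogMean (q r : ℝ) : ℝ := ∫ t in (0 : ℝ)..1, (1 - t) * (t * q + (1 - t) * r)⁻¹

variable {q r : ℝ}

theorem segment_pos (hq : 0 < q) (hr : 0 < r) {t : ℝ} (ht : t ∈ Set.Icc (0 : ℝ) 1) :
    0 < t * q + (1 - t) * r := by
  rcases eq_or_lt_of_le ht.1 with h | h
  · simp [← h, hr]
  · have := mul_pos h hq
    have := mul_nonneg (sub_nonneg.2 ht.2) hr.le
    linarith

theorem continuousOn_segment_inv (hq : 0 < q) (hr : 0 < r) :
    ContinuousOn (fun t : ℝ => (t * q + (1 - t) * r)⁻¹) (Set.uIcc 0 1) := by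
  rw [Set.uIcc_of_le zero_le_one]
  exact ContinuousOn.inv₀ (by fun_prop) fun t ht => (segment_pos hq hr ht).ne'

theorem intervalIntegrable_segment_inv (hq : 0 < q) (hr : 0 < r) :
    IntervalIntegrable (fun t : ℝ => (t * q + (1 - t) * r)⁻¹) volume 0 1 :=
  (continuousOn_segment_inv hq hr).intervalIntegrable

theorem intervalIntegrable_mul_segment_inv (hq : 0 < q) (hr : 0 < r) :
    IntervalIntegrable (fun t : ℝ => (1 - t) * (t * q + (1 - t) * r)⁻¹) volume 0 1 :=
  (ContinuousOn.mul (by fun_prop) (continuousOn_segment_inv hq hr)).intervalIntegrable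

theorem halfLogMean_add_swap (hq : 0 < q) (hr : 0 < r) :
    halfLogMean q r + halfLogMean r q = invLogMean q r := by
  have h : halfLogMean r q = ∫ t in (0 : ℝ)..1, t * (t * q + (1 - t) * r)⁻¹ := by
    have := integral_comp_sub_left (a := 0) (b := 1)
      (fun t : ℝ => t * (t * q + (1 - t) * r)⁻¹) 1
    simp only [sub_self, sub_zero] at this
    rw [← this]
    refine integral_congr fun t _ => ?_
    simp only [sub_sub_cancel]
    rw [add_comm]
  rw [h, halfLogMean, ← integral_add (intervalIntegrable_mul_segment_inv hq hr) (ContinuousOn.intervalIntegrable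
      (u := fun t : ℝ => t * (t * q + (1 - t) * r)⁻¹)
      (ContinuousOn.mul (by fun_prop) (continuousOn_segment_inv hq hr)))]
  refine integral_congr fun t _ => ?_
  ring

theorem hasDerivAt_segment (q r t : ℝ) :
    HasDerivAt (fun t : ℝ => t * q + (1 - t) * r) (q - r) t :=
  (((hasDerivAt_id' t).mul_const q).add (((hasDerivAt_id' t).const_sub 1).mul_const r)).congr_deriv
    (by ring)

theorem sub_mul_invLogMean (hq : 0 < q) (hr : 0 < r) :
    (q - r) * invLogMean q r = Real.log q - Real.log r := by
  rw [invLogMean, ← intervalIntegral.integral_const_mul]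
  have h := integral_eq_sub_of_hasDerivAt (a := (0 : ℝ)) (b := 1)
    (f := fun t => Real.log (t * q + (1 - t) * r))
    (f' := fun t => (q - r) * (t * q + (1 - t) * r)⁻¹) (fun t ht => ?_) ?_
  · rw [h]; simp
  · rw [Set.uIcc_of_le zero_le_one] at ht
    have h1 := hasDerivAt_segment q r t
    exact h1.log (segment_pos hq hr ht).ne'
  · exact (intervalIntegrable_segment_inv hq hr).const_mul _

theorem invLogMean_self (q : ℝ) : invLogMean q q = q⁻¹ := by
  have : ∀ t : ℝ, (t * q + (1 - t) * q)⁻¹ = q⁻¹ := fun t => by ring_nf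
  simp [invLogMean, this]

/-- With `s = t q + (1 - t) r` one has `q - s = (1 - t)(q - r)`, so `q log s - s` is a primitive of
the integrand. This is the scalar form of the exact entropy formula. -/
theorem sq_mul_halfLogMean (hq : 0 < q) (hr : 0 < r) :
    (q - r) * halfLogMean q r * (q - r) = q * Real.log q - q * Real.log r - q + r := by
  rw [mul_right_comm, halfLogMean, ← intervalIntegral.integral_const_mul]
  have h := integral_eq_sub_of_hasDerivAt (a := (0 : ℝ)) (b := 1)
    (f := fun t => q * Real.log (t * q + (1 - t) * r) - (t * q + (1 - t) * r))
    (f' := fun t => (q - r) * (q - r) * ((1 - t) * (t * q + (1 - t) * r)⁻¹)) (fun t ht => ?_) ?_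
  · rw [h]; simp; ring
  · rw [Set.uIcc_of_le zero_le_one] at ht
    have h1 := hasDerivAt_segment q r t
    have hp := (segment_pos hq hr ht).ne'
    refine (((h1.log hp).const_mul q).sub h1).congr_deriv ?_
    rw [← div_eq_mul_inv, mul_div_assoc', mul_div_assoc', div_sub' hp]
    congr 1
    ring
  · exact (intervalIntegrable_mul_segment_inv hq hr).const_mul _

theorem continuous_rpow_mul_rpow (hq : 0 < q) (hr : 0 < r) :
    Continuous fun s : ℝ => q ^ s * r ^ (1 - s) :=
  (Real.continuous_const_rpow hq.ne').mul
    ((Real.continuous_const_rpow hr.ne').comp (by fun_prop))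

theorem log_sub_log_mul_logMean (hq : 0 < q) (hr : 0 < r) :
    (Real.log q - Real.log r) * logMean q r = q - r := by
  rw [logMean, ← intervalIntegral.integral_const_mul]
  have h := integral_eq_sub_of_hasDerivAt (a := (0 : ℝ)) (b := 1)
    (f := fun s : ℝ => q ^ s * r ^ (1 - s))
    (f' := fun s => (Real.log q - Real.log r) * (q ^ s * r ^ (1 - s))) (fun s _ => ?_) ?_
  · rw [h]; simp
  · have h1 := Real.hasStrictDerivAt_const_rpow hq s
    have h2 := (Real.hasStrictDerivAt_const_rpow hr (1 - s)).hasDerivAt.comp s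
      ((hasDerivAt_id' s).const_sub 1)
    refine (h1.hasDerivAt.mul h2).congr_deriv ?_
    simp only [Function.comp]
    ring
  · exact ((continuous_rpow_mul_rpow hq hr).const_mul _).intervalIntegrable _ _

theorem logMean_self (hq : 0 < q) : logMean q q = q := by
  have : ∀ s : ℝ, q ^ s * q ^ (1 - s) = q := fun s => by
    rw [← Real.rpow_add hq]; simp
  simp [logMean, this]

/-- Off the diagonal the two factors are `(q - r) / (log q - log r)` and its reciprocal. -/
theorem logMean_mul_invLogMean (hq : 0 < q) (hr : 0 < r) : logMean q r * invLogMean q r = 1 := by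
  by_cases h : q = r
  · subst h; rw [logMean_self hq, invLogMean_self, mul_inv_cancel₀ hq.ne']
  · have h1 : q - r ≠ 0 := sub_ne_zero.2 h
    have h2 : Real.log q - Real.log r ≠ 0 := fun h' =>
      h (Real.log_injOn_pos hq hr (sub_eq_zero.1 h'))
    have h3 := sub_mul_invLogMean hq hr
    have h4 := log_sub_log_mul_logMean hq hr
    apply mul_left_cancel₀ (mul_ne_zero h1 h2)
    calc _ = ((q - r) * invLogMean q r) * ((Real.log q - Real.log r) * logMean q r) := by ring
      _ = _ := by rw [h3, h4]; ring

theorem invLogMean_pos (hq : 0 < q) (hr : 0 < r) : 0 < invLogMean q r :=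
  intervalIntegral_pos_of_pos_on (intervalIntegrable_segment_inv hq hr)
    (fun _ ht => inv_pos.2 (segment_pos hq hr (Set.Ioo_subset_Icc_self ht))) zero_lt_one

theorem logMean_pos (hq : 0 < q) (hr : 0 < r) : 0 < logMean q r := by
  have h1 := logMean_mul_invLogMean hq hr
  have h2 := invLogMean_pos hq hr
  by_contra h
  have := mul_nonpos_of_nonpos_of_nonneg (not_lt.1 h) h2.le
  linarith

/-- Homogeneity of degree one: the weight of `L₂(ω)` becomes a function of the modular ratio
followed by right multiplication by `ω`. -/
theorem logMean_eq_mul (hq : 0 < q) (hr : 0 < r) : logMean q r = logMean (q / r) 1 * r := by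
  rw [logMean, logMean, ← intervalIntegral.integral_mul_const]
  refine integral_congr fun s _ => ?_
  simp only [Real.one_rpow, mul_one]
  rw [Real.div_rpow hq.le hr.le, Real.rpow_sub hr, Real.rpow_one]
  ring

theorem continuousOn_add_inv (hq : 0 < q) {R : ℝ} (hR : 0 ≤ R) :
    ContinuousOn (fun u : ℝ => (q + u)⁻¹) (Set.uIcc 0 R) := by
  rw [Set.uIcc_of_le hR]
  exact ContinuousOn.inv₀ (by fun_prop) fun u hu => by have := hu.1; positivity

theorem integral_add_inv (hq : 0 < q) {R : ℝ} (hR : 0 ≤ R) :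
    ∫ u in (0 : ℝ)..R, (q + u)⁻¹ = Real.log (q + R) - Real.log q := by
  have h := integral_eq_sub_of_hasDerivAt (a := (0 : ℝ)) (b := R)
    (f := fun u => Real.log (q + u)) (f' := fun u => (q + u)⁻¹) (fun u hu => ?_) ?_
  · rw [h]; simp
  · rw [Set.uIcc_of_le hR] at hu
    have h0 : q + u ≠ 0 := by have := hu.1; positivity
    simpa using ((hasDerivAt_id u).const_add q).log h0
  · exact (continuousOn_add_inv hq hR).intervalIntegrable

theorem tendsto_log_add_sub (a b : ℝ) :
    Tendsto (fun R : ℝ => Real.log (a + R) - Real.log (b + R)) atTop (𝓝 0) := by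
  have h1 : Tendsto (fun R : ℝ => (a + R) / (b + R)) atTop (𝓝 1) := by
    have h2 : Tendsto (fun R : ℝ => 1 + (a - b) / (b + R)) atTop (𝓝 (1 + 0)) :=
      tendsto_const_nhds.add
        (tendsto_const_nhds.div_atTop (tendsto_atTop_add_const_left _ _ tendsto_id))
    rw [add_zero] at h2
    refine h2.congr' ?_
    filter_upwards [eventually_gt_atTop (-b)] with R hR
    have : b + R ≠ 0 := by linarith
    field_simp
    ring
  have h2 := (Real.continuousAt_log one_ne_zero).tendsto.comp h1
  rw [Real.log_one] at h2
  refine h2.congr' ?_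
  filter_upwards [eventually_gt_atTop (-b), eventually_gt_atTop (-a)] with R hR hR'
  simp only [Function.comp]
  rw [Real.log_div (by linarith) (by linarith)]

/-- The resolvent representation of the logarithm, kept as a limit of integrals over `[0, R]` so
that inequalities can be integrated on compact intervals. -/
theorem tendsto_integral_one_add_inv_sub (hq : 0 < q) :
    Tendsto (fun R : ℝ => ∫ u in (0 : ℝ)..R, ((1 + u)⁻¹ - (q + u)⁻¹)) atTop
      (𝓝 (Real.log q)) := by
  have h := (tendsto_log_add_sub 1 q).add_const (Real.log q)
  rw [zero_add] at h
  refine h.congr' ?_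
  filter_upwards [eventually_ge_atTop 0] with R hR
  rw [integral_sub (continuousOn_add_inv one_pos hR).intervalIntegrable
    (continuousOn_add_inv hq hR).intervalIntegrable, integral_add_inv one_pos hR,
    integral_add_inv hq hR, Real.log_one]
  ring

/-- Partial fractions reduce the off-diagonal case to two logarithms; on the diagonal `-(q + u)⁻¹`
is a primitive. The kernel is that of the derivative of the logarithm. -/
theorem tendsto_integral_add_inv_mul (hq : 0 < q) (hr : 0 < r) :
    Tendsto (fun R : ℝ => ∫ u in (0 : ℝ)..R, (q + u)⁻¹ * (r + u)⁻¹) atTop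
      (𝓝 (invLogMean q r)) := by
  by_cases hqr : q = r
  · subst hqr
    rw [invLogMean_self]
    have h : Tendsto (fun R : ℝ => q⁻¹ - (q + R)⁻¹) atTop (𝓝 (q⁻¹ - 0)) :=
      tendsto_const_nhds.sub
        (tendsto_inv_atTop_zero.comp (tendsto_atTop_add_const_left _ _ tendsto_id))
    rw [sub_zero] at h
    refine h.congr' ?_
    filter_upwards [eventually_ge_atTop 0] with R hR
    have h := integral_eq_sub_of_hasDerivAt (a := (0 : ℝ)) (b := R)
      (f := fun u => -(q + u)⁻¹) (f' := fun u => (q + u)⁻¹ * (q + u)⁻¹) (fun u hu => ?_) ?_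
    · rw [h]; simp; ring
    · rw [Set.uIcc_of_le hR] at hu
      have h0 : q + u ≠ 0 := by have := hu.1; positivity
      refine (((hasDerivAt_id' u).const_add q).inv h0).neg.congr_deriv ?_
      field_simp
    · exact ((continuousOn_add_inv hq hR).mul (continuousOn_add_inv hq hR)).intervalIntegrable
  · have h1 : q - r ≠ 0 := sub_ne_zero.2 hqr
    have hK : invLogMean q r = (q - r)⁻¹ * (0 + (Real.log q - Real.log r)) := by
      rw [zero_add, ← sub_mul_invLogMean hq hr, inv_mul_cancel_left₀ h1]
    rw [hK]
    refine (((tendsto_log_add_sub r q).add_const _).const_mul _).congr' ?_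
    filter_upwards [eventually_ge_atTop 0] with R hR
    have h2 : ∫ u in (0 : ℝ)..R, (q + u)⁻¹ * (r + u)⁻¹
        = ∫ u in (0 : ℝ)..R, (q - r)⁻¹ * ((r + u)⁻¹ - (q + u)⁻¹) := by
      refine integral_congr fun u hu => ?_
      rw [Set.uIcc_of_le hR] at hu
      have h0 : q + u ≠ 0 := by have := hu.1; positivity
      have h0' : r + u ≠ 0 := by have := hu.1; positivity
      field_simp
      ring
    rw [h2, intervalIntegral.integral_const_mul,
      integral_sub (continuousOn_add_inv hr hR).intervalIntegrable
      (continuousOn_add_inv hq hR).intervalIntegrable, integral_add_inv hr hR,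
      integral_add_inv hq hR]
    ring

end Scalar

theorem doubleOp_self_one {A : Type*} [CStarAlgebra A] [FiniteDimensional ℂ A]
    (k : ℝ → ℝ → ℝ) {a : A} (ha : IsSelfAdjoint a) :
    doubleOp k a a 1 = cfc (fun x => k x x) a := by
  rw [doubleOp_apply, cfc_eq_sum_specProj _ ha]
  refine Finset.sum_congr rfl fun x hx => ?_
  rw [Finset.sum_eq_single x]
  · simp [specProj_mul]
  · intro y _ hne
    simp [specProj_mul, hne.symm]
  · intro h; exact absurd hx h

/-! ### Relative entropy and quadratic forms -/

namespace FaithfulTrace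

open MeasureTheory Filter Topology

section Limits

variable {A : Type*} [CStarAlgebra A] [FiniteDimensional ℂ A] (tr : FaithfulTrace A)

theorem intervalIntegrable_inner_doubleOp {k : ℝ → ℝ → ℝ → ℝ} {a b : A} {c d : ℝ}
    (h : ∀ x ∈ spectrum ℝ a, ∀ y ∈ spectrum ℝ b,
      IntervalIntegrable (fun u => k u x y) volume c d) (Z X : A) :
    IntervalIntegrable (fun u => tr.inner Z (doubleOp (k u) a b X)) volume c d := by
  simp_rw [inner_doubleOp_apply]
  have h1 := IntervalIntegrable.sum (realSpec a)
    (f := fun x u => ∑ y ∈ realSpec b, k u x y * tr.inner (specProj a x * Z * specProj b y)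
      (specProj a x * X * specProj b y)) (μ := volume) (a := c) (b := d) fun x hx => by
      have h2 := IntervalIntegrable.sum (realSpec b)
        (f := fun y u => k u x y * tr.inner (specProj a x * Z * specProj b y)
          (specProj a x * X * specProj b y)) (μ := volume) (a := c) (b := d)
        fun y hy => (h x (mem_realSpec.1 hx) y (mem_realSpec.1 hy)).mul_const _
      simpa [Finset.sum_fn] using h2
  simpa [Finset.sum_fn] using h1

theorem integral_inner_doubleOp {k : ℝ → ℝ → ℝ → ℝ} {a b : A} {c d : ℝ}
    (h : ∀ x ∈ spectrum ℝ a, ∀ y ∈ spectrum ℝ b,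
      IntervalIntegrable (fun u => k u x y) volume c d) (Z X : A) :
    ∫ u in c..d, tr.inner Z (doubleOp (k u) a b X)
      = tr.inner Z (doubleOp (fun x y => ∫ u in c..d, k u x y) a b X) := by
  simp_rw [inner_doubleOp_apply]
  rw [intervalIntegral.integral_finsetSum fun x hx => ?_]
  · refine Finset.sum_congr rfl fun x hx => ?_
    rw [intervalIntegral.integral_finsetSum fun y hy =>
      (h x (mem_realSpec.1 hx) y (mem_realSpec.1 hy)).mul_const _]
    simp_rw [intervalIntegral.integral_mul_const]
  · have h2 := IntervalIntegrable.sum (realSpec b)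
      (f := fun y u => k u x y * tr.inner (specProj a x * Z * specProj b y)
        (specProj a x * X * specProj b y)) (μ := volume) (a := c) (b := d)
      fun y hy => (h x (mem_realSpec.1 hx) y (mem_realSpec.1 hy)).mul_const _
    simpa [Finset.sum_fn] using h2

theorem tendsto_inner_doubleOp {ι : Type*} {l : Filter ι} {k : ι → ℝ → ℝ → ℝ} {k' : ℝ → ℝ → ℝ}
    {a b : A} (h : ∀ x ∈ spectrum ℝ a, ∀ y ∈ spectrum ℝ b,
      Tendsto (fun u => k u x y) l (𝓝 (k' x y))) (Z X : A) :
    Tendsto (fun u => tr.inner Z (doubleOp (k u) a b X)) l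
      (𝓝 (tr.inner Z (doubleOp k' a b X))) := by
  simp_rw [inner_doubleOp_apply]
  exact tendsto_finsetSum _ fun x hx => tendsto_finsetSum _ fun y hy =>
    (h x (mem_realSpec.1 hx) y (mem_realSpec.1 hy)).mul_const _

theorem inner_doubleOp_swap (k : ℝ → ℝ → ℝ) (a : A) {X : A} (hX : IsSelfAdjoint X) :
    tr.inner X (doubleOp (fun x y => k y x) a a X) = tr.inner X (doubleOp k a a X) := by
  have h := star_doubleOp k a a X
  rw [hX.star_eq] at h
  rw [← h, ← inner_star_star, star_star, hX.star_eq]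

end Limits

section Order

variable {A : Type*} [CStarAlgebra A] [PartialOrder A] [StarOrderedRing A] (tr : FaithfulTrace A)

theorem inner_mul_left_mono {a b : A} (h : a ≤ b) (Z : A) :
    tr.inner Z (a * Z) ≤ tr.inner Z (b * Z) := by
  obtain ⟨s, hs⟩ := CStarAlgebra.nonneg_iff_eq_star_mul_self.1 (sub_nonneg.2 h)
  have h1 : tr.inner Z ((b - a) * Z) = tr.inner (s * Z) (s * Z) := by
    rw [hs, mul_assoc, inner_mul_left, star_star]
  have h2 := tr.inner_self_nonneg (s * Z)
  rw [← h1, sub_mul, map_sub] at h2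
  linarith

theorem inner_mul_right_mono {a b : A} (h : a ≤ b) (Z : A) :
    tr.inner Z (Z * a) ≤ tr.inner Z (Z * b) := by
  obtain ⟨s, hs⟩ := CStarAlgebra.nonneg_iff_eq_star_mul_self.1 (sub_nonneg.2 h)
  have h1 : tr.inner Z (Z * (b - a)) = tr.inner (Z * star s) (Z * star s) := by
    rw [hs, ← mul_assoc, inner_mul_right]
  have h2 := tr.inner_self_nonneg (Z * star s)
  rw [← h1, mul_sub, map_sub] at h2
  linarith

theorem inner_nonneg {a b : A} (ha : 0 ≤ a) (hb : 0 ≤ b) : 0 ≤ tr.inner a b := by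
  obtain ⟨s, rfl⟩ := CStarAlgebra.nonneg_iff_eq_star_mul_self.1 hb
  have h := tr.inner_mul_right_mono ha (s)
  have h1 : tr.inner (star s * s) a = tr.inner s (s * a) := by
    rw [inner_mul_left]
  rw [inner_comm, h1]
  simpa using h

/-- The (real-valued) relative entropy of an arbitrary pair of self-adjoint elements, without
support condition. -/
def relEnt (ρ ω : A) : ℝ := tr.inner ρ (CFC.log ρ) - tr.inner ρ (CFC.log ω)

end Order

section Entropy

variable {A : Type*} [CStarAlgebra A] [PartialOrder A] [StarOrderedRing A]
  [FiniteDimensional ℂ A] (tr : FaithfulTrace A)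

theorem mul_resolvent_cancel {a : A} (ha : IsStrictlyPositive a) {u : ℝ} (hu : 0 ≤ u) :
    (a + algebraMap ℝ A u) * cfc (fun x : ℝ => (x + u)⁻¹) a = 1 ∧
    cfc (fun x : ℝ => (x + u)⁻¹) a * (a + algebraMap ℝ A u) = 1 := by
  have hsa : IsSelfAdjoint a := ha.isSelfAdjoint
  have h1 : a + algebraMap ℝ A u = cfc (fun x : ℝ => x + u) a := by
    rw [cfc_add_const u (fun x => x) a, cfc_id' ℝ a]
  rw [h1, ← cfc_mul _ _ _ (continuousOn_real_spectrum _ _) (continuousOn_real_spectrum _ _),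
    ← cfc_mul _ _ _ (continuousOn_real_spectrum _ _) (continuousOn_real_spectrum _ _)]
  constructor
  · rw [← cfc_const_one ℝ a]
    refine cfc_congr fun x hx => ?_
    have := ha.spectrum_pos hx
    exact mul_inv_cancel₀ (by positivity)
  · rw [← cfc_const_one ℝ a]
    refine cfc_congr fun x hx => ?_
    have := ha.spectrum_pos hx
    exact inv_mul_cancel₀ (by positivity)

/-- The tangent inequality for the operator convex function `x ↦ (x + u)⁻¹`, traced against
`ρ`. -/
theorem inner_resolvent_sub_le {ρ ω : A} (hρ : IsStrictlyPositive ρ) (hω : IsStrictlyPositive ω)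
    {u : ℝ} (hu : 0 ≤ u) :
    tr.inner ρ (cfc (fun x : ℝ => (x + u)⁻¹) ω) - tr.inner ρ (cfc (fun x : ℝ => (x + u)⁻¹) ρ)
      ≤ tr.inner ρ (doubleOp (fun x y => (x + u)⁻¹ * (y + u)⁻¹) ω ω (ρ - ω)) := by
  have hsω : IsSelfAdjoint ω := hω.isSelfAdjoint
  rw [doubleOp_mul _ _ hsω hsω, ← map_sub]
  obtain ⟨h1, h2⟩ := mul_resolvent_cancel hω hu
  obtain ⟨h3, h4⟩ := mul_resolvent_cancel hρ hu
  have h5 : IsSelfAdjoint (cfc (fun x : ℝ => (x + u)⁻¹) ω) := cfc_predicate _ _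
  have h6 : IsSelfAdjoint (cfc (fun x : ℝ => (x + u)⁻¹) ρ) := cfc_predicate _ _
  generalize cfc (fun x : ℝ => (x + u)⁻¹) ω = a at *
  generalize cfc (fun x : ℝ => (x + u)⁻¹) ρ = b at *
  -- Completing the square: for `a = (ω + u)⁻¹` and `b = (ρ + u)⁻¹` the error in the tangent
  -- inequality is a conjugate of `ρ + u`, hence positive.
  have h7 : a * (ρ - ω) * a - (a - b) = star (a - b) * (ρ + algebraMap ℝ A u) * (a - b) := by
    rw [star_sub, h5.star_eq, h6.star_eq]
    have e1 : ρ - ω = (ρ + algebraMap ℝ A u) - (ω + algebraMap ℝ A u) := by abel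
    rw [e1]
    simp only [mul_sub, sub_mul]
    rw [h2, h4, one_mul, one_mul, mul_assoc a (_ + _) b, h3, mul_one]
  have h8 : 0 ≤ a * (ρ - ω) * a - (a - b) := by
    rw [h7]
    exact star_left_conjugate_nonneg
      (add_nonneg hρ.nonneg (algebraMap_nonneg A hu)) _
  have := tr.inner_nonneg hρ.nonneg h8
  rw [map_sub (tr.inner ρ)] at this
  linarith

/-- The relative entropy is bounded by the Bogoliubov–Kubo–Mori `χ²`-divergence. -/
theorem relEnt_le {ρ ω : A} (hρ : IsStrictlyPositive ρ) (hω : IsStrictlyPositive ω) :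
    tr.relEnt ρ ω ≤ tr.inner (ρ - ω) (doubleOp invLogMean ω ω (ρ - ω)) + tr.inner 1 (ρ - ω) := by
  have hsρ : IsSelfAdjoint ρ := hρ.isSelfAdjoint
  have hsω : IsSelfAdjoint ω := hω.isSelfAdjoint
  have hlog : ∀ a : A, IsStrictlyPositive a → Tendsto (fun R : ℝ => tr.inner ρ
      (doubleOp (fun x _ => ∫ u in (0 : ℝ)..R, ((1 + u)⁻¹ - (x + u)⁻¹)) a a 1)) atTop
      (𝓝 (tr.inner ρ (CFC.log a))) := fun a ha => by
    have hsa : IsSelfAdjoint a := ha.isSelfAdjoint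
    have h1 : CFC.log a = doubleOp (fun x _ => Real.log x) a a 1 := by
      rw [doubleOp_left _ hsa hsa, mul_one]; rfl
    rw [h1]
    exact tr.tendsto_inner_doubleOp (fun x hx _ _ =>
      tendsto_integral_one_add_inv_sub (ha.spectrum_pos hx)) _ _
  have hint : ∀ a : A, IsStrictlyPositive a → ∀ R : ℝ, 0 ≤ R →
      ∀ x ∈ spectrum ℝ a, ∀ y ∈ spectrum ℝ a,
      IntervalIntegrable (fun u : ℝ => (1 + u)⁻¹ - (x + u)⁻¹) volume 0 R := fun a ha R hR x hx _ _ =>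
    (continuousOn_add_inv one_pos hR).intervalIntegrable.sub
      (continuousOn_add_inv (ha.spectrum_pos hx) hR).intervalIntegrable
  have hint2 : ∀ R : ℝ, 0 ≤ R → ∀ x ∈ spectrum ℝ ω, ∀ y ∈ spectrum ℝ ω,
      IntervalIntegrable (fun u : ℝ => (x + u)⁻¹ * (y + u)⁻¹) volume 0 R := fun R hR x hx y hy =>
    ((continuousOn_add_inv (hω.spectrum_pos hx) hR).mul
      (continuousOn_add_inv (hω.spectrum_pos hy) hR)).intervalIntegrable
  have hlim : Tendsto (fun R : ℝ => tr.inner ρ (doubleOp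
      (fun x y => ∫ u in (0 : ℝ)..R, (x + u)⁻¹ * (y + u)⁻¹) ω ω (ρ - ω))) atTop
      (𝓝 (tr.inner ρ (doubleOp invLogMean ω ω (ρ - ω)))) :=
    tr.tendsto_inner_doubleOp (fun x hx y hy =>
      tendsto_integral_add_inv_mul (hω.spectrum_pos hx) (hω.spectrum_pos hy)) _ _
  -- The tangent inequality is integrated over `0 ≤ u ≤ R`, where the terms `(1 + u)⁻¹` of the two
  -- logarithms cancel, and `R → ∞`.
  have hmain : tr.relEnt ρ ω ≤ tr.inner ρ (doubleOp invLogMean ω ω (ρ - ω)) := by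
    refine le_of_tendsto_of_tendsto ((hlog ρ hρ).sub (hlog ω hω)) hlim ?_
    filter_upwards [eventually_ge_atTop 0] with R hR
    rw [← tr.integral_inner_doubleOp (hint ρ hρ R hR), ← tr.integral_inner_doubleOp (hint ω hω R hR),
      ← tr.integral_inner_doubleOp (hint2 R hR), ← intervalIntegral.integral_sub
        (tr.intervalIntegrable_inner_doubleOp (hint ρ hρ R hR) _ _)
        (tr.intervalIntegrable_inner_doubleOp (hint ω hω R hR) _ _)]
    refine intervalIntegral.integral_mono_on hR
      ((tr.intervalIntegrable_inner_doubleOp (hint ρ hρ R hR) _ _).sub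
        (tr.intervalIntegrable_inner_doubleOp (hint ω hω R hR) _ _))
      (tr.intervalIntegrable_inner_doubleOp (hint2 R hR) _ _) fun u hu => ?_
    have := tr.inner_resolvent_sub_le hρ hω hu.1
    have h1 : ∀ a : A, IsSelfAdjoint a → doubleOp (fun x _ => (1 + u)⁻¹ - (x + u)⁻¹) a a 1
        = (1 + u)⁻¹ • 1 - cfc (fun x : ℝ => (x + u)⁻¹) a := fun a hsa => by
      rw [doubleOp_sub, doubleOp_left _ hsa hsa, doubleOp_left _ hsa hsa, cfc_const _ a,
        Algebra.algebraMap_eq_smul_one, mul_one, mul_one]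
    rw [h1 ρ hsρ, h1 ω hsω, ← map_sub]
    rw [← map_sub] at this
    convert this using 2
    abel
  -- Since `invLogMean x x = x⁻¹`, the operator sends `ω` to `1`; replacing `ρ` by `ρ - ω` on the
  -- left therefore costs only the difference of traces.
  have h2 : tr.inner ω (doubleOp invLogMean ω ω (ρ - ω)) = tr.inner 1 (ρ - ω) := by
    rw [inner_doubleOp_comm]
    congr 2
    have h3 : ω = doubleOp (fun x _ => x) ω ω 1 := by
      rw [doubleOp_left _ hsω hsω, cfc_id' ℝ ω, mul_one]
    rw [← cfc_const_one ℝ ω]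
    nth_rewrite 3 [h3]
    rw [doubleOp_doubleOp, doubleOp_self_one _ hsω]
    refine cfc_congr fun x hx => ?_
    have := hω.spectrum_pos hx
    rw [invLogMean_self, inv_mul_cancel₀ this.ne']
  rw [map_sub tr.inner, LinearMap.sub_apply, h2]
  linarith

/-- Exact formula for the relative entropy in terms of the left action of `ρ` and the right action
of `ω`. -/
theorem relEnt_eq {ρ ω : A} (hρ : IsStrictlyPositive ρ) (hω : IsStrictlyPositive ω) :
    tr.relEnt ρ ω = tr.inner (ρ - ω) (doubleOp halfLogMean ρ ω (ρ - ω)) + tr.inner 1 (ρ - ω) := by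
  have hsρ : IsSelfAdjoint ρ := hρ.isSelfAdjoint
  have hsω : IsSelfAdjoint ω := hω.isSelfAdjoint
  -- The difference is `(L_ρ - R_ω) 1`, so its two occurrences multiply the kernel by `(x - y)²` and
  -- the scalar identity applies on each block.
  have h1 : ρ - ω = doubleOp (fun x y => x - y) ρ ω 1 := by
    rw [doubleOp_sub (fun x _ => x) (fun _ y => y), doubleOp_left (fun x => x) hsρ hsω,
      doubleOp_right (fun x => x) hsρ hsω, cfc_id' ℝ ω, cfc_id' ℝ ρ, mul_one, one_mul]
  have h2 : tr.inner (ρ - ω) (doubleOp halfLogMean ρ ω (ρ - ω))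
      = tr.inner 1 (ρ * CFC.log ρ - ρ * CFC.log ω - ρ + ω) := by
    conv_lhs => rw [h1]
    rw [← inner_doubleOp_comm, doubleOp_doubleOp, doubleOp_doubleOp, doubleOp_congr
      (k' := fun x y => x * Real.log x - x * Real.log y - x + y)]
    · congr 1
      rw [doubleOp_add (fun x y => x * Real.log x - x * Real.log y - x) (fun _ y => y),
        doubleOp_sub (fun x y => x * Real.log x - x * Real.log y) (fun x _ => x),
        doubleOp_sub (fun x _ => x * Real.log x) (fun x y => x * Real.log y),
        doubleOp_left (fun x => x * Real.log x) hsρ hsω, doubleOp_mul (fun x => x) _ hsρ hsω,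
        doubleOp_left (fun x => x) hsρ hsω, doubleOp_right (fun x => x) hsρ hsω,
        cfc_id' ℝ ω, cfc_id' ℝ ρ, cfc_mul _ _ _ (continuousOn_real_spectrum _ _)
        (continuousOn_real_spectrum _ _), cfc_id' ℝ ρ]
      simp [CFC.log]
    · intro x hx y hy
      rw [sq_mul_halfLogMean (hρ.spectrum_pos hx) (hω.spectrum_pos hy)]
  have h3 : ∀ Y, tr.inner 1 (ρ * Y) = tr.inner ρ Y := fun Y => by
    rw [inner_mul_left, mul_one, hsρ.star_eq]
  rw [h2, relEnt]
  simp only [map_add, map_sub, h3]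
  ring

/-- When both densities agree and `X` is self-adjoint, taking adjoints swaps the kernel arguments
without changing the form, and the kernel plus its swap is `invLogMean`. This is the origin of the
factor 2 in the upper bound. -/
theorem inner_doubleOp_halfLogMean_self {τ X : A} (hτ : IsStrictlyPositive τ)
    (hX : IsSelfAdjoint X) :
    2 * tr.inner X (doubleOp halfLogMean τ τ X) = tr.inner X (doubleOp invLogMean τ τ X) := by
  have h1 := tr.inner_doubleOp_swap halfLogMean τ hX
  have h2 := doubleOp_add halfLogMean (fun x y => halfLogMean y x) τ τ X
  rw [doubleOp_congr (k' := invLogMean)] at h2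
  · rw [h2, map_add, h1]; ring
  · exact fun x hx y hy => halfLogMean_add_swap (hτ.spectrum_pos hx) (hτ.spectrum_pos hy)

theorem integral_mul_inner_doubleOp_segment {a b : A} (ha : IsStrictlyPositive a)
    (hb : IsStrictlyPositive b) (X : A) :
    IntervalIntegrable (fun t : ℝ => (1 - t) *
      tr.inner X (doubleOp (fun x y => (t * x + (1 - t) * y)⁻¹) a b X)) volume 0 1 ∧
    ∫ t in (0 : ℝ)..1, (1 - t) *
      tr.inner X (doubleOp (fun x y => (t * x + (1 - t) * y)⁻¹) a b X)
      = tr.inner X (doubleOp halfLogMean a b X) := by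
  have h1 : ∀ t : ℝ, (1 - t) * tr.inner X (doubleOp (fun x y => (t * x + (1 - t) * y)⁻¹) a b X)
      = tr.inner X (doubleOp (fun x y => (1 - t) * (t * x + (1 - t) * y)⁻¹) a b X) := fun t => by
    rw [doubleOp_const_mul, map_smul, smul_eq_mul]
  have h2 : ∀ x ∈ spectrum ℝ a, ∀ y ∈ spectrum ℝ b, IntervalIntegrable
      (fun t : ℝ => (1 - t) * (t * x + (1 - t) * y)⁻¹) volume 0 1 := fun x hx y hy =>
    intervalIntegrable_mul_segment_inv (ha.spectrum_pos hx) (hb.spectrum_pos hy)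
  simp_rw [h1]
  exact ⟨tr.intervalIntegrable_inner_doubleOp h2 _ _, tr.integral_inner_doubleOp h2 _ _⟩

omit [PartialOrder A] [StarOrderedRing A] in
theorem doubleOp_segment {a b : A} (ha : IsSelfAdjoint a) (hb : IsSelfAdjoint b) (s t : ℝ) (Z : A) :
    doubleOp (fun x y => s * x + t * y) a b Z = s • (a * Z) + t • (Z * b) := by
  rw [doubleOp_add (fun x _ => s * x) (fun _ y => t * y),
    doubleOp_const_mul s (fun x _ => x), doubleOp_const_mul t (fun _ y => y),
    doubleOp_left (fun x => x) ha hb, doubleOp_right (fun x => x) ha hb, cfc_id' ℝ a, cfc_id' ℝ b]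

/-- The quadratic forms of `halfLogMean` are antitone in the two densities. -/
theorem inner_doubleOp_halfLogMean_le {a b c d : A} (ha : IsStrictlyPositive a)
    (hb : IsStrictlyPositive b) (hc : IsStrictlyPositive c) (hd : IsStrictlyPositive d)
    {C : ℝ} (hC : 0 < C) (hac : a ≤ C • c) (hbd : b ≤ C • d) (X : A) :
    tr.inner X (doubleOp halfLogMean c d X) ≤ C * tr.inner X (doubleOp halfLogMean a b X) := by
  obtain ⟨i1, e1⟩ := tr.integral_mul_inner_doubleOp_segment ha hb X
  obtain ⟨i2, e2⟩ := tr.integral_mul_inner_doubleOp_segment hc hd X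
  have hsa : IsSelfAdjoint a := ha.isSelfAdjoint
  have hsb : IsSelfAdjoint b := hb.isSelfAdjoint
  have hsc : IsSelfAdjoint c := hc.isSelfAdjoint
  have hsd : IsSelfAdjoint d := hd.isSelfAdjoint
  rw [← e1, ← e2, ← intervalIntegral.integral_const_mul]
  refine intervalIntegral.integral_mono_on zero_le_one i2 (i1.const_mul C) fun t ht => ?_
  rw [mul_left_comm]
  refine mul_le_mul_of_nonneg_left ?_ (sub_nonneg.2 ht.2)
  -- For fixed `t` the uninverted kernel is `t L_a + (1 - t) R_b`, which is monotone in `a` and `b`;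
  -- inversion reverses the order and turns `C` into `C⁻¹`.
  have h := tr.inner_doubleOp_inv_anti (k := fun x y => t * x + (1 - t) * y)
    (k' := fun x y => C * (t * x + (1 - t) * y)) hsa hsb hsc hsd
    (fun x hx y hy => segment_pos (ha.spectrum_pos hx) (hb.spectrum_pos hy) ht)
    (fun x hx y hy => mul_pos hC (segment_pos (hc.spectrum_pos hx) (hd.spectrum_pos hy) ht))
    (fun Z => ?_) X
  · simp_rw [mul_inv] at h
    rw [doubleOp_const_mul, map_smul, smul_eq_mul, inv_mul_le_iff₀ hC] at h
    exact h
  · rw [doubleOp_const_mul, doubleOp_segment hsa hsb, doubleOp_segment hsc hsd]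
    have h1 := tr.inner_mul_left_mono hac Z
    have h2 := tr.inner_mul_right_mono hbd Z
    rw [smul_mul_assoc, map_smul, smul_eq_mul] at h1
    rw [mul_smul_comm, map_smul, smul_eq_mul] at h2
    simp only [map_add, map_smul, smul_eq_mul]
    have h3 := mul_le_mul_of_nonneg_left h1 ht.1
    have h4 := mul_le_mul_of_nonneg_left h2 (sub_nonneg.2 ht.2)
    linarith

end Entropy

end FaithfulTrace

/-! ### Conditional expectations as projections on `L₂(ω)` -/

/-- The properties of a conditional expectation that do not mention its range. -/
structure IsCondExp {A : Type*} [CStarAlgebra A] [PartialOrder A] (E : A →ₗ[ℂ] A) : Prop where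
  nonneg : ∀ X, 0 ≤ X → 0 ≤ E X
  unital : E 1 = 1
  idem : ∀ X, E (E X) = E X
  map_star : ∀ X, E (star X) = star (E X)
  map_mul_left : ∀ X Y, E (E X * Y) = E X * E Y
  map_mul_right : ∀ X Y, E (Y * E X) = E Y * E X

theorem isStrictlyPositive_mul_cancel {A : Type*} [CStarAlgebra A] [PartialOrder A]
    [StarOrderedRing A] [FiniteDimensional ℂ A] {ω : A} (hω : IsStrictlyPositive ω) :
    ω * cfc (fun x : ℝ => x⁻¹) ω = 1 ∧ cfc (fun x : ℝ => x⁻¹) ω * ω = 1 := by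
  simpa using FaithfulTrace.mul_resolvent_cancel hω le_rfl

theorem logMean_comm {q r : ℝ} (hq : 0 < q) (hr : 0 < r) : logMean q r = logMean r q := by
  have h1 : invLogMean q r = invLogMean r q := by
    rw [← halfLogMean_add_swap hq hr, ← halfLogMean_add_swap hr hq, add_comm]
  apply mul_right_cancel₀ (invLogMean_pos hq hr).ne'
  rw [logMean_mul_invLogMean hq hr, h1, logMean_mul_invLogMean hr hq]

namespace FaithfulTrace

section SelfAdjoint

variable {A : Type*} [CStarAlgebra A] [PartialOrder A] [StarOrderedRing A]
  [FiniteDimensional ℂ A] (tr : FaithfulTrace A)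

omit [PartialOrder A] [StarOrderedRing A] in
theorem map_mul_of_predual_eq {E : A →ₗ[ℂ] A} {ω : A} (h : tr.predual E ω = ω) (X : A) :
    tr (ω * E X) = tr (ω * X) := by
  rw [← tr.predual_spec, h]

omit [PartialOrder A] [StarOrderedRing A] [FiniteDimensional ℂ A] in
theorem eq_of_map_mul_eq {X Y : A} (h : ∀ Z, tr (Z * X) = tr (Z * Y)) : X = Y :=
  tr.ext_inner fun Z => by rw [inner_apply, inner_apply, h]

omit [StarOrderedRing A] in
-- Invariance of `ω` and the bimodule property make both sides equal to `tr (ω E(X) E(Y))`: symmetry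
-- for the one-sided weight, from which symmetry on `L₂(ω)` is derived.
theorem map_mul_condExp_comm {E : A →ₗ[ℂ] A} (hE : IsCondExp E) {ω : A}
    (h : tr.predual E ω = ω) (X Y : A) : tr (ω * (X * E Y)) = tr (ω * (E X * Y)) := by
  rw [← tr.map_mul_of_predual_eq h, hE.map_mul_right, ← hE.map_mul_left,
    tr.map_mul_of_predual_eq h]

/-- A conditional expectation with invariant state `ω` commutes with the modular operator. -/
theorem condExp_modular {E : A →ₗ[ℂ] A} (hE : IsCondExp E) {ω : A} (hω : IsStrictlyPositive ω)
    (h : tr.predual E ω = ω) (Y : A) :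
    E (doubleOp (fun x y => x * y⁻¹) ω ω Y) = doubleOp (fun x y => x * y⁻¹) ω ω (E Y) := by
  have hsω : IsSelfAdjoint ω := hω.isSelfAdjoint
  obtain ⟨h1, h2⟩ := isStrictlyPositive_mul_cancel hω
  simp only [doubleOp_mul (fun x => x) (fun y => y⁻¹) hsω hsω, cfc_id' ℝ ω]
  generalize cfc (fun x : ℝ => x⁻¹) ω = v at *
  refine tr.eq_of_map_mul_eq fun Z => ?_
  -- Inserting `ω ω⁻¹` puts `ω` in front. Cyclicity then turns the modular twist into an exchange of
  -- factors, after which the one-sided symmetry applies a second time.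
  have key : ∀ W : A, tr (Z * W) = tr (ω * (v * Z * W)) := fun W => by
    rw [mul_assoc v, ← mul_assoc ω, h1, one_mul]
  rw [key, tr.map_mul_condExp_comm hE h, tr.mul_comm' Z]
  calc tr (ω * (E (v * Z) * (ω * Y * v))) = tr (ω * (Y * E (v * Z))) := by
        rw [← mul_assoc, ← mul_assoc, tr.mul_comm', ← mul_assoc v, ← mul_assoc v,
          h2, one_mul, tr.mul_comm', mul_assoc]
    _ = tr (ω * (E Y * (v * Z))) := tr.map_mul_condExp_comm hE h _ _
    _ = _ := by simp only [mul_assoc]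

theorem condExp_doubleOp_eval {E : A →ₗ[ℂ] A} (hE : IsCondExp E) {ω : A}
    (hω : IsStrictlyPositive ω) (h : tr.predual E ω = ω) (p : Polynomial ℝ) (Y : A) :
    E (doubleOp (fun x y => p.eval (x * y⁻¹)) ω ω Y)
      = doubleOp (fun x y => p.eval (x * y⁻¹)) ω ω (E Y) := by
  have hsω : IsSelfAdjoint ω := hω.isSelfAdjoint
  induction p using Polynomial.induction_on generalizing Y with
  | C a =>
    simp only [Polynomial.eval_C]
    have h1 : ∀ Z, doubleOp (fun _ _ => a) ω ω Z = a • Z := fun Z => by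
      have := doubleOp_const_mul a (fun _ _ => 1) ω ω Z
      simpa [doubleOp_one hsω hsω] using this
    rw [h1, h1, LinearMap.map_smul_of_tower]
  | add p q hp hq =>
    simp only [Polynomial.eval_add]
    rw [doubleOp_add (fun x y => p.eval (x * y⁻¹)), doubleOp_add (fun x y => p.eval (x * y⁻¹)),
      map_add, hp, hq]
  | monomial n a ih =>
    have h1 : ∀ Z, doubleOp (fun x y => (Polynomial.C a * Polynomial.X ^ (n + 1)).eval
        (x * y⁻¹)) ω ω Z = doubleOp (fun x y => (Polynomial.C a * Polynomial.X ^ n).eval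
        (x * y⁻¹)) ω ω (doubleOp (fun x y => x * y⁻¹) ω ω Z) := fun Z => by
      rw [doubleOp_doubleOp]
      congr 2
      ext x y
      simp [pow_succ, mul_assoc]
    rw [h1, ih, tr.condExp_modular hE hω h, ← h1]

/-- Only finitely many ratios `x / y` of eigenvalues occur, so Lagrange interpolation replaces `g`
by a polynomial in the modular operator. -/
theorem condExp_doubleOp_comp {E : A →ₗ[ℂ] A} (hE : IsCondExp E) {ω : A}
    (hω : IsStrictlyPositive ω) (h : tr.predual E ω = ω) (g : ℝ → ℝ) (Y : A) :
    E (doubleOp (fun x y => g (x * y⁻¹)) ω ω Y) = doubleOp (fun x y => g (x * y⁻¹)) ω ω (E Y) := by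
  let R : Finset ℝ := (realSpec ω ×ˢ realSpec ω).image fun z => z.1 * z.2⁻¹
  have h1 := tr.condExp_doubleOp_eval hE hω h (Lagrange.interpolate R id g) Y
  have h2 : doubleOp (fun x y => (Lagrange.interpolate R id g).eval (x * y⁻¹)) ω ω
      = doubleOp (fun x y => g (x * y⁻¹)) ω ω := by
    refine doubleOp_congr fun x hx y hy => ?_
    have hmem : x * y⁻¹ ∈ R := Finset.mem_image.2
      ⟨(x, y), Finset.mem_product.2 ⟨mem_realSpec.2 hx, mem_realSpec.2 hy⟩, rfl⟩
    simpa using Lagrange.eval_interpolate_at_node (s := R) (v := id) g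
      (Function.injective_id.injOn) hmem
  rwa [h2] at h1

/-- The real inner product of `L₂(ω)`. -/
def l2Form (ω : A) : LinearMap.BilinForm ℝ A :=
  tr.inner.compl₂ ((doubleOp logMean ω ω).restrictScalars ℝ)

omit [PartialOrder A] [StarOrderedRing A] in
theorem l2Form_apply (ω X Y : A) : tr.l2Form ω X Y = tr.inner X (doubleOp logMean ω ω Y) := rfl

omit [PartialOrder A] [StarOrderedRing A] in
theorem l2Form_comm (ω X Y : A) : tr.l2Form ω X Y = tr.l2Form ω Y X := by
  rw [l2Form_apply, l2Form_apply, inner_doubleOp_comm, inner_comm]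

variable {ω : A}

theorem l2Form_self_nonneg (hω : IsStrictlyPositive ω) (X : A) : 0 ≤ tr.l2Form ω X X :=
  tr.inner_doubleOp_nonneg (fun _ hx _ hy =>
    (logMean_pos (hω.spectrum_pos hx) (hω.spectrum_pos hy)).le) X

/-- The map `Γ_ω`, that is `X ↦ ∫₀¹ ωˢ X ω¹⁻ˢ ds`, has the inverse `doubleOp invLogMean ω ω`. -/
theorem doubleOp_logMean_invLogMean (hω : IsStrictlyPositive ω) (X : A) :
    doubleOp logMean ω ω (doubleOp invLogMean ω ω X) = X := by
  have hsω : IsSelfAdjoint ω := hω.isSelfAdjoint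
  rw [doubleOp_doubleOp, doubleOp_congr (k' := fun _ _ => 1), doubleOp_one hsω hsω]
  exact fun x hx y hy => logMean_mul_invLogMean (hω.spectrum_pos hx) (hω.spectrum_pos hy)

theorem doubleOp_invLogMean_logMean (hω : IsStrictlyPositive ω) (X : A) :
    doubleOp invLogMean ω ω (doubleOp logMean ω ω X) = X := by
  have hsω : IsSelfAdjoint ω := hω.isSelfAdjoint
  rw [doubleOp_doubleOp, doubleOp_congr (k' := fun _ _ => 1), doubleOp_one hsω hsω]
  intro x hx y hy
  rw [mul_comm]
  exact logMean_mul_invLogMean (hω.spectrum_pos hx) (hω.spectrum_pos hy)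

omit [PartialOrder A] [StarOrderedRing A] in
theorem l2Form_isSymm : LinearMap.IsSymm (tr.l2Form ω) := ⟨fun X Y => tr.l2Form_comm ω X Y⟩

theorem l2Form_sq_le (hω : IsStrictlyPositive ω) (X Y : A) :
    tr.l2Form ω X Y ^ 2 ≤ tr.l2Form ω X X * tr.l2Form ω Y Y :=
  LinearMap.BilinForm.apply_sq_le_of_symm _ (tr.l2Form_self_nonneg hω) tr.l2Form_isSymm X Y

theorem l2Form_self_pos (hω : IsStrictlyPositive ω) {X : A} (hX : X ≠ 0) :
    0 < tr.l2Form ω X X := by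
  refine lt_of_le_of_ne (tr.l2Form_self_nonneg hω X) fun h0 => ?_
  -- Cauchy–Schwarz against `Γ⁻¹ X` bounds `⟨X,X⟩²` for the trace by a multiple of the form assumed
  -- to vanish.
  have h1 := tr.l2Form_sq_le hω (doubleOp invLogMean ω ω X) X
  rw [← h0, mul_zero, l2Form_comm, l2Form_apply, doubleOp_logMean_invLogMean hω] at h1
  have h2 := tr.inner_self_pos hX
  have := pow_pos h2 2
  linarith

/-- A conditional expectation with invariant state `ω` is self-adjoint on `L₂(ω)`. -/
theorem l2Form_condExp_comm {E : A →ₗ[ℂ] A} (hE : IsCondExp E) (hω : IsStrictlyPositive ω)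
    (h : tr.predual E ω = ω) (X Y : A) : tr.l2Form ω X (E Y) = tr.l2Form ω (E X) Y := by
  have hsω : IsSelfAdjoint ω := hω.isSelfAdjoint
  -- By homogeneity of the logarithmic mean the form is the one-sided form of `ω` twisted by a
  -- function of the modular operator, and `E` commutes with the twist.
  have key : ∀ U V, tr.l2Form ω U V
      = (tr (ω * (star U * doubleOp (fun x y => logMean (x * y⁻¹) 1) ω ω V))).re := fun U V => by
    have h1 : doubleOp logMean ω ω V
        = doubleOp (fun x y => logMean (x * y⁻¹) 1) ω ω V * ω := by
      conv_rhs => rw [← cfc_id' ℝ ω]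
      rw [cfc_id' ℝ ω, ← cfc_id' ℝ ω, ← doubleOp_right (a := ω) (fun x => x) hsω hsω, cfc_id' ℝ ω,
        doubleOp_doubleOp]
      refine LinearMap.congr_fun (doubleOp_congr fun x hx y hy => ?_) V
      rw [logMean_eq_mul (hω.spectrum_pos hx) (hω.spectrum_pos hy), mul_comm, div_eq_mul_inv]
    rw [l2Form_apply, inner_apply, h1, ← mul_assoc, tr.mul_comm']
  rw [key, key, ← tr.condExp_doubleOp_comp hE hω h (fun z => logMean z 1),
    tr.map_mul_condExp_comm hE h, hE.map_star]

/-- Self-adjointness of `E` on `L₂(ω)`, read through the trace pairing. Thus `Γ` intertwines `E`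
with its predual map, which moves the argument from densities to `L₂(ω)`. -/
theorem predual_doubleOp_logMean {E : A →ₗ[ℂ] A} (hE : IsCondExp E) (hω : IsStrictlyPositive ω)
    (h : tr.predual E ω = ω) (Y : A) :
    tr.predual E (doubleOp logMean ω ω Y) = doubleOp logMean ω ω (E Y) := by
  refine tr.ext_inner fun Z => ?_
  rw [← l2Form_apply, tr.l2Form_condExp_comm hE hω h, l2Form_apply, inner_apply, inner_apply,
    tr.mul_comm', tr.predual_spec, hE.map_star, tr.mul_comm']

theorem predual_eq_doubleOp {E : A →ₗ[ℂ] A} (hE : IsCondExp E) (hω : IsStrictlyPositive ω)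
    (h : tr.predual E ω = ω) (X : A) :
    doubleOp invLogMean ω ω (tr.predual E X) = E (doubleOp invLogMean ω ω X) := by
  have := tr.predual_doubleOp_logMean hE hω h (doubleOp invLogMean ω ω X)
  rw [doubleOp_logMean_invLogMean hω] at this
  rw [this, doubleOp_invLogMean_logMean hω]

theorem l2Form_condExp_self {E : A →ₗ[ℂ] A} (hE : IsCondExp E) (hω : IsStrictlyPositive ω)
    (h : tr.predual E ω = ω) (X : A) : tr.l2Form ω X (E X) = tr.l2Form ω (E X) (E X) := by
  rw [← hE.idem X, tr.l2Form_condExp_comm hE hω h, hE.idem]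

theorem l2Form_sub_condExp {E : A →ₗ[ℂ] A} (hE : IsCondExp E) (hω : IsStrictlyPositive ω)
    (h : tr.predual E ω = ω) (X : A) :
    tr.l2Form ω (X - E X) (X - E X) = tr.l2Form ω X X - tr.l2Form ω (E X) (E X) := by
  simp only [map_sub, LinearMap.sub_apply]
  rw [tr.l2Form_comm ω (E X) X, tr.l2Form_condExp_self hE hω h]
  ring

theorem l2Form_condExp_le {E : A →ₗ[ℂ] A} (hE : IsCondExp E) (hω : IsStrictlyPositive ω)
    (h : tr.predual E ω = ω) (X : A) : tr.l2Form ω (E X) (E X) ≤ tr.l2Form ω X X := by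
  have := tr.l2Form_sub_condExp hE hω h X
  have := tr.l2Form_self_nonneg hω (X - E X)
  linarith

theorem l2Norm_eq (hω : IsStrictlyPositive ω) (X : A) : tr.l2Norm ω X = √(tr.l2Form ω X X) := by
  have hsω : IsSelfAdjoint ω := hω.isSelfAdjoint
  rw [l2Norm, l2Form_apply]
  congr 1
  have h1 := tr.integral_inner_doubleOp (k := fun s q r => q ^ s * r ^ (1 - s)) (a := ω) (b := ω)
    (c := 0) (d := 1) (fun x hx y hy => (continuous_rpow_mul_rpow (hω.spectrum_pos hx)
      (hω.spectrum_pos hy)).intervalIntegrable _ _) X X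
  refine Eq.trans ?_ h1
  refine intervalIntegral.integral_congr fun s _ => ?_
  rw [doubleOp_mul (fun q => q ^ s) (fun r => r ^ (1 - s)) hsω hsω,
    ← CFC.rpow_eq_cfc_real hω.nonneg, ← CFC.rpow_eq_cfc_real hω.nonneg, inner_apply]
  simp only [mul_assoc]

/-- In `L₂(ω)` the self-adjoint and the skew-adjoint part of an element are orthogonal. -/
theorem l2Form_add_I_smul (hω : IsStrictlyPositive ω) {X Y : A} (hX : IsSelfAdjoint X) (hY : IsSelfAdjoint Y) :
    tr.l2Form ω (X + Complex.I • Y) (X + Complex.I • Y)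
      = tr.l2Form ω X X + tr.l2Form ω Y Y := by
  have hG : IsSelfAdjoint (doubleOp logMean ω ω Y) := by
    rw [isSelfAdjoint_iff, star_doubleOp, hY.star_eq]
    exact LinearMap.congr_fun (doubleOp_congr fun x hx y hy =>
      logMean_comm (hω.spectrum_pos hy) (hω.spectrum_pos hx)) Y
  have h1 : tr.l2Form ω X (Complex.I • Y) = 0 := by
    have h2 := tr.map_star (X * doubleOp logMean ω ω Y)
    rw [star_mul, hG.star_eq, hX.star_eq, tr.mul_comm'] at h2
    have h3 := congrArg Complex.im h2
    simp at h3
    rw [l2Form_apply, inner_apply, map_smul, hX.star_eq]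
    simp
    linarith
  have h2 : tr.l2Form ω (Complex.I • Y) (Complex.I • Y) = tr.l2Form ω Y Y := by
    simp [l2Form_apply, inner_apply, ← mul_assoc]
  simp only [map_add, LinearMap.add_apply, h2]
  rw [tr.l2Form_comm ω (Complex.I • Y) X, h1]
  ring

end SelfAdjoint

end FaithfulTrace

/-! ### Contraction and gap for a pair of projections -/

/-- Two conditional expectations together with the conditional expectation onto the intersection of
their ranges. -/
structure IsCondExpPair {A : Type*} [CStarAlgebra A] [PartialOrder A] (E E₁ E₂ : A →ₗ[ℂ] A) :
    Prop where
  condExp : IsCondExp E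
  left : IsCondExp E₁
  right : IsCondExp E₂
  map_left : ∀ X, E (E₁ X) = E X
  left_map : ∀ X, E₁ (E X) = E X
  map_right : ∀ X, E (E₂ X) = E X
  right_map : ∀ X, E₂ (E X) = E X
  inter : ∀ X, E₁ X = X → E₂ X = X → E X = X

theorem IsCondExpPair.symm {A : Type*} [CStarAlgebra A] [PartialOrder A] {E E₁ E₂ : A →ₗ[ℂ] A}
    (h : IsCondExpPair E E₁ E₂) : IsCondExpPair E E₂ E₁ :=
  ⟨h.condExp, h.right, h.left, h.map_right, h.right_map, h.map_left, h.left_map,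
    fun X h1 h2 => h.inter X h2 h1⟩

/-- If `y` is positive and `x / y > 1`, its powers would outgrow any `K`. Exponents `2 ^ k` suffice,
and these are what repeated Cauchy–Schwarz produces. -/
theorem le_of_forall_pow_two_pow_le {x y K : ℝ} (hy : 0 ≤ y)
    (h : ∀ k : ℕ, x ^ 2 ^ k ≤ K * y ^ 2 ^ k) : x ≤ y := by
  by_contra! hlt
  rcases hy.eq_or_lt with h0 | h0
  · have := h 0
    simp [← h0] at this
    linarith
  · have h1 : 1 < x / y := (one_lt_div h0).2 hlt
    obtain ⟨n, hn⟩ := pow_unbounded_of_one_lt K h1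
    have h2 : (x / y) ^ n ≤ (x / y) ^ 2 ^ n := pow_le_pow_right₀ h1.le Nat.lt_two_pow_self.le
    have h3 := h n
    rw [div_pow, div_pow] at h2
    rw [div_pow] at hn
    rw [← div_le_iff₀ (by positivity)] at h3
    linarith

/-- The quotient `g / f` is bounded on the compact unit sphere, and equal degrees of homogeneity
extend the bound to all vectors. -/
theorem exists_le_mul_of_homogeneous {A : Type*} [NormedAddCommGroup A] [NormedSpace ℝ A]
    [FiniteDimensional ℝ A] {f g : A → ℝ} (hf : Continuous f) (hg : Continuous g)
    (hf2 : ∀ (r : ℝ) X, f (r • X) = r ^ 2 * f X) (hg2 : ∀ (r : ℝ) X, g (r • X) = r ^ 2 * g X)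
    (hpos : ∀ X, X ≠ 0 → 0 < f X) : ∃ c : ℝ, 1 ≤ c ∧ ∀ X, g X ≤ c * f X := by
  have : ProperSpace A := FiniteDimensional.proper ℝ A
  obtain ⟨c, hc⟩ := (isCompact_sphere (0 : A) 1).bddAbove_image (f := fun X => g X / f X)
    (hg.continuousOn.div hf.continuousOn fun X hX => (hpos X (by
      rintro rfl; simp at hX)).ne')
  refine ⟨max c 1, le_max_right _ _, fun X => ?_⟩
  by_cases hX : X = 0
  · have h1 := hf2 0 0
    have h2 := hg2 0 0
    simp at h1 h2
    simp [hX, h1, h2]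
  · have h0 : ‖X‖ ≠ 0 := norm_ne_zero_iff.2 hX
    have h1 : X = ‖X‖ • (‖X‖⁻¹ • X) := by rw [smul_smul, mul_inv_cancel₀ h0, one_smul]
    set u := ‖X‖⁻¹ • X with hu
    have hu1 : ‖u‖ = 1 := by rw [hu, norm_smul, norm_inv, norm_norm, inv_mul_cancel₀ h0]
    have hu0 : 0 < f u := hpos u (by rintro h; simp [h] at hu1)
    have h2 : g u / f u ≤ c := hc ⟨u, by simp [hu1], rfl⟩
    have h3 : g u ≤ max c 1 * f u := by
      rw [div_le_iff₀ hu0] at h2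
      exact h2.trans (mul_le_mul_of_nonneg_right (le_max_left _ _) hu0.le)
    rw [h1, hf2, hg2, mul_left_comm]
    exact mul_le_mul_of_nonneg_left h3 (sq_nonneg _)

namespace FaithfulTrace

variable {A : Type*} [CStarAlgebra A] [PartialOrder A] [StarOrderedRing A]
  [FiniteDimensional ℂ A] (tr : FaithfulTrace A) {E E₁ E₂ : A →ₗ[ℂ] A} {ω : A}

omit [PartialOrder A] [StarOrderedRing A] in
theorem predual_eq_of_comp {E E' : A →ₗ[ℂ] A} (h : ∀ X, E (E' X) = E X)
    (hω : tr.predual E ω = ω) : tr.predual E' ω = ω := by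
  refine tr.eq_of_map_mul_eq fun Z => ?_
  rw [tr.mul_comm', tr.predual_spec, ← tr.map_mul_of_predual_eq hω, h,
    tr.map_mul_of_predual_eq hω, tr.mul_comm']

omit [PartialOrder A] [StarOrderedRing A] in
theorem continuous_l2Form_self (T : A →ₗ[ℂ] A) :
    Continuous fun X => tr.l2Form ω (T X) (T X) := by
  simp only [l2Form_apply, inner_apply]
  have h1 : Continuous T := LinearMap.continuous_of_finiteDimensional T
  have h2 : Continuous (doubleOp logMean ω ω) := LinearMap.continuous_of_finiteDimensional _
  have h3 : Continuous tr.toLinearMap := LinearMap.continuous_of_finiteDimensional _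
  fun_prop

omit [FiniteDimensional ℂ A] in
theorem l2OpNorm_nonneg (T : A →ₗ[ℂ] A) : 0 ≤ tr.l2OpNorm ω T :=
  Real.sInf_nonneg fun _ hx => hx.1

theorem l2OpNorm_le_sqrt (hω : IsStrictlyPositive ω) {K : ℝ} {T : A →ₗ[ℂ] A} (hK : 0 ≤ K)
    (hT : ∀ X, tr.l2Form ω (T X) (T X) ≤ K * tr.l2Form ω X X) :
    tr.l2OpNorm ω T ≤ √K := by
  refine csInf_le ⟨0, fun _ hx => hx.1⟩ ⟨Real.sqrt_nonneg _, fun X => ?_⟩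
  rw [tr.l2Norm_eq hω, tr.l2Norm_eq hω, ← Real.sqrt_mul hK]
  exact Real.sqrt_le_sqrt (hT X)

section Pair

variable (h : IsCondExpPair E E₁ E₂) (hω : IsStrictlyPositive ω) (hinv : tr.predual E ω = ω)

include h hω hinv

/-- The operator is `E₁E₂(1 - E)`, a product of contractions. If the step through `E₁` loses no
norm, then `V = E₂(X - E X)` is fixed by both `E₁` and `E₂`, so it is fixed by `E`; but `E V = 0`,
so the image is zero. -/
theorem l2Form_comp_sub_lt {X : A} (hX : X ≠ 0) :
    tr.l2Form ω ((E₁ ∘ₗ E₂ - E) X) ((E₁ ∘ₗ E₂ - E) X) < tr.l2Form ω X X := by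
  have hinv₁ := tr.predual_eq_of_comp h.map_left hinv
  have hinv₂ := tr.predual_eq_of_comp h.map_right hinv
  have e1 : (E₁ ∘ₗ E₂ - E) X = E₁ (E₂ (X - E X)) := by
    simp [h.right_map, h.left_map]
  rw [e1]
  set V := E₂ (X - E X)
  have h0 := tr.l2Form_sub_condExp h.condExp hω hinv X
  have h1 := tr.l2Form_condExp_le h.right hω hinv₂ (X - E X)
  have h2 := tr.l2Form_sub_condExp h.left hω hinv₁ V
  have h3 := tr.l2Form_self_nonneg hω (E X)
  by_cases hV : V - E₁ V = 0
  · have h4 : E V = V := h.inter V (sub_eq_zero.1 hV).symm (h.right.idem _)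
    have h5 : E V = 0 := by
      change E (E₂ _) = 0
      rw [h.map_right, map_sub, h.condExp.idem, sub_self]
    rw [← h4, h5]
    simpa using tr.l2Form_self_pos hω hX
  · have := tr.l2Form_self_pos hω hV
    linarith

/-- Compactness makes the strict contraction uniform: if `c` times the defect `q(X) - q(TX)`
dominates `q(X)`, then `K = 1 - c⁻¹` works. -/
theorem exists_l2Form_comp_sub_le : ∃ K : ℝ, 0 ≤ K ∧ K < 1 ∧ ∀ X,
    tr.l2Form ω ((E₁ ∘ₗ E₂ - E) X) ((E₁ ∘ₗ E₂ - E) X) ≤ K * tr.l2Form ω X X := by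
  have : FiniteDimensional ℝ A := FiniteDimensional.complexToReal A
  obtain ⟨c, hc, hle⟩ := exists_le_mul_of_homogeneous
    (f := fun X => tr.l2Form ω X X
      - tr.l2Form ω ((E₁ ∘ₗ E₂ - E) X) ((E₁ ∘ₗ E₂ - E) X)) (g := fun X => tr.l2Form ω X X)
    ((tr.continuous_l2Form_self LinearMap.id).sub (tr.continuous_l2Form_self _))
    (tr.continuous_l2Form_self LinearMap.id)
    (fun r X => by
      simp only [LinearMap.map_smul_of_tower]
      simp only [LinearMap.smul_apply, smul_eq_mul]
      ring)
    (fun r X => by simp only [map_smul, LinearMap.smul_apply, smul_eq_mul]; ring)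
    (fun X hX => sub_pos.2 (tr.l2Form_comp_sub_lt h hω hinv hX))
  have hc0 : 0 < c := by linarith
  refine ⟨1 - c⁻¹, sub_nonneg.2 (inv_le_one_of_one_le₀ hc), by linarith [inv_pos.2 hc0],
    fun X => ?_⟩
  have h1 := hle X
  rw [← inv_mul_le_iff₀ hc0] at h1
  linarith

theorem l2OpNorm_lt_one : tr.l2OpNorm ω (E₁ ∘ₗ E₂ - E) < 1 := by
  obtain ⟨K, hK, hK1, hT⟩ := tr.exists_l2Form_comp_sub_le h hω hinv
  refine (tr.l2OpNorm_le_sqrt hω hK hT).trans_lt ?_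
  rwa [Real.sqrt_lt' one_pos, one_pow]

/-- Each ratio `‖TX‖ / ‖X‖` is a lower bound of the set defining the operator norm. The previous
uniform bound shows that this set is nonempty, so its infimum is meaningful. -/
theorem l2Form_comp_sub_le (X : A) :
    tr.l2Form ω ((E₁ ∘ₗ E₂ - E) X) ((E₁ ∘ₗ E₂ - E) X)
      ≤ tr.l2OpNorm ω (E₁ ∘ₗ E₂ - E) ^ 2 * tr.l2Form ω X X := by
  obtain ⟨K, hK, hK1, hT⟩ := tr.exists_l2Form_comp_sub_le h hω hinv
  set T := E₁ ∘ₗ E₂ - E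
  by_cases hX : X = 0
  · simp [hX]
  have hpos := tr.l2Form_self_pos hω hX
  have h1 : √(tr.l2Form ω (T X) (T X) / tr.l2Form ω X X) ≤ tr.l2OpNorm ω T := by
    refine le_csInf ⟨√K, Real.sqrt_nonneg _, fun X => ?_⟩ fun b hb => ?_
    · rw [tr.l2Norm_eq hω, tr.l2Norm_eq hω, ← Real.sqrt_mul hK]
      exact Real.sqrt_le_sqrt (hT X)
    · have := hb.2 X
      rw [tr.l2Norm_eq hω, tr.l2Norm_eq hω] at this
      rwa [Real.sqrt_div' _ hpos.le, div_le_iff₀ (Real.sqrt_pos.2 hpos)]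
  rw [Real.sqrt_le_iff, div_le_iff₀ hpos] at h1
  exact h1.2

theorem l2Form_comp_sub_comm (X Y : A) :
    tr.l2Form ω X ((E₁ ∘ₗ E₂ - E) Y) = tr.l2Form ω ((E₂ ∘ₗ E₁ - E) X) Y := by
  have hinv₁ := tr.predual_eq_of_comp h.map_left hinv
  have hinv₂ := tr.predual_eq_of_comp h.map_right hinv
  simp only [LinearMap.sub_apply, LinearMap.comp_apply, map_sub]
  rw [tr.l2Form_condExp_comm h.left hω hinv₁, tr.l2Form_condExp_comm h.right hω hinv₂,
    tr.l2Form_condExp_comm h.condExp hω hinv]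

/-- Bound on `E₂ E₁ E₂ - E = (E₂ E₁ - E) (E₁ E₂ - E)`. -/
theorem l2Form_sandwich_le {L : ℝ} (hL : ∀ X,
      tr.l2Form ω ((E₁ ∘ₗ E₂ - E) X) ((E₁ ∘ₗ E₂ - E) X) ≤ L * tr.l2Form ω X X) (hL0 : 0 ≤ L)
    (X : A) : tr.l2Form ω ((E₂ ∘ₗ E₁ ∘ₗ E₂ - E) X) ((E₂ ∘ₗ E₁ ∘ₗ E₂ - E) X)
      ≤ L ^ 2 * tr.l2Form ω X X := by
  -- The adjoint `E₂E₁ - E` obeys the same bound: `‖V‖² = ⟨Z, (E₁E₂ - E)V⟩`, then Cauchy–Schwarz and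
  -- division by `‖V‖²`.
  have hadj : ∀ Z, tr.l2Form ω ((E₂ ∘ₗ E₁ - E) Z) ((E₂ ∘ₗ E₁ - E) Z) ≤ L * tr.l2Form ω Z Z := by
    intro Z
    set V := (E₂ ∘ₗ E₁ - E) Z with hV
    by_cases hV0 : V = 0
    · rw [hV0]
      simpa using mul_nonneg hL0 (tr.l2Form_self_nonneg hω Z)
    · have hpos := tr.l2Form_self_pos hω hV0
      have h1 : tr.l2Form ω V V = tr.l2Form ω Z ((E₁ ∘ₗ E₂ - E) V) := by
        rw [tr.l2Form_comp_sub_comm h hω hinv]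
      have h2 := tr.l2Form_sq_le hω Z ((E₁ ∘ₗ E₂ - E) V)
      rw [← h1] at h2
      have h3 := mul_le_mul_of_nonneg_left (hL V) (tr.l2Form_self_nonneg hω Z)
      have h4 : tr.l2Form ω V V * tr.l2Form ω V V
          ≤ (L * tr.l2Form ω Z Z) * tr.l2Form ω V V := by nlinarith
      exact le_of_mul_le_mul_right h4 hpos
  have e : (E₂ ∘ₗ E₁ ∘ₗ E₂ - E) X = (E₂ ∘ₗ E₁ - E) ((E₁ ∘ₗ E₂ - E) X) := by
    simp [h.left.idem, h.left_map, h.right_map, h.map_left, h.map_right, h.condExp.idem]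
  rw [e]
  calc _ ≤ L * (L * tr.l2Form ω X X) := (hadj _).trans (mul_le_mul_of_nonneg_left (hL X) hL0)
    _ = _ := by ring

/-- The bound is on matrix coefficients for the trace, so the state enters only through the constant
`K`. In this form the rate can be carried to other invariant states and to matrix amplifications. -/
theorem abs_inner_sandwich_pow_le {L : ℝ} (hL : ∀ X,
      tr.l2Form ω ((E₁ ∘ₗ E₂ - E) X) ((E₁ ∘ₗ E₂ - E) X) ≤ L * tr.l2Form ω X X) (hL0 : 0 ≤ L)
    (W V : A) : ∃ K : ℝ, ∀ m : ℕ,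
      |tr.inner W (((E₂ ∘ₗ E₁ ∘ₗ E₂ - E) ^ m) V)| ≤ K * L ^ m := by
  set S := E₂ ∘ₗ E₁ ∘ₗ E₂ - E with hS
  set U := doubleOp invLogMean ω ω W
  refine ⟨√(tr.l2Form ω U U * tr.l2Form ω V V), fun m => ?_⟩
  have h1 : ∀ m : ℕ, tr.l2Form ω ((S ^ m) V) ((S ^ m) V) ≤ (L ^ m) ^ 2 * tr.l2Form ω V V := by
    intro m
    induction m with
    | zero => simp
    | succ m ih =>
      rw [pow_succ', Module.End.mul_apply]
      calc _ ≤ L ^ 2 * tr.l2Form ω ((S ^ m) V) ((S ^ m) V) :=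
            tr.l2Form_sandwich_le h hω hinv hL hL0 _
        _ ≤ L ^ 2 * ((L ^ m) ^ 2 * tr.l2Form ω V V) := mul_le_mul_of_nonneg_left ih (sq_nonneg _)
        _ = _ := by ring
  have h2 : tr.inner W ((S ^ m) V) = tr.l2Form ω U ((S ^ m) V) := by
    rw [l2Form_comm, l2Form_apply, doubleOp_logMean_invLogMean hω, inner_comm]
  rw [h2]
  refine abs_le_of_sq_le_sq ?_ (mul_nonneg (Real.sqrt_nonneg _) (pow_nonneg hL0 m))
  rw [mul_pow, Real.sq_sqrt (mul_nonneg (tr.l2Form_self_nonneg hω _)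
    (tr.l2Form_self_nonneg hω _))]
  have h3 := tr.l2Form_sq_le hω U ((S ^ m) V)
  have h4 := mul_le_mul_of_nonneg_left (h1 m) (tr.l2Form_self_nonneg hω U)
  linarith

/-- Since `S` is self-adjoint on `L₂(ω)`, Cauchy–Schwarz gives `b m ^ 2 ≤ b (2 * m)` for the
normalized moments `|⟨V, Sᵐ V⟩|`, hence `b 1 ^ 2 ^ k ≤ b (2 ^ k)`, and the constant in the growth
bound washes out. Here `ω` may differ from the state at which the rate was obtained. -/
theorem l2Form_sandwich_self_le {L : ℝ} (hL0 : 0 ≤ L) (hgrowth : ∀ W V, ∃ K : ℝ, ∀ m : ℕ,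
      |tr.inner W (((E₂ ∘ₗ E₁ ∘ₗ E₂ - E) ^ m) V)| ≤ K * L ^ m) (V : A) :
    tr.l2Form ω V ((E₂ ∘ₗ E₁ ∘ₗ E₂ - E) V) ≤ L * tr.l2Form ω V V := by
  have hinv₁ := tr.predual_eq_of_comp h.map_left hinv
  have hinv₂ := tr.predual_eq_of_comp h.map_right hinv
  set S := E₂ ∘ₗ E₁ ∘ₗ E₂ - E with hS
  by_cases hV : V = 0
  · simp [hV]
  have hpos := tr.l2Form_self_pos hω hV
  have hsymm : ∀ X Y, tr.l2Form ω X (S Y) = tr.l2Form ω (S X) Y := fun X Y => by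
    simp only [hS, LinearMap.sub_apply, LinearMap.comp_apply, map_sub]
    rw [tr.l2Form_condExp_comm h.right hω hinv₂, tr.l2Form_condExp_comm h.left hω hinv₁,
      tr.l2Form_condExp_comm h.right hω hinv₂, tr.l2Form_condExp_comm h.condExp hω hinv]
  have hsymm' : ∀ (m : ℕ) X Y, tr.l2Form ω X ((S ^ m) Y) = tr.l2Form ω ((S ^ m) X) Y := by
    intro m
    induction m with
    | zero => simp
    | succ m ih =>
      intro X Y
      rw [pow_succ', Module.End.mul_apply, hsymm, ih, ← Module.End.mul_apply,
        ← pow_succ, ← pow_succ']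
  set b : ℕ → ℝ := fun m => |tr.l2Form ω V ((S ^ m) V)| / tr.l2Form ω V V with hb
  have hb0 : ∀ m, 0 ≤ b m := fun m => div_nonneg (abs_nonneg _) hpos.le
  have hdouble : ∀ m, b m ^ 2 ≤ b (2 * m) := by
    intro m
    have h1 := tr.l2Form_sq_le hω V ((S ^ m) V)
    have h2 : tr.l2Form ω ((S ^ m) V) ((S ^ m) V) = tr.l2Form ω V ((S ^ (2 * m)) V) := by
      rw [← hsymm', ← Module.End.mul_apply, ← pow_add, two_mul]
    rw [h2] at h1
    simp only [hb]
    rw [div_pow, sq_abs, sq (tr.l2Form ω V V), div_le_div_iff₀ (mul_pos hpos hpos) hpos]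
    have h3 := h1.trans (mul_le_mul_of_nonneg_left (le_abs_self _) hpos.le)
    nlinarith
  have hpow : ∀ k : ℕ, b 1 ^ 2 ^ k ≤ b (2 ^ k) := by
    intro k
    induction k with
    | zero => simp
    | succ k ih =>
      calc b 1 ^ 2 ^ (k + 1) = (b 1 ^ 2 ^ k) ^ 2 := by rw [← pow_mul, pow_succ]
        _ ≤ b (2 ^ k) ^ 2 := pow_le_pow_left₀ (pow_nonneg (hb0 1) _) ih 2
        _ ≤ b (2 ^ (k + 1)) := (hdouble (2 ^ k)).trans_eq (congrArg b (pow_succ' 2 k).symm)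
  obtain ⟨K, hK⟩ := hgrowth (doubleOp logMean ω ω V) V
  have h1 : b 1 ≤ L := by
    refine le_of_forall_pow_two_pow_le (K := K / tr.l2Form ω V V) hL0 fun k =>
      (hpow k).trans ?_
    have h2 := hK (2 ^ k)
    rw [← inner_doubleOp_comm] at h2
    rw [div_mul_eq_mul_div]
    exact div_le_div_of_nonneg_right h2 hpos.le
  simp only [hb, pow_one] at h1
  rw [div_le_iff₀ hpos] at h1
  exact (le_abs_self _).trans h1

/-- The gap inequality for two projections whose product has norm at most `lam` off the
intersection of their ranges. -/
theorem l2Form_gap {lam : ℝ} (hlam : 0 ≤ lam)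
    (hS : ∀ V, tr.l2Form ω V ((E₂ ∘ₗ E₁ ∘ₗ E₂ - E) V) ≤ lam ^ 2 * tr.l2Form ω V V)
    {X : A} (hX : E X = 0) : (1 - lam) * tr.l2Form ω X X
      ≤ tr.l2Form ω (X - E₁ X) (X - E₁ X) + tr.l2Form ω (X - E₂ X) (X - E₂ X) := by
  have hinv₁ := tr.predual_eq_of_comp h.map_left hinv
  have hinv₂ := tr.predual_eq_of_comp h.map_right hinv
  rw [tr.l2Form_sub_condExp h.left hω hinv₁, tr.l2Form_sub_condExp h.right hω hinv₂]
  have e1 := tr.l2Form_condExp_self h.left hω hinv₁ X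
  have e2 := tr.l2Form_condExp_self h.right hω hinv₂ X
  have hEv : E (E₂ X) = 0 := by rw [h.map_right, hX]
  have hv2 : E₂ (E₂ X) = E₂ X := h.right.idem X
  have hu1 : E₁ (E₁ X) = E₁ X := h.left.idem X
  set u := E₁ X
  set v := E₂ X
  have hqX := tr.l2Form_self_nonneg hω X
  have hqu := tr.l2Form_self_nonneg hω u
  have hqv := tr.l2Form_self_nonneg hω v
  -- The angle between the two ranges: as `E v = 0` and `E₂ v = v`, the hypothesis on `S` says `‖E₁
  -- v‖² ≤ lam² ‖v‖²`, and `⟨u, v⟩ = ⟨u, E₁ v⟩`.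
  have h1 : tr.l2Form ω u v ^ 2 ≤ lam ^ 2 * (tr.l2Form ω u u * tr.l2Form ω v v) := by
    have h2 : tr.l2Form ω u v = tr.l2Form ω u (E₁ v) := by
      rw [tr.l2Form_condExp_comm h.left hω hinv₁, hu1]
    have h3 := tr.l2Form_sq_le hω u (E₁ v)
    have h4 := hS v
    simp only [LinearMap.sub_apply, LinearMap.comp_apply, hEv, sub_zero, hv2] at h4
    rw [tr.l2Form_condExp_comm h.right hω hinv₂, hv2, tr.l2Form_condExp_self h.left hω hinv₁] at h4
    rw [h2]
    have := mul_le_mul_of_nonneg_left h4 hqu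
    linarith
  set s := tr.l2Form ω u u + tr.l2Form ω v v with hs
  have hs0 : 0 ≤ s := add_nonneg hqu hqv
  have h5 : 2 * tr.l2Form ω u v ≤ lam * s := by
    refine le_of_abs_le (abs_le_of_sq_le_sq ?_ (mul_nonneg hlam hs0))
    nlinarith [mul_nonneg (sq_nonneg lam) (sq_nonneg (tr.l2Form ω u u - tr.l2Form ω v v))]
  -- Since `⟨X, u + v⟩ = ‖u‖² + ‖v‖² = s`, Cauchy–Schwarz gives `s² ≤ ‖X‖² (s + 2⟨u,v⟩) ≤ (1 + lam)
  -- s ‖X‖²`. The claim is then `2‖X‖² - s ≥ (1 - lam)‖X‖²`.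
  have h6 := tr.l2Form_sq_le hω X (u + v)
  have h7 : tr.l2Form ω X (u + v) = s := by rw [map_add, e1, e2]
  have h8 : tr.l2Form ω (u + v) (u + v) = s + 2 * tr.l2Form ω u v := by
    simp only [map_add, LinearMap.add_apply]
    rw [tr.l2Form_comm ω v u]
    ring
  rw [h7, h8] at h6
  have h9 : s ≤ (1 + lam) * tr.l2Form ω X X := by
    rcases hs0.eq_or_lt with h0 | h0
    · rw [← h0]; positivity
    · refine le_of_mul_le_mul_right ?_ h0
      nlinarith [mul_le_mul_of_nonneg_left h5 hqX]
  linarith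

end Pair

end FaithfulTrace

/-! ### Predual maps and the upper bound for faithful states -/

namespace FaithfulTrace

variable {A : Type*} [CStarAlgebra A] [PartialOrder A] [StarOrderedRing A] (tr : FaithfulTrace A)

/-- Self-duality of the positive cone: testing against the negative part of `a` leaves minus its
squared norm. -/
theorem nonneg_of_inner_nonneg {a : A} (ha : IsSelfAdjoint a)
    (h : ∀ b, 0 ≤ b → 0 ≤ tr.inner a b) : 0 ≤ a := by
  have h1 := CFC.posPart_sub_negPart a ha
  have h2 := CFC.posPart_mul_negPart a
  have h3 : IsSelfAdjoint a⁺ := (CFC.posPart_nonneg a).isSelfAdjoint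
  have h4 := h a⁻ (CFC.negPart_nonneg a)
  have h5 : tr.inner a⁺ a⁻ = 0 := by rw [inner_apply, h3.star_eq, h2]; simp
  rw [← h1] at h4
  rw [map_sub, LinearMap.sub_apply, h1, h5] at h4
  have h6 : a⁻ = 0 := by
    by_contra hne
    have := tr.inner_self_pos hne
    linarith
  rw [← h1, h6, sub_zero]
  exact CFC.posPart_nonneg a

variable [FiniteDimensional ℂ A] {E E₁ E₂ : A →ₗ[ℂ] A} {ω : A}

omit [StarOrderedRing A] in
theorem isSelfAdjoint_predual (hE : IsCondExp E) {X : A} (hX : IsSelfAdjoint X) :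
    IsSelfAdjoint (tr.predual E X) := by
  refine tr.eq_of_map_mul_eq fun Z => ?_
  have h := tr.map_star (tr.predual E X * star Z)
  rw [star_mul, star_star] at h
  rw [h, tr.predual_spec, ← tr.map_star, star_mul, hX.star_eq, hE.map_star, star_star,
    tr.mul_comm' Z, tr.predual_spec, tr.mul_comm']

theorem predual_nonneg (hE : IsCondExp E) {X : A} (hX : 0 ≤ X) : 0 ≤ tr.predual E X := by
  have hs := tr.isSelfAdjoint_predual hE hX.isSelfAdjoint
  refine tr.nonneg_of_inner_nonneg hs fun b hb => ?_
  rw [inner_apply, hs.star_eq, tr.predual_spec]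
  have := tr.inner_nonneg hX (hE.nonneg b hb)
  rwa [inner_apply, hX.isSelfAdjoint.star_eq] at this

theorem predual_mono (hE : IsCondExp E) {X Y : A} (h : X ≤ Y) :
    tr.predual E X ≤ tr.predual E Y := by
  have := tr.predual_nonneg hE (sub_nonneg.2 h)
  rwa [map_sub, sub_nonneg] at this

omit [PartialOrder A] [StarOrderedRing A] in
theorem predual_predual_of_comp {E E' : A →ₗ[ℂ] A} (h : ∀ X, E (E' X) = E X) (ρ : A) :
    tr.predual E' (tr.predual E ρ) = tr.predual E ρ := by
  refine tr.eq_of_map_mul_eq fun Z => ?_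
  rw [tr.mul_comm', tr.predual_spec, tr.predual_spec, h, ← tr.predual_spec, tr.mul_comm']

omit [StarOrderedRing A] in
theorem map_predual (hE : IsCondExp E) (X : A) : tr (tr.predual E X) = tr X := by
  have := tr.predual_spec E X 1
  rwa [hE.unital, mul_one, mul_one] at this

omit [StarOrderedRing A] in
theorem inner_one_sub_predual (hE : IsCondExp E) (X : A) :
    tr.inner 1 (X - tr.predual E X) = 0 := by
  rw [inner_apply, star_one, one_mul, map_sub, tr.map_predual hE, sub_self, Complex.zero_re]

theorem inner_doubleOp_invLogMean_eq (hω : IsStrictlyPositive ω) (X : A) :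
    tr.inner X (doubleOp invLogMean ω ω X)
      = tr.l2Form ω (doubleOp invLogMean ω ω X) (doubleOp invLogMean ω ω X) := by
  rw [l2Form_apply, doubleOp_logMean_invLogMean hω, inner_comm]

/-- The exact entropy formula has densities `(ρ, ω₁)`; antitonicity replaces both by `ω` at the cost
`c`, and on equal densities the kernel is half of `invLogMean`. -/
theorem l2Form_le_relEnt {ρ ω₁ : A} (hρ : IsStrictlyPositive ρ) (hω₁ : IsStrictlyPositive ω₁)
    (hω : IsStrictlyPositive ω) {c : ℝ} (hc : 0 < c) (h : ρ ≤ c • ω) (h₁ : ω₁ ≤ c • ω)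
    (htr : tr.inner 1 (ρ - ω₁) = 0) :
    tr.l2Form ω (doubleOp invLogMean ω ω (ρ - ω₁)) (doubleOp invLogMean ω ω (ρ - ω₁))
      ≤ 2 * c * tr.relEnt ρ ω₁ := by
  have hs : IsSelfAdjoint (ρ - ω₁) := hρ.isSelfAdjoint.sub hω₁.isSelfAdjoint
  have h1 := tr.inner_doubleOp_halfLogMean_le hρ hω₁ hω hω hc h h₁ (ρ - ω₁)
  rw [← tr.inner_doubleOp_invLogMean_eq hω, ← tr.inner_doubleOp_halfLogMean_self hω hs,
    tr.relEnt_eq hρ hω₁, htr, add_zero]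
  linarith

theorem relEnt_nonneg_of_pos {ρ ω : A} (hρ : IsStrictlyPositive ρ) (hω : IsStrictlyPositive ω)
    (htr : tr.inner 1 (ρ - ω) = 0) : 0 ≤ tr.relEnt ρ ω := by
  rw [tr.relEnt_eq hρ hω, htr, add_zero]
  refine tr.inner_doubleOp_nonneg (fun x hx y hy => ?_) _
  refine intervalIntegral.integral_nonneg zero_le_one fun t ht => mul_nonneg
    (sub_nonneg.2 ht.2) (inv_nonneg.2 (segment_pos (hρ.spectrum_pos hx) (hω.spectrum_pos hy) ht).le)

/-- Approximate tensorization for faithful states. -/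
theorem relEnt_le_of_growth (h : IsCondExpPair E E₁ E₂) {lam : ℝ} (hlam : 0 ≤ lam)
    (hlam1 : lam < 1) (hgrowth : ∀ W V, ∃ K : ℝ, ∀ m : ℕ,
      |tr.inner W (((E₂ ∘ₗ E₁ ∘ₗ E₂ - E) ^ m) V)| ≤ K * (lam ^ 2) ^ m)
    {ρ : A} {c : ℝ} (hc : 0 < c) (hle : ρ ≤ c • tr.predual E ρ)
    (hρ : IsStrictlyPositive ρ) (hω : IsStrictlyPositive (tr.predual E ρ))
    (hω₁ : IsStrictlyPositive (tr.predual E₁ ρ)) (hω₂ : IsStrictlyPositive (tr.predual E₂ ρ)) :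
    tr.relEnt ρ (tr.predual E ρ)
      ≤ 2 * c / (1 - lam) * (tr.relEnt ρ (tr.predual E₁ ρ) + tr.relEnt ρ (tr.predual E₂ ρ)) := by
  have hinv := tr.predual_predual_of_comp h.condExp.idem ρ
  have hinv₁ := tr.predual_predual_of_comp h.map_left ρ
  have hinv₂ := tr.predual_predual_of_comp h.map_right ρ
  set ω := tr.predual E ρ with hωdef
  have hA := tr.relEnt_le hρ hω
  rw [tr.inner_one_sub_predual h.condExp, add_zero, tr.inner_doubleOp_invLogMean_eq hω] at hA
  -- Applying the positive map `F_*` to `ρ ≤ c ω`, with `ω` invariant, gives the same constant for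
  -- `F_* ρ`.
  have hle' : ∀ F : A →ₗ[ℂ] A, IsCondExp F → tr.predual F ω = ω →
      tr.predual F ρ ≤ c • ω := fun F hF hFω => by
    have := tr.predual_mono hF hle
    rwa [LinearMap.map_smul_of_tower, hFω] at this
  have hB₁ := tr.l2Form_le_relEnt hρ hω₁ hω hc hle (hle' _ h.left hinv₁)
    (tr.inner_one_sub_predual h.left ρ)
  have hB₂ := tr.l2Form_le_relEnt hρ hω₂ hω hc hle (hle' _ h.right hinv₂)
    (tr.inner_one_sub_predual h.right ρ)
  set Y := doubleOp invLogMean ω ω (ρ - ω) with hY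
  have hEY : E Y = 0 := by
    rw [hY, ← tr.predual_eq_doubleOp h.condExp hω hinv, map_sub, hinv, ← hωdef, sub_self, map_zero]
  -- The invariant `ω` cancels from `ρ - F_* ρ`, and `Γ⁻¹` carries `F_*` to `F`.
  have hsub : ∀ F : A →ₗ[ℂ] A, IsCondExp F → tr.predual F ω = ω →
      doubleOp invLogMean ω ω (ρ - tr.predual F ρ) = Y - F Y := fun F hF hFω => by
    rw [hY, ← tr.predual_eq_doubleOp hF hω hFω, ← map_sub, map_sub (tr.predual F), hFω]
    congr 1
    abel
  rw [hsub _ h.left hinv₁] at hB₁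
  rw [hsub _ h.right hinv₂] at hB₂
  have hS := tr.l2Form_sandwich_self_le h hω hinv (sq_nonneg lam) hgrowth
  have hgap := tr.l2Form_gap h hω hinv hlam hS hEY
  have h1 : 0 < 1 - lam := sub_pos.2 hlam1
  rw [div_mul_eq_mul_div, le_div_iff₀ h1]
  have := mul_le_mul_of_nonneg_right hA h1.le
  linarith

end FaithfulTrace

/-! ### Quasi-bases and finiteness of the index -/

theorem IsStrictlyPositive.exists_smul_one_le {A : Type*} [CStarAlgebra A] [PartialOrder A]
    [StarOrderedRing A] [FiniteDimensional ℂ A] {a : A} (ha : IsStrictlyPositive a) :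
    ∃ δ : ℝ, 0 < δ ∧ δ • (1 : A) ≤ a := by
  have hsa : IsSelfAdjoint a := ha.isSelfAdjoint
  by_cases hne : (realSpec a).Nonempty
  · refine ⟨(realSpec a).min' hne,
      ha.spectrum_pos (mem_realSpec.1 ((realSpec a).min'_mem hne)), ?_⟩
    rw [← Algebra.algebraMap_eq_smul_one, algebraMap_le_iff_le_spectrum]
    exact fun x hx => (realSpec a).min'_le x (mem_realSpec.2 hx)
  · have h1 := sum_specProj hsa
    rw [Finset.not_nonempty_iff_eq_empty.1 hne, Finset.sum_empty] at h1
    exact ⟨1, one_pos, by rw [← h1, smul_zero]; exact ha.nonneg⟩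

section Sum

variable {A : Type*} [CStarAlgebra A] [PartialOrder A] [StarOrderedRing A]

/-- Operator Cauchy–Schwarz, from expanding the positive element `∑ i j, |y i - y j|²`. -/
theorem star_sum_mul_sum_le {ι : Type*} [Fintype ι] (y : ι → A) :
    star (∑ i, y i) * ∑ i, y i ≤ (Fintype.card ι : ℝ) • ∑ i, star (y i) * y i := by
  have h1 : 0 ≤ ∑ i, ∑ j, star (y i - y j) * (y i - y j) :=
    Finset.sum_nonneg fun i _ => Finset.sum_nonneg fun j _ => star_mul_self_nonneg _
  have h2 : ∑ i, ∑ j, star (y i - y j) * (y i - y j)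
      = (2 : ℝ) • ((Fintype.card ι : ℝ) • ∑ i, star (y i) * y i
        - star (∑ i, y i) * ∑ i, y i) := by
    have e : ∀ i j, star (y i - y j) * (y i - y j) = star (y i) * y i + star (y j) * y j
        - (star (y i) * y j + star (y j) * y i) := fun i j => by
      rw [star_sub, sub_mul, mul_sub, mul_sub]
      abel
    have e1 : ∑ i, ∑ j, star (y i) * y j = star (∑ i, y i) * ∑ i, y i := by
      rw [star_sum, Finset.sum_mul_sum]
    have e2 : ∑ i, ∑ j, star (y j) * y i = star (∑ i, y i) * ∑ i, y i := by
      rw [Finset.sum_comm, e1]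
    simp only [e, Finset.sum_sub_distrib, Finset.sum_add_distrib, e1, e2, Finset.sum_const,
      Finset.card_univ, ← Finset.smul_sum, ← Nat.cast_smul_eq_nsmul ℝ]
    module
  rw [h2] at h1
  have h3 := smul_nonneg (by norm_num : (0 : ℝ) ≤ 1 / 2) h1
  rw [smul_smul] at h3
  norm_num at h3
  rwa [← star_sum] at h3

/-- A finite quasi-basis `(u, v)` of a conditional expectation, with bounds for its elements. -/
structure IsFrame {ι : Type*} [Fintype ι] (E : A →ₗ[ℂ] A) (u v : ι → A) (α : ℝ) : Prop where
  nonneg : 0 ≤ α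
  expand : ∀ x, ∑ i, v i * E (star (u i) * x) = x
  left_le : ∀ i, u i * star (u i) ≤ α • 1
  right_le : ∀ i, star (v i) * v i ≤ α • 1

/-- The Kadison–Schwarz inequality: the difference of the two sides is `E` of `|w - E w|²`. -/
theorem IsCondExp.star_mul_self_le {E : A →ₗ[ℂ] A} (hE : IsCondExp E) (w : A) :
    star (E w) * E w ≤ E (star w * w) := by
  have h := hE.nonneg _ (star_mul_self_nonneg (w - E w))
  have h1 : E (star (w - E w) * (w - E w)) = E (star w * w) - star (E w) * E w := by
    rw [star_sub, sub_mul, mul_sub, mul_sub, ← hE.map_star w]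
    simp only [map_sub, hE.map_mul_left, hE.map_mul_right, hE.idem]
    abel
  rwa [h1, sub_nonneg] at h

theorem IsCondExp.mono {E : A →ₗ[ℂ] A} (hE : IsCondExp E) {a b : A} (h : a ≤ b) : E a ≤ E b := by
  have := hE.nonneg _ (sub_nonneg.2 h)
  rwa [map_sub, sub_nonneg] at this

/-- The Pimsner–Popa inequality from a quasi-basis. -/
theorem IsFrame.star_mul_self_le {ι : Type*} [Fintype ι] {E : A →ₗ[ℂ] A} {u v : ι → A} {α : ℝ}
    (hf : IsFrame E u v α) (hE : IsCondExp E) (x : A) :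
    star x * x ≤ ((Fintype.card ι : ℝ) ^ 2 * α ^ 2) • E (star x * x) := by
  have hEx : 0 ≤ E (star x * x) := hE.nonneg _ (star_mul_self_nonneg x)
  -- One factor `α` bounds `star (v i) * v i`; the other bounds `u i * star (u i)` after
  -- Kadison–Schwarz.
  have hterm : ∀ i, star (v i * E (star (u i) * x)) * (v i * E (star (u i) * x))
      ≤ (α ^ 2) • E (star x * x) := by
    intro i
    have h1 := star_left_conjugate_le_conjugate (hf.right_le i) (E (star (u i) * x))
    have h2 := hE.star_mul_self_le (star (u i) * x)
    have h3 := hE.mono (star_left_conjugate_le_conjugate (hf.left_le i) x)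
    simp only [mul_smul_comm, smul_mul_assoc, mul_one, LinearMap.map_smul_of_tower] at h1 h3
    have h4 : star (star (u i) * x) * (star (u i) * x) = star x * (u i * star (u i)) * x := by
      simp [mul_assoc]
    rw [h4] at h2
    calc _ = star (E (star (u i) * x)) * (star (v i) * v i) * E (star (u i) * x) := by
          simp [mul_assoc]
      _ ≤ _ := h1
      _ ≤ α • (α • E (star x * x)) := smul_le_smul_of_nonneg_left (h2.trans h3) hf.nonneg
      _ = _ := by rw [smul_smul, sq]
  -- One factor of the cardinality comes from Cauchy–Schwarz, the second from adding the equal term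
  -- bounds.
  have h := star_sum_mul_sum_le fun i => v i * E (star (u i) * x)
  rw [hf.expand] at h
  refine h.trans ?_
  have h5 := Finset.sum_le_sum fun i (_ : i ∈ Finset.univ) => hterm i
  rw [Finset.sum_const, Finset.card_univ, ← Nat.cast_smul_eq_nsmul ℝ] at h5
  refine (smul_le_smul_of_nonneg_left h5 (Nat.cast_nonneg _)).trans_eq ?_
  rw [smul_smul, smul_smul]
  ring_nf

end Sum

namespace FaithfulTrace

variable {A : Type*} [CStarAlgebra A] [PartialOrder A] [StarOrderedRing A]
  [FiniteDimensional ℂ A] (tr : FaithfulTrace A) {E : A →ₗ[ℂ] A}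

theorem re_map_mul_star_mul_self_pos {σ : A} (hσ : IsStrictlyPositive σ) {x : A} (hx : x ≠ 0) :
    0 < (tr (σ * (star x * x))).re := by
  obtain ⟨δ, hδ, hle⟩ := hσ.exists_smul_one_le
  have h := tr.inner_mul_right_mono hle x
  rw [mul_smul_comm, mul_one, map_smul, smul_eq_mul] at h
  have h1 := mul_pos hδ (tr.inner_self_pos hx)
  have h2 : tr.inner x (x * σ) = (tr (σ * (star x * x))).re := by
    rw [inner_apply, ← mul_assoc, re_map_mul_comm]
  linarith

/-- For a vector space basis `u`, the frame operator `Θ x = ∑ u i * E (star (u i) * x)` is right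
linear over the range of `E`, and it is injective since `tr (σ x⋆ Θ x)` is a sum of terms `tr (σ |E
(star (u i) * x)|²)`. Setting `v i = Θ⁻¹ (u i)` gives the expansion after applying `Θ`. -/
theorem exists_isFrame (hE : IsCondExp E) {σ : A} (hσ : IsStrictlyPositive σ)
    (hinv : tr.predual E σ = σ) :
    ∃ (m : ℕ) (u v : Fin m → A) (α : ℝ), IsFrame E u v α := by
  let u := Module.finBasis ℂ A
  let Θ : A →ₗ[ℂ] A := ∑ i, LinearMap.mulLeft ℂ (u i) ∘ₗ E ∘ₗ LinearMap.mulLeft ℂ (star (u i))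
  have hΘ : ∀ x, Θ x = ∑ i, u i * E (star (u i) * x) := fun x => by simp [Θ]
  have hright : ∀ x z, Θ (x * E z) = Θ x * E z := fun x z => by
    rw [hΘ, hΘ, Finset.sum_mul]
    refine Finset.sum_congr rfl fun i _ => ?_
    rw [← mul_assoc (star (u i)), hE.map_mul_right, mul_assoc]
  have hnn : ∀ x : A, 0 ≤ (tr (σ * (star x * x))).re := fun x => by
    by_cases hx : x = 0
    · simp [hx]
    · exact (tr.re_map_mul_star_mul_self_pos hσ hx).le
  have hinj : Function.Injective Θ := by
    rw [← LinearMap.ker_eq_bot, LinearMap.ker_eq_bot']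
    intro x hx
    have h1 : ∑ i, (tr (σ * (star (E (star (u i) * x)) * E (star (u i) * x)))).re = 0 := by
      have h2 : tr (σ * (star x * Θ x)) = 0 := by simp [hx]
      rw [hΘ, Finset.mul_sum, Finset.mul_sum, map_sum] at h2
      rw [← Complex.re_sum, ← Complex.zero_re, ← h2]
      refine congrArg _ (Finset.sum_congr rfl fun i _ => ?_)
      rw [← mul_assoc (star x), tr.map_mul_condExp_comm hE hinv, ← hE.idem (star (u i) * x),
        ← tr.map_mul_condExp_comm hE hinv]
      rw [hE.idem, ← hE.map_star, star_mul, star_star, ← tr.map_mul_condExp_comm hE hinv,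
        hE.idem]
    have h2 : ∀ i, E (star (u i) * x) = 0 := fun i => by
      by_contra hne
      have h3 := (Finset.sum_eq_zero_iff_of_nonneg fun i _ => hnn _).1 h1 i (Finset.mem_univ i)
      exact (tr.re_map_mul_star_mul_self_pos hσ hne).ne' h3
    -- Expanding the left factor `x` in the basis reduces this to the vanishing terms `E (star (u i)
    -- * x)`. Faithfulness and invariance of `σ` then force `x = 0`.
    have h3 : E (star x * x) = 0 := by
      conv_lhs => rw [← u.sum_repr x]
      rw [star_sum, Finset.sum_mul, map_sum]
      refine Finset.sum_eq_zero fun i _ => ?_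
      rw [star_smul, smul_mul_assoc, map_smul, u.sum_repr, h2, smul_zero]
    by_contra hne
    have h4 := tr.re_map_mul_star_mul_self_pos hσ hne
    rw [← tr.map_mul_of_predual_eq hinv, h3] at h4
    simp at h4
  let e := LinearEquiv.ofInjectiveEndo Θ hinj
  have he : ∀ x, Θ (e.symm x) = x := fun x => e.apply_symm_apply x
  let v := fun i => e.symm (u i)
  let α := ∑ i, (‖u i * star (u i)‖ + ‖star (v i) * v i‖)
  have hα : ∀ i, ‖u i * star (u i)‖ ≤ α ∧ ‖star (v i) * v i‖ ≤ α := fun i => by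
    have := Finset.single_le_sum (f := fun i => ‖u i * star (u i)‖ + ‖star (v i) * v i‖)
      (fun i _ => by positivity) (Finset.mem_univ i)
    constructor
    · linarith [norm_nonneg (star (v i) * v i)]
    · linarith [norm_nonneg (u i * star (u i))]
  have hbound : ∀ a : A, IsSelfAdjoint a → ‖a‖ ≤ α → a ≤ α • 1 := fun a ha h => by
    refine (IsSelfAdjoint.le_algebraMap_norm_self ha).trans ?_
    rw [Algebra.algebraMap_eq_smul_one]
    exact smul_le_smul_of_nonneg_right h zero_le_one
  refine ⟨_, u, v, α, ⟨Finset.sum_nonneg fun _ _ => by positivity, fun x => hinj ?_,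
    fun i => hbound _ (.mul_star_self _) (hα i).1, fun i => hbound _ (.star_mul_self _) (hα i).2⟩⟩
  rw [map_sum, hΘ x]
  refine Finset.sum_congr rfl fun i _ => ?_
  rw [hright, he]

theorem le_smul_predual (hE : IsCondExp E) {c : ℝ}
    (h : ∀ x, star x * x ≤ c • E (star x * x)) {ρ : A} (hρ : 0 ≤ ρ) :
    ρ ≤ c • tr.predual E ρ := by
  have hs := tr.isSelfAdjoint_predual hE hρ.isSelfAdjoint
  rw [← sub_nonneg]
  refine tr.nonneg_of_inner_nonneg ((IsSelfAdjoint.smul (IsSelfAdjoint.all c) hs).sub hρ.isSelfAdjoint)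
    fun b hb => ?_
  obtain ⟨y, rfl⟩ := CStarAlgebra.nonneg_iff_eq_star_mul_self.1 hb
  have h1 := tr.inner_nonneg hρ (sub_nonneg.2 (h y))
  rw [map_sub, map_smul, smul_eq_mul] at h1
  have h2 : tr.inner (tr.predual E ρ) (star y * y) = tr.inner ρ (E (star y * y)) := by
    rw [inner_apply, inner_apply, hs.star_eq, hρ.isSelfAdjoint.star_eq, tr.predual_spec]
  rw [map_sub, LinearMap.sub_apply, map_smul, LinearMap.smul_apply, smul_eq_mul, h2]
  exact h1

theorem index_le_ofReal (hE : IsCondExp E) {c : ℝ} (hc : 0 < c)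
    (h : ∀ x, star x * x ≤ c • E (star x * x)) : tr.index E ≤ ENNReal.ofReal c :=
  iInf₂_le c ⟨hc, fun _ hρ => tr.le_smul_predual hE h hρ.1⟩

end FaithfulTrace

/-! ### Matrix amplifications -/

section Base

variable {A : Type*} [CStarAlgebra A] [PartialOrder A] [StarOrderedRing A]

theorem exists_eq_star_mul_self_of_nonneg {a : A} (ha : 0 ≤ a) : ∃ s, a = star s * s :=
  CStarAlgebra.nonneg_iff_eq_star_mul_self.1 ha

/-- The embedding `a ↦ a ⊗ 1` of `A` into the matrices over `A`. -/
def CStarMatrix.diag (n : ℕ) (a : A) : CStarMatrix (Fin n) (Fin n) A :=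
  CStarMatrix.ofMatrix (Matrix.diagonal fun _ => a)

namespace CStarMatrix

variable {n : ℕ}

omit [PartialOrder A] [StarOrderedRing A] in
theorem diag_apply (a : A) (i j : Fin n) : diag n a i j = if i = j then a else 0 := rfl

omit [PartialOrder A] [StarOrderedRing A] in
theorem star_diag (a : A) : star (diag n a) = diag n (star a) := by
  ext i j
  rw [star_apply, diag_apply, diag_apply]
  by_cases h : i = j
  · simp [h]
  · simp [h, Ne.symm h]

omit [PartialOrder A] [StarOrderedRing A] in
theorem diag_mul_apply (a : A) (X : CStarMatrix (Fin n) (Fin n) A) (i j : Fin n) :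
    (diag n a * X) i j = a * X i j := by
  simp [mul_apply, diag_apply]

omit [PartialOrder A] [StarOrderedRing A] in
theorem diag_mul (a b : A) : diag n (a * b) = diag n a * diag n b := by
  ext i j
  rw [diag_mul_apply, diag_apply, diag_apply]
  split_ifs <;> simp

omit [PartialOrder A] [StarOrderedRing A] in
theorem diag_one : diag n (1 : A) = 1 := rfl

omit [PartialOrder A] [StarOrderedRing A] in
theorem diag_sub (a b : A) : diag n (a - b) = diag n a - diag n b := by
  ext i j
  rw [sub_apply, diag_apply, diag_apply, diag_apply]
  split_ifs <;> simp

omit [PartialOrder A] [StarOrderedRing A] in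
theorem diag_smul (r : ℂ) (a : A) : diag n (r • a) = r • diag n a := by
  ext i j
  rw [smul_apply, diag_apply, diag_apply]
  split_ifs <;> simp

theorem diag_nonneg {a : A} (ha : 0 ≤ a) : 0 ≤ diag n a := by
  obtain ⟨s, rfl⟩ := CStarAlgebra.nonneg_iff_eq_star_mul_self.1 ha
  rw [diag_mul, ← star_diag]
  exact star_mul_self_nonneg _

theorem diag_mono {a b : A} (h : a ≤ b) : diag n a ≤ diag n b := by
  have := diag_nonneg (n := n) (sub_nonneg.2 h)
  rwa [diag_sub, sub_nonneg] at this

theorem diag_le_smul_one {a : A} {r : ℝ} (h : a ≤ r • 1) : diag n a ≤ (r : ℂ) • 1 := by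
  rw [← diag_one, ← diag_smul, Complex.coe_smul]
  exact diag_mono h

omit [PartialOrder A] [StarOrderedRing A] in
theorem sum_apply' {ι : Type*} (s : Finset ι) (f : ι → CStarMatrix (Fin n) (Fin n) A)
    (i j : Fin n) : (∑ k ∈ s, f k) i j = ∑ k ∈ s, f k i j := by
  classical
  induction s using Finset.induction_on with
  | empty => rfl
  | insert a s ha ih => rw [Finset.sum_insert ha, Finset.sum_insert ha, add_apply, ih]

end CStarMatrix

omit [PartialOrder A] [StarOrderedRing A] in
theorem ampl_apply (n : ℕ) (Φ : A →ₗ[ℂ] A) (X : CStarMatrix (Fin n) (Fin n) A) (i j : Fin n) :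
    ampl n Φ X i j = Φ (X i j) := rfl

theorem IsConditionalExpectation.isCondExp {N : StarSubalgebra ℂ A} {E : A →ₗ[ℂ] A}
    (hE : IsConditionalExpectation N E) : IsCondExp E := by
  have hnn : ∀ X, 0 ≤ X → 0 ≤ E X := fun X hX => by
    -- Positivity is complete positivity at `n = 1`, read off from the single matrix entry of `star
    -- s * s`.
    have h1 := hE.completelyPositive 1 _ (CStarMatrix.diag_nonneg (n := 1) hX)
    obtain ⟨s, hs⟩ := exists_eq_star_mul_self_of_nonneg h1
    have h2 := congrFun (congrFun hs 0) 0
    rw [ampl_apply, CStarMatrix.diag_apply, if_pos rfl, CStarMatrix.mul_apply] at h2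
    rw [h2]
    exact Finset.sum_nonneg fun i _ => by
      rw [CStarMatrix.star_apply]; exact star_mul_self_nonneg _
  have hsa : ∀ X, IsSelfAdjoint X → IsSelfAdjoint (E X) := fun X hX => by
    rw [← CFC.posPart_sub_negPart X hX, map_sub]
    exact (hnn _ (CFC.posPart_nonneg X)).isSelfAdjoint.sub
      (hnn _ (CFC.negPart_nonneg X)).isSelfAdjoint
  refine ⟨hnn, hE.unital, fun X => hE.fixes _ (hE.mem X), fun X => ?_, fun X Y => ?_,
    fun X Y => ?_⟩
  · have h1 := hsa _ (realPart X).2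
    have h2 := hsa _ (imaginaryPart X).2
    conv_lhs => rw [← realPart_add_I_smul_imaginaryPart X]
    conv_rhs => rw [← realPart_add_I_smul_imaginaryPart X]
    simp only [map_add, star_add, star_smul, map_smul, h1.star_eq, h2.star_eq,
      (realPart X).2.star_eq, (imaginaryPart X).2.star_eq]
  · have := hE.bimodule (E X) (hE.mem X) 1 N.one_mem Y
    simpa using this
  · have := hE.bimodule 1 N.one_mem (E X) (hE.mem X) Y
    simpa using this

theorem IsConditionalExpectation.isCondExpPair {N N₁ N₂ : StarSubalgebra ℂ A} (hN : N = N₁ ⊓ N₂)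
    {E E₁ E₂ : A →ₗ[ℂ] A} (hE : IsConditionalExpectation N E)
    (hE₁ : IsConditionalExpectation N₁ E₁) (hE₂ : IsConditionalExpectation N₂ E₂)
    (h₁ : E ∘ₗ E₁ = E) (h₂ : E ∘ₗ E₂ = E) : IsCondExpPair E E₁ E₂ where
  condExp := hE.isCondExp
  left := hE₁.isCondExp
  right := hE₂.isCondExp
  map_left := LinearMap.congr_fun h₁
  map_right := LinearMap.congr_fun h₂
  left_map X := hE₁.fixes _ (by have := hE.mem X; rw [hN] at this; exact this.1)
  right_map X := hE₂.fixes _ (by have := hE.mem X; rw [hN] at this; exact this.2)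
  inter X hX₁ hX₂ := hE.fixes _ (by
    rw [hN]; exact ⟨hX₁ ▸ hE₁.mem X, hX₂ ▸ hE₂.mem X⟩)

theorem IsCondExp.ampl {E : A →ₗ[ℂ] A} (hE : IsCondExp E) (n : ℕ)
    (hnn : ∀ X : CStarMatrix (Fin n) (Fin n) A, 0 ≤ X → 0 ≤ ampl n E X) :
    IsCondExp (ampl n E) where
  nonneg := hnn
  unital := by
    ext i j
    rw [ampl_apply, CStarMatrix.one_apply]
    split_ifs
    · exact hE.unital
    · exact map_zero E
  idem X := by ext i j; simp only [ampl_apply, hE.idem]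
  map_star X := by ext i j; simp only [ampl_apply, CStarMatrix.star_apply, hE.map_star]
  map_mul_left X Y := by
    ext i j; simp only [ampl_apply, CStarMatrix.mul_apply, map_sum, hE.map_mul_left]
  map_mul_right X Y := by
    ext i j; simp only [ampl_apply, CStarMatrix.mul_apply, map_sum, hE.map_mul_right]

theorem IsCondExpPair.ampl {E E₁ E₂ : A →ₗ[ℂ] A} (h : IsCondExpPair E E₁ E₂) {n : ℕ}
    (hE : IsCondExp (ampl n E)) (hE₁ : IsCondExp (ampl n E₁)) (hE₂ : IsCondExp (ampl n E₂)) :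
    IsCondExpPair (ampl n E) (ampl n E₁) (ampl n E₂) where
  condExp := hE
  left := hE₁
  right := hE₂
  map_left X := by ext i j; simp only [ampl_apply, h.map_left]
  left_map X := by ext i j; simp only [ampl_apply, h.left_map]
  map_right X := by ext i j; simp only [ampl_apply, h.map_right]
  right_map X := by ext i j; simp only [ampl_apply, h.right_map]
  inter X h₁ h₂ := by
    ext i j
    exact h.inter _ (congrFun (congrFun h₁ i) j) (congrFun (congrFun h₂ i) j)

/-- Multiplication by `u i ⊗ 1` and `v i ⊗ 1` acts entrywise. The number of elements and the bound
`α` are independent of `n`, which makes the completely bounded index finite. -/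
theorem IsFrame.ampl {ι : Type*} [Fintype ι] {E : A →ₗ[ℂ] A} {u v : ι → A} {α : ℝ}
    (hf : IsFrame E u v α) (n : ℕ) :
    IsFrame (ampl n E) (fun i => CStarMatrix.diag n (u i)) (fun i => CStarMatrix.diag n (v i))
      α where
  nonneg := hf.nonneg
  expand X := by
    ext i j
    rw [CStarMatrix.sum_apply']
    simp only [CStarMatrix.star_diag, CStarMatrix.diag_mul_apply, ampl_apply]
    exact hf.expand _
  left_le i := by
    rw [CStarMatrix.star_diag, ← CStarMatrix.diag_mul]
    exact CStarMatrix.diag_le_smul_one (hf.left_le i)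
  right_le i := by
    rw [CStarMatrix.star_diag, ← CStarMatrix.diag_mul]
    exact CStarMatrix.diag_le_smul_one (hf.right_le i)

end Base

namespace FaithfulTrace

variable {A : Type*} [CStarAlgebra A] [PartialOrder A] [StarOrderedRing A]
  [FiniteDimensional ℂ A] (tr : FaithfulTrace A)

omit [FiniteDimensional ℂ A] in
theorem amplify_apply (n : ℕ) (X : CStarMatrix (Fin n) (Fin n) A) :
    tr.amplify n X = ∑ i, tr (X i i) := rfl

omit [FiniteDimensional ℂ A] in
theorem inner_amplify (n : ℕ) (X Y : CStarMatrix (Fin n) (Fin n) A) :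
    (tr.amplify n).inner X Y = ∑ i, ∑ j, tr.inner (X j i) (Y j i) := by
  rw [inner_apply, amplify_apply, Complex.re_sum]
  refine Finset.sum_congr rfl fun i _ => ?_
  rw [CStarMatrix.mul_apply, map_sum, Complex.re_sum]
  exact Finset.sum_congr rfl fun j _ => by rw [CStarMatrix.star_apply, inner_apply]

omit [FiniteDimensional ℂ A] in
-- The amplified operator acts entrywise, so its matrix coefficients are finite sums of the original
-- ones: only `K` changes with `n`, not the rate.
theorem growth_ampl {E E₁ E₂ : A →ₗ[ℂ] A} {L : ℝ}
    (hgrowth : ∀ W V, ∃ K : ℝ, ∀ m : ℕ,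
      |tr.inner W (((E₂ ∘ₗ E₁ ∘ₗ E₂ - E) ^ m) V)| ≤ K * L ^ m) (n : ℕ)
    (W V : CStarMatrix (Fin n) (Fin n) A) : ∃ K : ℝ, ∀ m : ℕ,
      |(tr.amplify n).inner W (((ampl n E₂ ∘ₗ ampl n E₁ ∘ₗ ampl n E₂ - ampl n E) ^ m) V)|
        ≤ K * L ^ m := by
  have hpow : ∀ (m : ℕ) i j, ((ampl n E₂ ∘ₗ ampl n E₁ ∘ₗ ampl n E₂ - ampl n E) ^ m) V i j
      = ((E₂ ∘ₗ E₁ ∘ₗ E₂ - E) ^ m) (V i j) := by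
    intro m
    induction m with
    | zero => intro i j; rfl
    | succ m ih =>
      intro i j
      rw [pow_succ', pow_succ', Module.End.mul_apply, Module.End.mul_apply, ← ih]
      rfl
  choose K hK using fun i j => hgrowth (W j i) (V j i)
  refine ⟨∑ i, ∑ j, K i j, fun m => ?_⟩
  rw [inner_amplify, Finset.sum_mul]
  refine (Finset.abs_sum_le_sum_abs _ _).trans (Finset.sum_le_sum fun i _ => ?_)
  rw [Finset.sum_mul]
  refine (Finset.abs_sum_le_sum_abs _ _).trans (Finset.sum_le_sum fun j _ => ?_)
  rw [hpow]
  exact hK i j m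

end FaithfulTrace

/-! ### Supports and the passage to arbitrary states -/

section Support

variable {A : Type*} [CStarAlgebra A] [PartialOrder A] [StarOrderedRing A] [FiniteDimensional ℂ A]

/-- For the kernel projection `p` of `ω`, compression gives `p ρ p ≤ k p ω p = 0`; with `ρ = star s
* s` this says `s p = 0`. -/
theorem mul_specProj_zero_eq_zero {ρ ω : A} {k : ℝ} (hρ : 0 ≤ ρ) (hω : 0 ≤ ω) (h : ρ ≤ k • ω) :
    ρ * specProj ω 0 = 0 := by
  have hsω : IsSelfAdjoint ω := hω.isSelfAdjoint
  have h1 : ω * specProj ω 0 = 0 := by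
    conv_lhs => rw [← cfc_id' ℝ ω]
    rw [cfc_id' ℝ ω]
    have := (cfc_mul (fun x : ℝ => x) (fun y : ℝ => if y = 0 then 1 else 0) ω
      (continuousOn_real_spectrum _ _) (continuousOn_real_spectrum _ _)).symm
    rw [cfc_id' ℝ ω] at this
    rw [specProj, this, ← cfc_zero ℝ ω]
    exact cfc_congr fun x _ => by simp
  have h2 := star_left_conjugate_le_conjugate h (specProj ω 0)
  rw [star_specProj, mul_smul_comm, smul_mul_assoc, mul_assoc _ ω, h1, mul_zero, smul_zero] at h2
  obtain ⟨s, rfl⟩ := CStarAlgebra.nonneg_iff_eq_star_mul_self.1 hρ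
  have h3 : star (s * specProj ω 0) * (s * specProj ω 0) = 0 := by
    refine le_antisymm ?_ (star_mul_self_nonneg _)
    simpa [mul_assoc] using h2
  rw [CStarRing.star_mul_self_eq_zero_iff] at h3
  rw [mul_assoc, h3, mul_zero]

/-- The support of `ρ` kills the kernel of `ω`, so the difference of the two projections is itself a
projection. This excludes the value `+∞` of the relative entropy whenever `ρ` is dominated by a
multiple of `ω`. -/
theorem supportProj_le_supportProj {ρ ω : A} {k : ℝ} (hρ : 0 ≤ ρ) (hω : 0 ≤ ω) (h : ρ ≤ k • ω) :
    supportProj ρ ≤ supportProj ω := by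
  have hsω : IsSelfAdjoint ω := hω.isSelfAdjoint
  have hsρ : IsSelfAdjoint ρ := hρ.isSelfAdjoint
  have hidem : ∀ a : A, supportProj a * supportProj a = supportProj a := fun a => by
    rw [supportProj, ← cfc_mul _ _ _ (continuousOn_real_spectrum _ _)
      (continuousOn_real_spectrum _ _)]
    exact cfc_congr fun x _ => by simp
  have hstar : ∀ a : A, star (supportProj a) = supportProj a := fun a =>
    (cfc_predicate (p := IsSelfAdjoint) _ a : IsSelfAdjoint (supportProj a))
  have h1 : supportProj ω = 1 - specProj ω 0 := by
    rw [supportProj, specProj, ← cfc_const_one ℝ ω, ← cfc_sub _ _ _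
      (continuousOn_real_spectrum _ _) (continuousOn_real_spectrum _ _)]
    exact cfc_congr fun x _ => by by_cases hx : x = 0 <;> simp [hx]
  have h2 : supportProj ρ = cfc (fun x : ℝ => x⁻¹) ρ * ρ := by
    have := cfc_mul (fun x : ℝ => x⁻¹) (fun x : ℝ => x) ρ
      (continuousOn_real_spectrum _ _) (continuousOn_real_spectrum _ _)
    rw [cfc_id' ℝ ρ] at this
    rw [← this, supportProj]
    exact cfc_congr fun x _ => by by_cases hx : x = 0 <;> simp [hx]
  have h3 : supportProj ρ * supportProj ω = supportProj ρ := by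
    rw [h1, mul_sub, mul_one, h2, mul_assoc, mul_specProj_zero_eq_zero hρ hω h, mul_zero, sub_zero]
  have h4 : supportProj ω * supportProj ρ = supportProj ρ := by
    have := congrArg star h3
    rwa [star_mul, hstar, hstar] at this
  have h5 : supportProj ω - supportProj ρ
      = star (supportProj ω - supportProj ρ) * (supportProj ω - supportProj ρ) := by
    rw [star_sub, hstar, hstar, sub_mul, mul_sub, mul_sub, hidem, hidem, h3, h4]
    abel
  rw [← sub_nonneg, h5]
  exact star_mul_self_nonneg _

end Support

namespace FaithfulTrace

open Filter Topology

variable {A : Type*} [CStarAlgebra A] [PartialOrder A] [StarOrderedRing A]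
  [FiniteDimensional ℂ A] (tr : FaithfulTrace A) {E E₁ E₂ : A →ₗ[ℂ] A}

theorem relEntropy_eq_coe {ρ ω : A} {k : ℝ} (hρ : 0 ≤ ρ) (hω : 0 ≤ ω) (h : ρ ≤ k • ω) :
    tr.relEntropy ρ ω = (tr.relEnt ρ ω : EReal) := by
  rw [relEntropy, if_pos (supportProj_le_supportProj hρ hω h), relEnt, inner_apply, inner_apply,
    hρ.isSelfAdjoint.star_eq, map_sub, Complex.sub_re]

omit [PartialOrder A] [StarOrderedRing A] in
-- Convergence is required only after multiplication by the spectral weight, so `g` may diverge at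
-- an eigenvalue of weight zero.
theorem tendsto_inner_cfc {ι : Type*} {l : Filter ι} {g : ι → ℝ → ℝ} {G : ℝ → ℝ} {Z ω : A}
    (hω : IsSelfAdjoint ω) (h : ∀ x ∈ spectrum ℝ ω,
      Tendsto (fun i => g i x * tr.inner Z (specProj ω x)) l
        (𝓝 (G x * tr.inner Z (specProj ω x)))) :
    Tendsto (fun i => tr.inner Z (cfc (g i) ω)) l (𝓝 (tr.inner Z (cfc G ω))) := by
  simp_rw [cfc_eq_sum_specProj _ hω, map_sum, map_smul, smul_eq_mul]
  exact tendsto_finsetSum _ fun x hx => h x (mem_realSpec.1 hx)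

omit [FiniteDimensional ℂ A] in
theorem inner_mono_right {a b c : A} (ha : 0 ≤ a) (h : b ≤ c) : tr.inner a b ≤ tr.inner a c := by
  have := tr.inner_nonneg ha (sub_nonneg.2 h)
  rwa [map_sub, sub_nonneg] at this

theorem log_add_smul_one {ω : A} (hω : 0 ≤ ω) {a t : ℝ} :
    CFC.log (a • ω + t • (1 : A)) = cfc (fun x : ℝ => Real.log (a * x + t)) ω := by
  have hsω : IsSelfAdjoint ω := hω.isSelfAdjoint
  have h1 : a • ω + t • (1 : A) = cfc (fun x : ℝ => a * x + t) ω := by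
    rw [cfc_add_const t (fun x => a * x) ω (continuousOn_real_spectrum _ _),
      cfc_const_mul_id a ω, Algebra.algebraMap_eq_smul_one]
  rw [h1, CFC.log, ← cfc_comp' Real.log (fun x => a * x + t) ω
    (((finite_real_spectrum ω).image _).continuousOn _) (continuousOn_real_spectrum _ _)]

theorem tendsto_log_segment {x t : ℝ} (hx : 0 < x) :
    Tendsto (fun ε : ℝ => Real.log ((1 - ε) * x + ε * t)) (𝓝[>] 0) (𝓝 (Real.log x)) := by
  have h1 : Tendsto (fun ε : ℝ => (1 - ε) * x + ε * t) (𝓝 0) (𝓝 ((1 - 0) * x + 0 * t)) :=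
    (by fun_prop : Continuous fun ε : ℝ => (1 - ε) * x + ε * t).tendsto 0
  simp only [sub_zero, one_mul, zero_mul, add_zero] at h1
  exact ((Real.continuousAt_log hx.ne').tendsto.comp h1).mono_left nhdsWithin_le_nhds

theorem tendsto_mul_log_segment {x t : ℝ} (hx : 0 ≤ x) (ht : 0 < t) :
    Tendsto (fun ε : ℝ => ε * Real.log ((1 - ε) * x + ε * t)) (𝓝[>] 0) (𝓝 0) := by
  have h0 : Tendsto (fun ε : ℝ => ε) (𝓝[>] 0) (𝓝 0) := tendsto_id.mono_left nhdsWithin_le_nhds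
  rcases hx.eq_or_lt with rfl | hx
  · have h1 : Tendsto (fun ε : ℝ => t⁻¹ * ((ε * t) * Real.log (ε * t))) (𝓝 0)
        (𝓝 (t⁻¹ * ((0 * t) * Real.log (0 * t)))) :=
      ((Real.continuous_mul_log.comp (continuous_mul_const t)).const_mul t⁻¹).tendsto 0
    simp only [zero_mul, mul_zero] at h1
    refine (h1.mono_left nhdsWithin_le_nhds).congr fun ε => ?_
    field_simp
    simp
  · simpa using h0.mul (tendsto_log_segment (t := t) hx)

/-- Continuity of `tr (ρ log ω)` along the segments towards a faithful state. -/
theorem tendsto_inner_log {ρ ω σ : A} {k : ℝ} (hρ : 0 ≤ ρ) (hω : 0 ≤ ω) (h : ρ ≤ k • ω)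
    (hσ : IsStrictlyPositive σ) :
    Tendsto (fun ε : ℝ => tr.inner ((1 - ε) • ρ + ε • σ) (CFC.log ((1 - ε) • ω + ε • σ)))
      (𝓝[>] 0) (𝓝 (tr.inner ρ (CFC.log ω))) := by
  have hsω : IsSelfAdjoint ω := hω.isSelfAdjoint
  obtain ⟨d, hd, hdσ⟩ := hσ.exists_smul_one_le
  obtain ⟨s, hs, hσs⟩ : ∃ s : ℝ, 0 < s ∧ σ ≤ s • 1 := by
    refine ⟨‖σ‖ + 1, by positivity, ?_⟩
    have h1 := IsSelfAdjoint.le_algebraMap_norm_self hσ.isSelfAdjoint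
    rw [Algebra.algebraMap_eq_smul_one] at h1
    exact h1.trans (smul_le_smul_of_nonneg_right (by linarith) zero_le_one)
  have hev : ∀ᶠ ε : ℝ in 𝓝[>] 0, 0 < ε ∧ ε < 1 := by
    filter_upwards [Ioo_mem_nhdsGT (zero_lt_one (α := ℝ))] with ε hε using hε
  -- In general `σ` and `ω` do not commute. Bounding `σ` by scalars and using operator monotonicity
  -- of the logarithm leaves functions of `ω` alone.
  have hbounds : ∀ᶠ ε : ℝ in 𝓝[>] 0,
      cfc (fun x : ℝ => Real.log ((1 - ε) * x + ε * d)) ω ≤ CFC.log ((1 - ε) • ω + ε • σ) ∧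
      CFC.log ((1 - ε) • ω + ε • σ) ≤ cfc (fun x : ℝ => Real.log ((1 - ε) * x + ε * s)) ω := by
    filter_upwards [hev] with ε ⟨h0, h1⟩
    have hω' : 0 ≤ (1 - ε) • ω := smul_nonneg (by linarith) hω
    rw [← log_add_smul_one hω, ← log_add_smul_one hω]
    have hp : ∀ a : A, IsStrictlyPositive a → IsStrictlyPositive (ε • a) := fun a ha =>
      ha.smul h0
    constructor
    · refine CFC.log_le_log ?_ ?_
      · rw [mul_smul]
        exact add_le_add_right (smul_le_smul_of_nonneg_left hdσ h0.le) _
      · rw [mul_smul]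
        exact (hp _ (isStrictlyPositive_one.smul hd)).nonneg_add hω'
    · refine CFC.log_le_log ?_ ((hp _ hσ).nonneg_add hω')
      rw [mul_smul]
      exact add_le_add_right (smul_le_smul_of_nonneg_left hσs h0.le) _
  have hspec : ∀ x ∈ spectrum ℝ ω, 0 ≤ x := fun x hx => spectrum_nonneg_of_nonneg hω hx
  have h1 : Tendsto (fun ε : ℝ => tr.inner ρ (CFC.log ((1 - ε) • ω + ε • σ)))
      (𝓝[>] 0) (𝓝 (tr.inner ρ (CFC.log ω))) := by
    have hlim : ∀ t : ℝ, Tendsto (fun ε : ℝ => tr.inner ρ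
        (cfc (fun x : ℝ => Real.log ((1 - ε) * x + ε * t)) ω)) (𝓝[>] 0)
        (𝓝 (tr.inner ρ (CFC.log ω))) := fun t => by
      refine tr.tendsto_inner_cfc hsω fun x hx => ?_
      rcases (hspec x hx).eq_or_lt with rfl | hx0
      -- At eigenvalue zero the logarithm diverges, but `ρ ≤ k ω` makes its weight vanish.
      · have : tr.inner ρ (specProj ω 0) = 0 := by
          rw [inner_apply, hρ.isSelfAdjoint.star_eq, mul_specProj_zero_eq_zero hρ hω h, map_zero,
            Complex.zero_re]
        simp [this]
      · exact (tendsto_log_segment hx0).mul_const _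
    refine tendsto_of_tendsto_of_tendsto_of_le_of_le' (hlim d) (hlim s) ?_ ?_
    · filter_upwards [hbounds] with ε hε using tr.inner_mono_right hρ hε.1
    · filter_upwards [hbounds] with ε hε using tr.inner_mono_right hρ hε.2
  -- The admixture of `σ` has weight on the kernel of `ω` too; there `ε log ε → 0` decides.
  have h2 : Tendsto (fun ε : ℝ => ε * tr.inner σ (CFC.log ((1 - ε) • ω + ε • σ)))
      (𝓝[>] 0) (𝓝 0) := by
    have hlim : ∀ t : ℝ, 0 < t → Tendsto (fun ε : ℝ => ε * tr.inner σ
        (cfc (fun x : ℝ => Real.log ((1 - ε) * x + ε * t)) ω)) (𝓝[>] 0) (𝓝 0) := fun t ht => by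
      have h3 : Tendsto (fun ε : ℝ => tr.inner σ
          (cfc (fun x : ℝ => ε * Real.log ((1 - ε) * x + ε * t)) ω)) (𝓝[>] 0)
          (𝓝 (tr.inner σ (cfc (fun _ : ℝ => (0 : ℝ)) ω))) :=
        tr.tendsto_inner_cfc hsω fun x hx =>
          (tendsto_mul_log_segment (hspec x hx) ht).mul_const _
      rw [cfc_const_zero ℝ ω, map_zero] at h3
      refine h3.congr fun ε => ?_
      rw [cfc_const_mul _ _ _ (continuousOn_real_spectrum _ _), map_smul, smul_eq_mul]
    refine tendsto_of_tendsto_of_tendsto_of_le_of_le' (hlim d hd) (hlim s hs) ?_ ?_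
    · filter_upwards [hbounds, hev] with ε hε h0 using
        mul_le_mul_of_nonneg_left (tr.inner_mono_right hσ.nonneg hε.1) h0.1.le
    · filter_upwards [hbounds, hev] with ε hε h0 using
        mul_le_mul_of_nonneg_left (tr.inner_mono_right hσ.nonneg hε.2) h0.1.le
  have h3 : Tendsto (fun ε : ℝ => 1 - ε) (𝓝[>] 0) (𝓝 1) := by
    have : Tendsto (fun ε : ℝ => 1 - ε) (𝓝 0) (𝓝 (1 - 0)) :=
      (by fun_prop : Continuous fun ε : ℝ => 1 - ε).tendsto 0
    rw [sub_zero] at this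
    exact this.mono_left nhdsWithin_le_nhds
  have h4 := (h3.mul h1).add h2
  rw [one_mul, add_zero] at h4
  refine h4.congr fun ε => ?_
  simp

theorem tendsto_relEnt {ρ ω σ : A} {k : ℝ} (hρ : 0 ≤ ρ) (hω : 0 ≤ ω) (h : ρ ≤ k • ω)
    (hσ : IsStrictlyPositive σ) :
    Tendsto (fun ε : ℝ => tr.relEnt ((1 - ε) • ρ + ε • σ) ((1 - ε) • ω + ε • σ))
      (𝓝[>] 0) (𝓝 (tr.relEnt ρ ω)) :=
  (tr.tendsto_inner_log hρ hρ (k := 1) (by simp) hσ).sub (tr.tendsto_inner_log hρ hω h hσ)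

theorem exists_forall_le_smul_predual (hE : IsCondExp E) {σ : A} (hσ : IsStrictlyPositive σ)
    (hinv : tr.predual E σ = σ) : ∃ c : ℝ, ∀ ρ, 0 ≤ ρ → ρ ≤ c • tr.predual E ρ := by
  obtain ⟨m, u, v, α, hf⟩ := tr.exists_isFrame hE hσ hinv
  exact ⟨_, fun ρ hρ => tr.le_smul_predual hE (hf.star_mul_self_le hE) hρ⟩

/-- Mixing with `σ` makes all densities faithful and commutes with the predual maps, so the faithful
case passes to the limit. The state `σ` serves only this regularization; the gap enters through the
growth rate. -/
theorem approxTensorization_of_growth (h : IsCondExpPair E E₁ E₂) {σ : A}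
    (hσ : IsStrictlyPositive σ) (hσ1 : tr σ = 1) (hinv : tr.predual E σ = σ)
    {lam : ℝ} (hlam : 0 ≤ lam)
    (hlam1 : lam < 1) (hgrowth : ∀ W V, ∃ K : ℝ, ∀ m : ℕ,
      |tr.inner W (((E₂ ∘ₗ E₁ ∘ₗ E₂ - E) ^ m) V)| ≤ K * (lam ^ 2) ^ m)
    {C : ℝ} (hindex : tr.index E ≤ ENNReal.ofReal C) (hC : 0 ≤ C) :
    tr.ApproxTensorization (tr.predual E) (tr.predual E₁) (tr.predual E₂)
      (2 * C / (1 - lam) ^ 2) := by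
  intro ρ hρ
  have hinv₁ := tr.predual_eq_of_comp h.map_left hinv
  have hinv₂ := tr.predual_eq_of_comp h.map_right hinv
  obtain ⟨k, hk⟩ := tr.exists_forall_le_smul_predual h.condExp hσ hinv
  obtain ⟨k₁, hk₁⟩ := tr.exists_forall_le_smul_predual h.left hσ hinv₁
  obtain ⟨k₂, hk₂⟩ := tr.exists_forall_le_smul_predual h.right hσ hinv₂
  have hρE := tr.predual_nonneg h.condExp hρ.1
  have hρE₁ := tr.predual_nonneg h.left hρ.1
  have hρE₂ := tr.predual_nonneg h.right hρ.1
  rw [tr.relEntropy_eq_coe hρ.1 hρE (hk ρ hρ.1), tr.relEntropy_eq_coe hρ.1 hρE₁ (hk₁ ρ hρ.1),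
    tr.relEntropy_eq_coe hρ.1 hρE₂ (hk₂ ρ hρ.1), ← EReal.coe_add, ← EReal.coe_mul,
    EReal.coe_le_coe_iff]
  have hev : ∀ᶠ ε : ℝ in 𝓝[>] 0, 0 < ε ∧ ε < 1 := by
    filter_upwards [Ioo_mem_nhdsGT (zero_lt_one (α := ℝ))] with ε hε using hε
  have hpos : ∀ ε : ℝ, 0 < ε ∧ ε < 1 → ∀ a : A, 0 ≤ a →
      IsStrictlyPositive ((1 - ε) • a + ε • σ) := fun ε hε a ha =>
    (hσ.smul hε.1).nonneg_add (smul_nonneg (by linarith [hε.2]) ha)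
  have hpre : ∀ F : A →ₗ[ℂ] A, tr.predual F σ = σ → ∀ ε : ℝ,
      tr.predual F ((1 - ε) • ρ + ε • σ) = (1 - ε) • tr.predual F ρ + ε • σ := fun F hF ε => by
    rw [map_add, LinearMap.map_smul_of_tower, LinearMap.map_smul_of_tower, hF]
  have hstate : ∀ ε : ℝ, 0 < ε ∧ ε < 1 → tr.IsState ((1 - ε) • ρ + ε • σ) := fun ε hε =>
    ⟨(hpos ε hε ρ hρ.1).nonneg, by
      rw [map_add, map_real_smul, map_real_smul, hρ.2, hσ1]; push_cast; ring⟩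
  -- Nonnegativity of the entropies on the right is what permits enlarging the constant below.
  have hnn : ∀ F : A →ₗ[ℂ] A, IsCondExp F → tr.predual F σ = σ → 0 ≤ tr.predual F ρ →
      ∀ k : ℝ, ρ ≤ k • tr.predual F ρ → 0 ≤ tr.relEnt ρ (tr.predual F ρ) :=
    fun F hF hFσ hFρ k hk => by
      refine ge_of_tendsto (tr.tendsto_relEnt hρ.1 hFρ hk hσ) ?_
      filter_upwards [hev] with ε hε
      refine tr.relEnt_nonneg_of_pos (hpos ε hε ρ hρ.1) (hpos ε hε _ hFρ) ?_
      rw [← hpre F hFσ]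
      exact tr.inner_one_sub_predual hF _
  -- The hypothesis only bounds an infimum by `C`, so an admissible constant is taken below each `c'
  -- > C` and `c'` is lowered to `C` afterwards.
  have hmain : ∀ c : ℝ, C < c → tr.relEnt ρ (tr.predual E ρ)
      ≤ 2 * c / (1 - lam) * (tr.relEnt ρ (tr.predual E₁ ρ) + tr.relEnt ρ (tr.predual E₂ ρ)) := by
    intro c' hc'
    have hc'0 : 0 < c' := hC.trans_lt hc'
    have h1 : tr.index E < ENNReal.ofReal c' :=
      hindex.trans_lt ((ENNReal.ofReal_lt_ofReal_iff hc'0).2 hc')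
    rw [index, iInf_lt_iff] at h1
    obtain ⟨c, h1⟩ := h1
    rw [iInf_lt_iff] at h1
    obtain ⟨⟨hc, hadm⟩, h1⟩ := h1
    rw [ENNReal.ofReal_lt_ofReal_iff hc'0] at h1
    have hD : tr.relEnt ρ (tr.predual E ρ)
      ≤ 2 * c / (1 - lam) * (tr.relEnt ρ (tr.predual E₁ ρ) + tr.relEnt ρ (tr.predual E₂ ρ)) := by
      refine le_of_tendsto_of_tendsto (tr.tendsto_relEnt hρ.1 hρE (hk ρ hρ.1) hσ)
        (((tr.tendsto_relEnt hρ.1 hρE₁ (hk₁ ρ hρ.1) hσ).add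
          (tr.tendsto_relEnt hρ.1 hρE₂ (hk₂ ρ hρ.1) hσ)).const_mul _) ?_
      filter_upwards [hev] with ε hε
      rw [← hpre E hinv, ← hpre E₁ hinv₁, ← hpre E₂ hinv₂]
      refine tr.relEnt_le_of_growth h hlam hlam1 hgrowth hc (hadm _ (hstate ε hε))
        (hpos ε hε ρ hρ.1) ?_ ?_ ?_
      · rw [hpre E hinv]; exact hpos ε hε _ hρE
      · rw [hpre E₁ hinv₁]; exact hpos ε hε _ hρE₁
      · rw [hpre E₂ hinv₂]; exact hpos ε hε _ hρE₂
    refine hD.trans (mul_le_mul_of_nonneg_right ?_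
      (add_nonneg (hnn E₁ h.left hinv₁ hρE₁ k₁ (hk₁ ρ hρ.1))
        (hnn E₂ h.right hinv₂ hρE₂ k₂ (hk₂ ρ hρ.1))))
    exact div_le_div_of_nonneg_right (by linarith) (sub_pos.2 hlam1).le
  have hlim : tr.relEnt ρ (tr.predual E ρ)
      ≤ 2 * C / (1 - lam) * (tr.relEnt ρ (tr.predual E₁ ρ) + tr.relEnt ρ (tr.predual E₂ ρ)) := by
    have hcont : Tendsto (fun c : ℝ => 2 * c / (1 - lam) *
        (tr.relEnt ρ (tr.predual E₁ ρ) + tr.relEnt ρ (tr.predual E₂ ρ))) (𝓝[>] C)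
        (𝓝 (2 * C / (1 - lam) *
        (tr.relEnt ρ (tr.predual E₁ ρ) + tr.relEnt ρ (tr.predual E₂ ρ)))) :=
      ((by fun_prop : Continuous fun c : ℝ => 2 * c / (1 - lam) *
        (tr.relEnt ρ (tr.predual E₁ ρ) + tr.relEnt ρ (tr.predual E₂ ρ))).tendsto C).mono_left
        nhdsWithin_le_nhds
    refine ge_of_tendsto hcont ?_
    filter_upwards [self_mem_nhdsWithin] with c hc using hmain c hc
  -- The argument yields `2C / (1 - lam)`; the stated square is weaker because `0 < 1 - lam ≤ 1`.
  refine hlim.trans (mul_le_mul_of_nonneg_right ?_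
      (add_nonneg (hnn E₁ h.left hinv₁ hρE₁ k₁ (hk₁ ρ hρ.1))
        (hnn E₂ h.right hinv₂ hρE₂ k₂ (hk₂ ρ hρ.1))))
  have h1 : 0 < 1 - lam := sub_pos.2 hlam1
  refine div_le_div_of_nonneg_left (by positivity) (by positivity) ?_
  nlinarith

end FaithfulTrace

/-! ### The lower bound -/

namespace FaithfulTrace

open Filter Topology

section LowerBound

variable {A : Type*} [CStarAlgebra A] [PartialOrder A] [StarOrderedRing A]
  [FiniteDimensional ℂ A] (tr : FaithfulTrace A) {E E₁ E₂ : A →ₗ[ℂ] A}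

/-- The reverse comparison: here `ω` is dominated by multiples of `ρ` and `ω₁`. With constants
tending to 1 near `σ`, the two comparisons together identify the second-order term of the entropy.
-/
theorem relEnt_le_l2Form {ρ ω₁ ω : A} (hρ : IsStrictlyPositive ρ) (hω₁ : IsStrictlyPositive ω₁)
    (hω : IsStrictlyPositive ω) {c : ℝ} (hc : 0 < c) (h : ω ≤ c • ρ) (h₁ : ω ≤ c • ω₁)
    (htr : tr.inner 1 (ρ - ω₁) = 0) :
    2 * tr.relEnt ρ ω₁ ≤
      c * tr.l2Form ω (doubleOp invLogMean ω ω (ρ - ω₁)) (doubleOp invLogMean ω ω (ρ - ω₁)) := by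
  have hs : IsSelfAdjoint (ρ - ω₁) := hρ.isSelfAdjoint.sub hω₁.isSelfAdjoint
  have h1 := tr.inner_doubleOp_halfLogMean_le hω hω hρ hω₁ hc h h₁ (ρ - ω₁)
  rw [← tr.inner_doubleOp_invLogMean_eq hω, ← tr.inner_doubleOp_halfLogMean_self hω hs,
    tr.relEnt_eq hρ hω₁, htr, add_zero]
  linarith

theorem exists_smul_bounds {σ X : A} (hσ : IsStrictlyPositive σ) (hX : IsSelfAdjoint X) :
    ∃ κ : ℝ, 0 < κ ∧ X ≤ κ • σ ∧ -(κ • σ) ≤ X := by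
  obtain ⟨d, hd, hdσ⟩ := hσ.exists_smul_one_le
  have h1 : (‖X‖ + 1) • (1 : A) ≤ ((‖X‖ + 1) / d) • σ := by
    have := smul_le_smul_of_nonneg_left hdσ (by positivity : 0 ≤ (‖X‖ + 1) / d)
    rwa [smul_smul, div_mul_cancel₀ _ hd.ne'] at this
  have h2 : algebraMap ℝ A ‖X‖ ≤ (‖X‖ + 1) • (1 : A) := by
    rw [Algebra.algebraMap_eq_smul_one]
    exact smul_le_smul_of_nonneg_right (by linarith) zero_le_one
  refine ⟨(‖X‖ + 1) / d, by positivity, hX.le_algebraMap_norm_self.trans (h2.trans h1), ?_⟩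
  exact (neg_le_neg (h2.trans h1)).trans hX.neg_algebraMap_norm_le_self

/-- Second-order expansion of the tensorization inequality at the invariant state. -/
theorem l2Form_le_of_approxTensorization (h : IsCondExpPair E E₁ E₂) {σ : A}
    (hσ : IsStrictlyPositive σ) (hσ1 : tr σ = 1) (hinv : tr.predual E σ = σ) {c : ℝ}
    (hAT : tr.ApproxTensorization (tr.predual E) (tr.predual E₁) (tr.predual E₂) c)
    {Y : A} (hY : IsSelfAdjoint Y) (hEY : E Y = 0) (hE₂Y : E₂ Y = Y) :
    tr.l2Form σ Y Y ≤ c * (tr.l2Form σ Y Y - tr.l2Form σ (E₁ Y) (E₁ Y)) := by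
  have hinv₁ := tr.predual_eq_of_comp h.map_left hinv
  have hinv₂ := tr.predual_eq_of_comp h.map_right hinv
  rw [← tr.l2Form_sub_condExp h.left hσ hinv₁]
  -- The direction of perturbation. `E Y = 0` keeps `E_*(σ + ε X) = σ`, and `E₂ Y = Y` makes `σ + ε
  -- X` invariant under `E_{2*}`.
  set X := doubleOp logMean σ σ Y with hXdef
  have hX : IsSelfAdjoint X := by
    rw [isSelfAdjoint_iff, hXdef, star_doubleOp, hY.star_eq]
    exact LinearMap.congr_fun (doubleOp_congr fun x hx y hy =>
      logMean_comm (hσ.spectrum_pos hy) (hσ.spectrum_pos hx)) Y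
  have hΓX : doubleOp invLogMean σ σ X = Y := doubleOp_invLogMean_logMean hσ Y
  have hPX : tr.predual E X = 0 := by
    rw [hXdef, tr.predual_doubleOp_logMean h.condExp hσ hinv, hEY, map_zero]
  have hP₂X : tr.predual E₂ X = X := by
    rw [hXdef, tr.predual_doubleOp_logMean h.right hσ hinv₂, hE₂Y]
  set X₁ := tr.predual E₁ X with hX₁
  have hΓX₁ : doubleOp invLogMean σ σ X₁ = E₁ Y := by
    rw [hX₁, tr.predual_eq_doubleOp h.left hσ hinv₁, hΓX]
  obtain ⟨κ, hκ, hup, hlow⟩ := exists_smul_bounds hσ hX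
  have hup₁ : X₁ ≤ κ • σ := by
    have := tr.predual_mono h.left hup
    rwa [LinearMap.map_smul_of_tower, hinv₁] at this
  have hlow₁ : -(κ • σ) ≤ X₁ := by
    have := tr.predual_mono h.left hlow
    rwa [map_neg, LinearMap.map_smul_of_tower, hinv₁] at this
  have htrX : tr X = 0 := by rw [← tr.map_predual h.condExp, hPX, map_zero]
  have hκε : ∀ ε : ℝ, 0 < ε ∧ ε < κ⁻¹ → 0 < 1 - ε * κ := fun ε hε => by
    have := mul_lt_mul_of_pos_right hε.2 hκ
    rw [inv_mul_cancel₀ hκ.ne'] at this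
    linarith
  have hge : ∀ (ε : ℝ) (Z : A), 0 < ε → -(κ • σ) ≤ Z → (1 - ε * κ) • σ ≤ σ + ε • Z :=
    fun ε Z hε hZ => by
      have := smul_le_smul_of_nonneg_left hZ hε.le
      rw [smul_neg, smul_smul] at this
      rw [sub_smul, one_smul, sub_eq_add_neg]
      exact add_le_add_right this _
  have hle : ∀ (ε : ℝ) (Z : A), 0 < ε → Z ≤ κ • σ → σ + ε • Z ≤ (1 + ε * κ) • σ :=
    fun ε Z hε hZ => by
      have := smul_le_smul_of_nonneg_left hZ hε.le
      rw [smul_smul] at this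
      rw [add_smul, one_smul]
      exact add_le_add_right this _
  -- The bounds `±κ σ` on `X` and `X₁` place every density between `(1 - εκ) σ` and `(1 + εκ) σ`;
  -- after division by `ε²` only these factors still depend on `ε`.
  have hmain : ∀ ε : ℝ, 0 < ε ∧ ε < κ⁻¹ → (1 - ε * κ) * tr.l2Form σ Y Y
      ≤ (1 + ε * κ) * (c * tr.l2Form σ (Y - E₁ Y) (Y - E₁ Y)) := by
    intro ε hε
    have hm := hκε ε hε
    have hp : 0 < 1 + ε * κ := by have := mul_pos hε.1 hκ; linarith
    set ρ := σ + ε • X with hρdef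
    set ω₁ := σ + ε • X₁ with hω₁def
    have hgeρ := hge ε X hε.1 hlow
    have hgeω := hge ε X₁ hε.1 hlow₁
    have hleρ := hle ε X hε.1 hup
    have hleω := hle ε X₁ hε.1 hup₁
    rw [← hρdef] at hgeρ hleρ
    rw [← hω₁def] at hgeω hleω
    have hρ : IsStrictlyPositive ρ := (hσ.smul hm).of_le hgeρ
    have hω₁ : IsStrictlyPositive ω₁ := (hσ.smul hm).of_le hgeω
    have hPρ : tr.predual E ρ = σ := by
      rw [hρdef, map_add, LinearMap.map_smul_of_tower, hPX, hinv, smul_zero, add_zero]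
    have hP₁ρ : tr.predual E₁ ρ = ω₁ := by
      rw [hρdef, map_add, LinearMap.map_smul_of_tower, hinv₁]
    have hP₂ρ : tr.predual E₂ ρ = ρ := by
      rw [hρdef, map_add, LinearMap.map_smul_of_tower, hP₂X, hinv₂]
    have hstate : tr.IsState ρ := ⟨hρ.nonneg, by
      rw [hρdef, map_add, map_real_smul, htrX, hσ1, mul_zero, add_zero]⟩
    have hinvsmul : ∀ Z : A, (1 - ε * κ) • σ ≤ Z → σ ≤ (1 - ε * κ)⁻¹ • Z := fun Z hZ => by
      have := smul_le_smul_of_nonneg_left hZ (inv_pos.2 hm).le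
      rwa [smul_smul, inv_mul_cancel₀ hm.ne', one_smul] at this
    have hT := hAT ρ hstate
    rw [hPρ, hP₁ρ, hP₂ρ, tr.relEntropy_eq_coe hρ.nonneg hσ.nonneg hleρ,
      tr.relEntropy_eq_coe hρ.nonneg hρ.nonneg (k := 1) (by simp),
      tr.relEntropy_eq_coe hρ.nonneg hω₁.nonneg (k := (1 + ε * κ) * (1 - ε * κ)⁻¹) (by
        refine hleρ.trans ?_
        rw [mul_smul]
        exact smul_le_smul_of_nonneg_left (hinvsmul _ hgeω) hp.le),
      ← EReal.coe_add, ← EReal.coe_mul, EReal.coe_le_coe_iff] at hT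
    have hself : tr.relEnt ρ ρ = 0 := by rw [relEnt, sub_self]
    rw [hself, add_zero] at hT
    have e1 : ρ - σ = ε • X := by rw [hρdef]; abel
    have e2 : ρ - ω₁ = ε • (X - X₁) := by rw [hρdef, hω₁def, smul_sub]; abel
    have ht1 : tr.inner 1 (ρ - σ) = 0 := by rw [← hPρ]; exact tr.inner_one_sub_predual h.condExp ρ
    have ht2 : tr.inner 1 (ρ - ω₁) = 0 := by rw [← hP₁ρ]; exact tr.inner_one_sub_predual h.left ρ
    have hσle : σ ≤ (1 + ε * κ) • σ := by
      conv_lhs => rw [← one_smul ℝ σ]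
      exact smul_le_smul_of_nonneg_right (by linarith [mul_pos hε.1 hκ]) hσ.nonneg
    have h1 := tr.l2Form_le_relEnt hρ hσ hσ hp hleρ hσle ht1
    have h2 := tr.relEnt_le_l2Form hρ hω₁ hσ (inv_pos.2 hm) (hinvsmul _ hgeρ) (hinvsmul _ hgeω) ht2
    have h0 := tr.relEnt_nonneg_of_pos hρ hω₁ ht2
    rw [e1, LinearMap.map_smul_of_tower, hΓX] at h1
    rw [e2, LinearMap.map_smul_of_tower, map_sub, hΓX, hΓX₁] at h2
    simp only [map_smul, LinearMap.smul_apply, smul_eq_mul] at h1 h2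
    have hq := tr.l2Form_self_nonneg hσ Y
    rw [inv_mul_eq_div, le_div_iff₀ hm] at h2
    set q := tr.l2Form σ Y Y
    set q' := tr.l2Form σ (Y - E₁ Y) (Y - E₁ Y)
    have hε2 : 0 < ε * ε := mul_pos hε.1 hε.1
    -- A negative `c` would force the entropy to `σ` to vanish, hence `Y = 0`, and the inequality is
    -- trivial.
    rcases le_or_gt 0 c with hc | hc
    · have h3 : ε * (ε * q) ≤ 2 * (1 + ε * κ) * (c * tr.relEnt ρ ω₁) :=
        h1.trans (mul_le_mul_of_nonneg_left hT (by positivity))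
      have h4 : (1 - ε * κ) * (ε * (ε * q)) ≤ (1 + ε * κ) * (c * (ε * (ε * q'))) := by
        calc _ ≤ (1 - ε * κ) * (2 * (1 + ε * κ) * (c * tr.relEnt ρ ω₁)) :=
              mul_le_mul_of_nonneg_left h3 hm.le
          _ = (1 + ε * κ) * (c * (2 * tr.relEnt ρ ω₁ * (1 - ε * κ))) := by ring
          _ ≤ _ := mul_le_mul_of_nonneg_left (mul_le_mul_of_nonneg_left h2 hc) hp.le
      refine le_of_mul_le_mul_left ?_ hε2
      linarith
    · have h3 : c * tr.relEnt ρ ω₁ ≤ 0 := mul_nonpos_of_nonpos_of_nonneg hc.le h0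
      have h4 : ε * (ε * q) ≤ 0 :=
        h1.trans (mul_nonpos_of_nonneg_of_nonpos (by positivity) (hT.trans h3))
      have hq0 : q = 0 := by
        refine le_antisymm ?_ hq
        by_contra hlt
        have := mul_pos hε2 (not_le.1 hlt)
        linarith
      have hY0 : Y = 0 := by
        by_contra hne
        exact (tr.l2Form_self_pos hσ hne).ne' hq0
      have hq'0 : q' = 0 := by simp [q', hY0]
      rw [hq0, hq'0]
      simp
  have hev : ∀ᶠ ε : ℝ in 𝓝[>] 0, 0 < ε ∧ ε < κ⁻¹ := by
    filter_upwards [Ioo_mem_nhdsGT (inv_pos.2 hκ)] with ε hε using hε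
  have hl : ∀ s r : ℝ, Tendsto (fun ε : ℝ => (1 + ε * s) * r) (𝓝[>] 0) (𝓝 r) := fun s r => by
    have : Tendsto (fun ε : ℝ => (1 + ε * s) * r) (𝓝 0) (𝓝 ((1 + 0 * s) * r)) :=
      (by fun_prop : Continuous fun ε : ℝ => (1 + ε * s) * r).tendsto 0
    rw [zero_mul, add_zero, one_mul] at this
    exact this.mono_left nhdsWithin_le_nhds
  refine le_of_tendsto_of_tendsto (hl (-κ) _) (hl κ _) ?_
  filter_upwards [hev] with ε hε
  have := hmain ε hε
  rwa [mul_neg, ← sub_eq_add_neg]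

/-- Perturbing states only reaches self-adjoint directions. Real and imaginary parts are orthogonal
in `L₂(σ)` and are respected by the expectations, so the two inequalities add. -/
theorem l2Form_le_of_approxTensorization' (h : IsCondExpPair E E₁ E₂) {σ : A}
    (hσ : IsStrictlyPositive σ) (hσ1 : tr σ = 1) (hinv : tr.predual E σ = σ) {c : ℝ}
    (hAT : tr.ApproxTensorization (tr.predual E) (tr.predual E₁) (tr.predual E₂) c)
    {Y : A} (hEY : E Y = 0) (hE₂Y : E₂ Y = Y) :
    tr.l2Form σ Y Y ≤ c * (tr.l2Form σ Y Y - tr.l2Form σ (E₁ Y) (E₁ Y)) := by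
  have hre : ∀ F : A →ₗ[ℂ] A, IsCondExp F → ∀ X, F (realPart X : A) = (realPart (F X) : A) ∧
      F (imaginaryPart X : A) = (imaginaryPart (F X) : A) := fun F hF X => by
    simp only [realPart_apply_coe, imaginaryPart_apply_coe, LinearMap.map_smul_of_tower, map_add,
      map_sub, map_smul, hF.map_star, and_self]
  have hsplit : ∀ X : A, tr.l2Form σ X X = tr.l2Form σ (realPart X : A) (realPart X : A)
      + tr.l2Form σ (imaginaryPart X : A) (imaginaryPart X : A) := fun X => by
    rw [← tr.l2Form_add_I_smul hσ (realPart X).2 (imaginaryPart X).2,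
      realPart_add_I_smul_imaginaryPart]
  have h1 := tr.l2Form_le_of_approxTensorization h hσ hσ1 hinv hAT (realPart Y).2
    (by rw [(hre E h.condExp Y).1, hEY]; simp) (by rw [(hre E₂ h.right Y).1, hE₂Y])
  have h2 := tr.l2Form_le_of_approxTensorization h hσ hσ1 hinv hAT (imaginaryPart Y).2
    (by rw [(hre E h.condExp Y).2, hEY]; simp) (by rw [(hre E₂ h.right Y).2, hE₂Y])
  rw [(hre E₁ h.left Y).1] at h1
  rw [(hre E₁ h.left Y).2] at h2
  rw [hsplit Y, hsplit (E₁ Y)]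
  linarith

/-- One nonzero `Y` forces `c > 0` and `c⁻¹ ≤ 1`. The quadratic inequality at `E₂(X - E X)`, for
every `X`, then bounds the squared norm of `E₁E₂ - E` by `1 - c⁻¹`. -/
theorem one_div_le_of_approxTensorization (h : IsCondExpPair E E₁ E₂) {σ : A}
    (hσ : IsStrictlyPositive σ) (hσ1 : tr σ = 1) (hinv : tr.predual E σ = σ) {c : ℝ}
    (hAT : tr.ApproxTensorization (tr.predual E) (tr.predual E₁) (tr.predual E₂) c)
    {Y : A} (hY : Y ≠ 0) (hEY : E Y = 0) (hE₂Y : E₂ Y = Y) :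
    1 / (1 - tr.l2OpNorm σ (E₁ ∘ₗ E₂ - E) ^ 2) ≤ c := by
  have hinv₂ := tr.predual_eq_of_comp h.map_right hinv
  have hinv₁ := tr.predual_eq_of_comp h.map_left hinv
  have hq := fun {V : A} (h1 : E V = 0) (h2 : E₂ V = V) =>
    tr.l2Form_le_of_approxTensorization' h hσ hσ1 hinv hAT h1 h2
  have hY1 := hq hEY hE₂Y
  have hYpos := tr.l2Form_self_pos hσ hY
  have hY2 := tr.l2Form_condExp_le h.left hσ hinv₁ Y
  have hc : 0 < c := by
    by_contra hc
    have := mul_nonpos_of_nonpos_of_nonneg (not_lt.1 hc) (sub_nonneg.2 hY2)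
    linarith
  have hK : ∀ V : A, E V = 0 → E₂ V = V →
      tr.l2Form σ (E₁ V) (E₁ V) ≤ (1 - c⁻¹) * tr.l2Form σ V V := fun V h1 h2 => by
    have h3 := hq h1 h2
    rw [← inv_mul_le_iff₀ hc] at h3
    linarith
  have hK0 : 0 ≤ 1 - c⁻¹ := by
    by_contra hneg
    have h1 := hK Y hEY hE₂Y
    have h2 := tr.l2Form_self_nonneg hσ (E₁ Y)
    have h3 := mul_neg_of_neg_of_pos (not_le.1 hneg) hYpos
    linarith
  have hnorm := tr.l2OpNorm_le_sqrt hσ (T := E₁ ∘ₗ E₂ - E) hK0 fun X => by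
    have e1 : (E₁ ∘ₗ E₂ - E) X = E₁ (E₂ (X - E X)) := by
      simp [h.right_map, h.left_map]
    have h1 := hK (E₂ (X - E X)) (by simp [h.map_right, h.condExp.idem]) (h.right.idem _)
    have h2 := tr.l2Form_condExp_le h.right hσ hinv₂ (X - E X)
    have h3 := tr.l2Form_sub_condExp h.condExp hσ hinv X
    have h4 := tr.l2Form_self_nonneg hσ (E X)
    rw [e1]
    exact h1.trans (mul_le_mul_of_nonneg_left (by linarith) hK0)
  have h0 : 0 ≤ tr.l2OpNorm σ (E₁ ∘ₗ E₂ - E) := tr.l2OpNorm_nonneg _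
  have hsq := pow_le_pow_left₀ h0 hnorm 2
  rw [Real.sq_sqrt hK0] at hsq
  have hcinv : c⁻¹ ≤ 1 - tr.l2OpNorm σ (E₁ ∘ₗ E₂ - E) ^ 2 := by linarith
  rw [one_div]
  exact inv_le_of_inv_le₀ hc hcinv

end LowerBound

end FaithfulTrace

/-! ### Transfer between the algebra and its amplifications -/

section Transfer

variable {A B : Type*} [CStarAlgebra A] [PartialOrder A] [StarOrderedRing A]
  [FiniteDimensional ℂ A] [CStarAlgebra B] [PartialOrder B] [StarOrderedRing B]

omit [PartialOrder A] [StarOrderedRing A] [PartialOrder B] [StarOrderedRing B] in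
theorem StarAlgHom.map_cfc_of_finiteDimensional (φ : A →⋆ₐ[ℂ] B) (f : ℝ → ℝ) {a : A}
    (ha : IsSelfAdjoint a) : φ (cfc f a) = cfc f (φ a) :=
  StarAlgHomClass.map_cfc φ f a (continuousOn_real_spectrum a f)
    (LinearMap.continuous_of_finiteDimensional φ.toAlgHom.toLinearMap) ha (ha.map φ)

omit [StarOrderedRing A] [StarOrderedRing B] in
-- Star homomorphisms commute with the functional calculus, and the order embedding preserves the
-- support condition in both directions.
theorem FaithfulTrace.relEntropy_map (tr : FaithfulTrace A) (tr' : FaithfulTrace B)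
    (φ : A →⋆ₐ[ℂ] B) (hφ : ∀ a b, φ a ≤ φ b ↔ a ≤ b) (htr : ∀ a, tr' (φ a) = tr a) {ρ ω : A}
    (hρ : IsSelfAdjoint ρ) (hω : IsSelfAdjoint ω) :
    tr'.relEntropy (φ ρ) (φ ω) = tr.relEntropy ρ ω := by
  have h1 : ∀ a : A, IsSelfAdjoint a → supportProj (φ a) = φ (supportProj a) := fun a ha =>
    (φ.map_cfc_of_finiteDimensional _ ha).symm
  have h2 : ∀ a : A, IsSelfAdjoint a → CFC.log (φ a) = φ (CFC.log a) := fun a ha =>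
    (φ.map_cfc_of_finiteDimensional _ ha).symm
  rw [relEntropy, relEntropy, h1 ρ hρ, h1 ω hω, h2 ρ hρ, h2 ω hω, hφ, ← map_mul, ← map_mul,
    ← map_sub, htr]

/-- The embedding `a ↦ a ⊗ 1` as a star algebra homomorphism. -/
def CStarMatrix.diagHom (n : ℕ) : A →⋆ₐ[ℂ] CStarMatrix (Fin n) (Fin n) A where
  toFun := CStarMatrix.diag n
  map_one' := CStarMatrix.diag_one
  map_mul' := CStarMatrix.diag_mul
  map_zero' := by ext i j; rw [CStarMatrix.diag_apply]; split_ifs <;> rfl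
  map_add' a b := by
    ext i j
    rw [CStarMatrix.add_apply, CStarMatrix.diag_apply, CStarMatrix.diag_apply,
      CStarMatrix.diag_apply]
    split_ifs <;> simp
  commutes' r := by
    rw [Algebra.algebraMap_eq_smul_one, CStarMatrix.diag_smul, CStarMatrix.diag_one,
      Algebra.algebraMap_eq_smul_one]
  map_star' a := (CStarMatrix.star_diag a).symm

omit [FiniteDimensional ℂ A] in
theorem CStarMatrix.diag_le_diag_iff {n : ℕ} [NeZero n] {a b : A} :
    diag n a ≤ diag n b ↔ a ≤ b := by
  refine ⟨fun h => ?_, diag_mono⟩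
  have h1 := sub_nonneg.2 h
  rw [← diag_sub] at h1
  obtain ⟨s, hs⟩ := exists_eq_star_mul_self_of_nonneg h1
  have h2 := congrFun (congrFun hs 0) 0
  rw [CStarMatrix.diag_apply, if_pos rfl, CStarMatrix.mul_apply] at h2
  rw [← sub_nonneg, h2]
  exact Finset.sum_nonneg fun i _ => by
    rw [CStarMatrix.star_apply]; exact star_mul_self_nonneg _

/-- The case `n = 1`, transported along `a ↦ a ⊗ 1`; it reduces the complete lower bound to the
plain one. -/
theorem FaithfulTrace.CompleteApproxTensorization.approxTensorization {tr : FaithfulTrace A}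
    {Φ Φ₁ Φ₂ : A →ₗ[ℂ] A} {c : ℝ} (h : tr.CompleteApproxTensorization Φ Φ₁ Φ₂ c)
    (hΦ : ∀ X, IsSelfAdjoint X → IsSelfAdjoint (Φ X))
    (hΦ₁ : ∀ X, IsSelfAdjoint X → IsSelfAdjoint (Φ₁ X))
    (hΦ₂ : ∀ X, IsSelfAdjoint X → IsSelfAdjoint (Φ₂ X)) :
    tr.ApproxTensorization Φ Φ₁ Φ₂ c := by
  intro ρ hρ
  have hsρ := hρ.1.isSelfAdjoint
  have htr : ∀ a, tr.amplify 1 (CStarMatrix.diagHom 1 a) = tr a := fun a => by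
    rw [amplify_apply, Fin.sum_univ_one]; rfl
  have hent := fun {ω : A} (hω : IsSelfAdjoint ω) => tr.relEntropy_map (tr.amplify 1)
    (CStarMatrix.diagHom 1) (fun _ _ => CStarMatrix.diag_le_diag_iff) htr hsρ hω
  have hampl : ∀ Ψ : A →ₗ[ℂ] A, ampl 1 Ψ (CStarMatrix.diagHom 1 ρ)
      = CStarMatrix.diagHom 1 (Ψ ρ) := fun Ψ => by
    ext i j
    rw [Subsingleton.elim i 0, Subsingleton.elim j 0]
    rfl
  have := h 1 (CStarMatrix.diagHom 1 ρ) ⟨CStarMatrix.diag_nonneg hρ.1, (htr ρ).trans hρ.2⟩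
  rwa [hampl, hampl, hampl, hent (hΦ _ hsρ), hent (hΦ₁ _ hsρ), hent (hΦ₂ _ hsρ)] at this

end Transfer

namespace FaithfulTrace

section Amplified

variable {A : Type*} [CStarAlgebra A] [PartialOrder A] [StarOrderedRing A]
  [FiniteDimensional ℂ A] (tr : FaithfulTrace A) {E E₁ E₂ : A →ₗ[ℂ] A}

/-- The index and the completely bounded index are bounded by the same constant. -/
theorem exists_index_le (hE : IsCondExp E) (hEn : ∀ n, IsCondExp (ampl n E)) {σ : A}
    (hσ : IsStrictlyPositive σ) (hinv : tr.predual E σ = σ) :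
    ∃ c : ℝ, tr.index E ≤ ENNReal.ofReal c ∧ tr.cbIndex E ≤ ENNReal.ofReal c := by
  obtain ⟨m, u, v, α, hf⟩ := tr.exists_isFrame hE hσ hinv
  have hle : ∀ {B : Type _} [CStarAlgebra B] [PartialOrder B] [StarOrderedRing B]
      {F : B →ₗ[ℂ] B} {u v : Fin m → B}, IsCondExp F → IsFrame F u v α → ∀ x : B,
      star x * x ≤ ((m : ℝ) ^ 2 * α ^ 2 + 1) • F (star x * x) := by
    intro B _ _ _ F u v hF hfr x
    have h1 := hfr.star_mul_self_le hF x
    rw [Fintype.card_fin] at h1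
    exact h1.trans (smul_le_smul_of_nonneg_right (by linarith)
      (hF.nonneg _ (star_mul_self_nonneg x)))
  -- The added 1 keeps the constant positive when `m` or `α` vanishes, as the definition of the
  -- index demands.
  have hpos : 0 < (m : ℝ) ^ 2 * α ^ 2 + 1 := by positivity
  refine ⟨(m : ℝ) ^ 2 * α ^ 2 + 1, tr.index_le_ofReal hE hpos (hle hE hf), iSup_le fun n => ?_⟩
  exact (tr.amplify n).index_le_ofReal (hEn n) hpos (hle (hEn n) (hf.ampl n))

theorem predual_ampl_diag {σ : A} (hinv : tr.predual E σ = σ) (n : ℕ) :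
    (tr.amplify n).predual (ampl n E) (CStarMatrix.diag n σ) = CStarMatrix.diag n σ := by
  rw [predual_ampl]
  ext i j
  rw [ampl_apply, CStarMatrix.diag_apply]
  split_ifs
  · exact hinv
  · exact map_zero _

/-- The witness is `σ ⊗ 1 / n`, normalized for the unnormalized trace on matrices; hence `n ≠ 0`. -/
theorem exists_isState_ampl {σ : A} (hσ : IsStrictlyPositive σ) (hσ1 : tr σ = 1)
    (hinv : tr.predual E σ = σ) (n : ℕ) [NeZero n] :
    ∃ τ, IsStrictlyPositive τ ∧ tr.amplify n τ = 1 ∧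
      (tr.amplify n).predual (ampl n E) τ = τ := by
  have hn : (0 : ℝ) < n := by exact_mod_cast Nat.pos_of_ne_zero (NeZero.ne n)
  have hn' : (n : ℂ) ≠ 0 := by exact_mod_cast NeZero.ne n
  have hsmul : IsUnit ((n : ℂ)⁻¹ • σ) := by
    have := hσ.isUnit.smul (Units.mk0 ((n : ℂ)⁻¹) (inv_ne_zero hn'))
    exact this
  have hnonneg : 0 ≤ (n : ℂ)⁻¹ • σ := by
    have h1 : 0 ≤ (n : ℝ)⁻¹ • σ := smul_nonneg (inv_nonneg.2 hn.le) hσ.nonneg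
    rwa [← Complex.coe_smul, Complex.ofReal_inv, Complex.ofReal_natCast] at h1
  refine ⟨CStarMatrix.diag n ((n : ℂ)⁻¹ • σ), ?_, ?_, ?_⟩
  · exact (hsmul.map (CStarMatrix.diagHom (A := A) n)).isStrictlyPositive
      (CStarMatrix.diag_nonneg hnonneg)
  · simp [amplify_apply, CStarMatrix.diag_apply, hσ1, hn']
  · exact tr.predual_ampl_diag (by rw [map_smul, hinv]) n

end Amplified

end FaithfulTrace

end

/-! ### The main theorem -/

theorem theorem3 {M : Type*} [CStarAlgebra M] [PartialOrder M] [StarOrderedRing M]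
    [FiniteDimensional ℂ M] (tr : FaithfulTrace M)
    (N N₁ N₂ : StarSubalgebra ℂ M) (hN : N = N₁ ⊓ N₂)
    (E E₁ E₂ : M →ₗ[ℂ] M)
    (hE : IsConditionalExpectation N E)
    (hE₁ : IsConditionalExpectation N₁ E₁)
    (hE₂ : IsConditionalExpectation N₂ E₂)
    (h₁ : E ∘ₗ E₁ = E) (h₂ : E ∘ₗ E₂ = E)
    (σ : M) (hσ : tr.IsState σ) (hσ_inv : tr.predual E σ = σ) (hσ_full : IsUnit σ)
    (lam : ℝ) (hlam : lam = tr.l2OpNorm σ (E₁ ∘ₗ E₂ - E)) :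
    lam < 1 ∧
    tr.index E ≠ ∞ ∧
    tr.cbIndex E ≠ ∞ ∧
    -- upper bounds: the inequalities hold with these constants
    tr.ApproxTensorization (tr.predual E) (tr.predual E₁) (tr.predual E₂)
      (2 * (tr.index E).toReal / (1 - lam) ^ 2) ∧
    tr.CompleteApproxTensorization (tr.predual E) (tr.predual E₁) (tr.predual E₂)
      (2 * (tr.cbIndex E).toReal / (1 - lam) ^ 2) ∧
    -- lower bounds: every admissible constant is at least `1 / (1 - lam ^ 2)`
    (N₁ ≠ N ∨ N₂ ≠ N → ∀ c : ℝ,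
      (tr.ApproxTensorization (tr.predual E) (tr.predual E₁) (tr.predual E₂) c →
        1 / (1 - lam ^ 2) ≤ c) ∧
      (tr.CompleteApproxTensorization (tr.predual E) (tr.predual E₁) (tr.predual E₂) c →
        1 / (1 - lam ^ 2) ≤ c)) := by
  have hpos : IsStrictlyPositive σ := hσ_full.isStrictlyPositive hσ.1
  have hpair := IsConditionalExpectation.isCondExpPair hN hE hE₁ hE₂ h₁ h₂
  have hEn := fun n => hpair.condExp.ampl n (hE.completelyPositive n)
  have hE₁n := fun n => hpair.left.ampl n (hE₁.completelyPositive n)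
  have hE₂n := fun n => hpair.right.ampl n (hE₂.completelyPositive n)
  obtain ⟨C, hC, hCcb⟩ := tr.exists_index_le hpair.condExp hEn hpos hσ_inv
  have hfin : tr.index E ≠ ∞ := ne_top_of_le_ne_top ENNReal.ofReal_ne_top hC
  have hfincb : tr.cbIndex E ≠ ∞ := ne_top_of_le_ne_top ENNReal.ofReal_ne_top hCcb
  have hlam0 : 0 ≤ lam := hlam ▸ tr.l2OpNorm_nonneg _
  have hlam1 : lam < 1 := hlam ▸ tr.l2OpNorm_lt_one hpair hpos hσ_inv
  have hbound : ∀ X, tr.l2Form σ ((E₁ ∘ₗ E₂ - E) X) ((E₁ ∘ₗ E₂ - E) X)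
      ≤ lam ^ 2 * tr.l2Form σ X X := fun X => by
    rw [hlam]
    exact tr.l2Form_comp_sub_le hpair hpos hσ_inv X
  have hgrowth := tr.abs_inner_sandwich_pow_le hpair hpos hσ_inv hbound (sq_nonneg lam)
  have hlower : N₁ ≠ N ∨ N₂ ≠ N → ∀ c : ℝ,
      tr.ApproxTensorization (tr.predual E) (tr.predual E₁) (tr.predual E₂) c →
        1 / (1 - lam ^ 2) ≤ c := by
    intro hne c hAT
    -- The lower bound needs a nonzero `Y` fixed by `E₂` with `E Y = 0`, which exists only if `N₂`
    -- exceeds `N`. Otherwise `E₁E₂ = E`, so `lam = 0` and only `c ≥ 1` is required; this follows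
    -- with the two expectations exchanged.
    by_cases hN₂ : N₂ ≤ N
    · have hN₂' : N₂ = N := le_antisymm hN₂ (hN ▸ inf_le_right)
      have hN₁ : ¬ N₁ ≤ N := fun h => by
        rcases hne with h' | h'
        · exact h' (le_antisymm h (hN ▸ inf_le_left))
        · exact h' hN₂'
      obtain ⟨y, hy, hyN⟩ := SetLike.not_le_iff_exists.1 hN₁
      have hswap : tr.ApproxTensorization (tr.predual E) (tr.predual E₂) (tr.predual E₁) c :=
        fun ρ hρ => by rw [add_comm]; exact hAT ρ hρ
      have hle := tr.one_div_le_of_approxTensorization hpair.symm hpos hσ.2 hσ_inv hswap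
        (Y := y - E y) (fun h0 => hyN (sub_eq_zero.1 h0 ▸ hE.mem y))
        (by rw [map_sub, hpair.condExp.idem, sub_self])
        (by rw [map_sub, hpair.left_map, hE₁.fixes y hy])
      have hzero : E₁ ∘ₗ E₂ - E = 0 := by
        ext X
        have h3 : E₂ X ∈ N := hN₂ (hE₂.mem X)
        have h4 := hpair.map_right X
        rw [hE.fixes _ h3] at h4
        rw [LinearMap.sub_apply, LinearMap.comp_apply, h4, hpair.left_map, sub_self]
        rfl
      have hlam_zero : lam = 0 := by
        refine le_antisymm ?_ hlam0
        have := tr.l2OpNorm_le_sqrt hpos (T := E₁ ∘ₗ E₂ - E) le_rfl fun X => by simp [hzero]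
        rwa [Real.sqrt_zero, ← hlam] at this
      refine le_trans ?_ hle
      have h5 := tr.l2OpNorm_lt_one hpair.symm hpos hσ_inv
      have h6 : 0 ≤ tr.l2OpNorm σ (E₂ ∘ₗ E₁ - E) := tr.l2OpNorm_nonneg _
      rw [hlam_zero]
      apply one_div_le_one_div_of_le
      · nlinarith
      · nlinarith
    · obtain ⟨y, hy, hyN⟩ := SetLike.not_le_iff_exists.1 hN₂
      rw [hlam]
      exact tr.one_div_le_of_approxTensorization hpair hpos hσ.2 hσ_inv hAT
        (Y := y - E y) (fun h0 => hyN (sub_eq_zero.1 h0 ▸ hE.mem y))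
        (by rw [map_sub, hpair.condExp.idem, sub_self])
        (by rw [map_sub, hpair.right_map, hE₂.fixes y hy])
  refine ⟨hlam1, hfin, hfincb, ?_, ?_, fun hne c => ⟨hlower hne c, fun hAT => hlower hne c ?_⟩⟩
  · exact tr.approxTensorization_of_growth hpair hpos hσ.2 hσ_inv hlam0 hlam1 hgrowth
      (ENNReal.ofReal_toReal hfin).ge ENNReal.toReal_nonneg
  · intro n
    -- For `n = 0` the trace is zero, so there are no states.
    rcases eq_or_ne n 0 with rfl | hn
    · intro ρ hρ
      have := hρ.2
      simp [FaithfulTrace.amplify_apply] at this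
    · have : NeZero n := ⟨hn⟩
      obtain ⟨τ, hτ, hτ1, hτinv⟩ := tr.exists_isState_ampl hpos hσ.2 hσ_inv n
      rw [← tr.predual_ampl, ← tr.predual_ampl, ← tr.predual_ampl]
      exact (tr.amplify n).approxTensorization_of_growth
        (hpair.ampl (hEn n) (hE₁n n) (hE₂n n)) hτ hτ1 hτinv hlam0 hlam1
        (tr.growth_ampl hgrowth n)
        ((le_iSup (fun n => (tr.amplify n).index (ampl n E)) n).trans
          (ENNReal.ofReal_toReal hfincb).ge) ENNReal.toReal_nonneg
  · exact hAT.approxTensorization (fun _ => tr.isSelfAdjoint_predual hpair.condExp)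
      (fun _ => tr.isSelfAdjoint_predual hpair.left)
      (fun _ => tr.isSelfAdjoint_predual hpair.right)
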